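/- An instance of the travelling salesman problem (TSP) of size $n\ge 1$ is a distance function $d:[n]\times[n]\to\mathbb R$ (not necessarily symmetric, nonnegative or metric), and solving it means computing $\min_{\pi}\bigl(d(\pi(n),\pi(1))+\sum_{i=1}^{n-1}d(\pi(i),\pi(i+1))\bigr)$ over all permutations $\pi$ of $[n]$. Call a pair $(S,T)$ of reals with $S,T\ge 1$ a feasible space-time tradeoff for TSP if there is a deterministic algorithm that solves every instance of size $n$ simultaneously in time at most $T^{n+o(n)}$ and space at most $S^{n+o(n)}$, where the $o(n)$ terms depend on $n$ only. Here an algorithm is a single program for a unit-cost random access machine with words of $O(n)$ bits, which reads $d$ from a read-only input; lengths are real numbers, held in cells of their own, that can only be read from the input, set to zero, copied, added, subtracted and compared, and every length cell may only hold a value assembled from at most $2^{O(n)}$ (counted with multiplicity) input distances. Time is the number of executed steps and space is the number of memory cells. Theorem. There is a real number $T<1.786\cdot\sqrt2$, so that $\sqrt2\cdot T<3.572$, such that $(\sqrt2,T)$ is a feasible space-time tradeoff for TSP. -/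

import Mathlib

open scoped Asymptotics
open Filter

namespace TSP

/-! ### The problem -/

/-- Length of the tour that visits the cities in the order `π 0, π 1, …, π (n-1)` and then
returns to `π 0` (`finRotate n` is the cyclic successor on `Fin n`). The distances are
arbitrary reals: not necessarily symmetric, nonnegative or metric. -/
noncomputable def tourLength {n : ℕ} (d : Fin n → Fin n → ℝ) (π : Equiv.Perm (Fin n)) : ℝ :=
  ∑ i, d (π i) (π (finRotate n i))

/-- `x` is the optimal value of the instance `d`: the minimum length of a tour. -/
def IsOptimum {n : ℕ} (d : Fin n → Fin n → ℝ) (x : ℝ) : Prop :=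
  IsLeast (Set.range (tourLength d)) x

/-! ### The machine model

A deterministic word RAM with unit-cost instructions. Integers are machine words. Lengths are real
numbers, kept in cells of their own, which can only be loaded from the input, copied, added,
subtracted and compared. -/

/-- A length cell. `val` is the stored real; `terms` counts (with multiplicity) the input distances
it was assembled from. The latter is bounded by the word size, the analogue of the overflow
condition on words: thus a length cell always holds an integer combination of input distances with
coefficients of at most word size, and no unbounded amount of information can be packed
into it. -/
structure Length where
  val : ℝ
  terms : ℕ

/-- A configuration: the registers, the word memory and the length memory. -/
structure Config where
  reg : ℕ → ℕ
  mem : ℕ → ℕ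
  len : ℕ → Length

/-- Word operations. -/
inductive Op
  | add | sub | mul | div | mod | land | lor | xor | shl | shr | lt | eq

/-- Semantics of the word operations (subtraction is truncated, comparisons give `0` or `1`). -/
def Op.eval : Op → ℕ → ℕ → ℕ
  | .add, a, b => a + b
  | .sub, a, b => a - b
  | .mul, a, b => a * b
  | .div, a, b => a / b
  | .mod, a, b => a % b
  | .land, a, b => a &&& b
  | .lor, a, b => a ||| b
  | .xor, a, b => a ^^^ b
  | .shl, a, b => a <<< b
  | .shr, a, b => a >>> b
  | .lt, a, b => if a < b then 1 else 0
  | .eq, a, b => if a = b then 1 else 0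

/-- Elementary instructions. The arguments are register numbers (and a constant in `const`);
memory is only addressed through registers. -/
inductive Instr
  /-- `reg i := c` -/
  | const (i c : ℕ)
  /-- `reg i := o (reg j) (reg k)` -/
  | op (o : Op) (i j k : ℕ)
  /-- `reg i := mem (reg j)` -/
  | load (i j : ℕ)
  /-- `mem (reg i) := reg j` -/
  | store (i j : ℕ)
  /-- `len (reg i) := 0` -/
  | zeroLen (i : ℕ)
  /-- `len (reg i) := d (reg j) (reg k)`, the access to the input -/
  | readDist (i j k : ℕ)
  /-- `len (reg i) := len (reg j)` -/
  | copyLen (i j : ℕ)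
  /-- `len (reg i) := len (reg j) + len (reg k)` -/
  | addLen (i j k : ℕ)
  /-- `len (reg i) := len (reg j) - len (reg k)` -/
  | subLen (i j k : ℕ)
  /-- `reg i := 1` if `len (reg j) ≤ len (reg k)`, and `reg i := 0` otherwise -/
  | leLen (i j k : ℕ)

/-- An instruction can be executed, on an instance with `n` cities and a machine with `w`-bit words,
`s` cells of word memory and `s` cells of length memory, if no word overflows, no address
outside the memory is used, and no distance is read that is not in the input. -/
def Instr.Legal (n w s : ℕ) (σ : Config) : Instr → Prop
  | .const _ c => c < 2 ^ w
  | .op o _ j k => o.eval (σ.reg j) (σ.reg k) < 2 ^ w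
  | .load _ j => σ.reg j < s
  | .store i _ => σ.reg i < s
  | .zeroLen i => σ.reg i < s
  | .readDist i j k => σ.reg i < s ∧ σ.reg j < n ∧ σ.reg k < n
  | .copyLen i j => σ.reg i < s ∧ σ.reg j < s
  | .addLen i j k => σ.reg i < s ∧ σ.reg j < s ∧ σ.reg k < s ∧
      (σ.len (σ.reg j)).terms + (σ.len (σ.reg k)).terms < 2 ^ w
  | .subLen i j k => σ.reg i < s ∧ σ.reg j < s ∧ σ.reg k < s ∧
      (σ.len (σ.reg j)).terms + (σ.len (σ.reg k)).terms < 2 ^ w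
  | .leLen _ j k => σ.reg j < s ∧ σ.reg k < s

/-- Write a word into a register. -/
def Config.setReg (σ : Config) (i v : ℕ) : Config :=
  { σ with reg := Function.update σ.reg i v }

/-- Write a word into the word memory. -/
def Config.setMem (σ : Config) (a v : ℕ) : Config :=
  { σ with mem := Function.update σ.mem a v }

/-- Write a length into the length memory. -/
def Config.setLen (σ : Config) (a : ℕ) (x : Length) : Config :=
  { σ with len := Function.update σ.len a x }

/-- Extension of the distance function by `0` to all pairs of natural numbers (the additional
values are never accessed by a legal instruction). -/
noncomputable def distAt {n : ℕ} (d : Fin n → Fin n → ℝ) (a b : ℕ) : ℝ :=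
  if h : a < n ∧ b < n then d ⟨a, h.1⟩ ⟨b, h.2⟩ else 0

open Classical in
/-- The effect of an instruction on the configuration, for the instance `d`. -/
noncomputable def Instr.apply {n : ℕ} (d : Fin n → Fin n → ℝ) (σ : Config) : Instr → Config
  | .const i c => σ.setReg i c
  | .op o i j k => σ.setReg i (o.eval (σ.reg j) (σ.reg k))
  | .load i j => σ.setReg i (σ.mem (σ.reg j))
  | .store i j => σ.setMem (σ.reg i) (σ.reg j)
  | .zeroLen i => σ.setLen (σ.reg i) ⟨0, 0⟩
  | .readDist i j k => σ.setLen (σ.reg i) ⟨distAt d (σ.reg j) (σ.reg k), 1⟩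
  | .copyLen i j => σ.setLen (σ.reg i) (σ.len (σ.reg j))
  | .addLen i j k => σ.setLen (σ.reg i)
      ⟨(σ.len (σ.reg j)).val + (σ.len (σ.reg k)).val,
        (σ.len (σ.reg j)).terms + (σ.len (σ.reg k)).terms⟩
  | .subLen i j k => σ.setLen (σ.reg i)
      ⟨(σ.len (σ.reg j)).val - (σ.len (σ.reg k)).val,
        (σ.len (σ.reg j)).terms + (σ.len (σ.reg k)).terms⟩
  | .leLen i j k => σ.setReg i
      (if (σ.len (σ.reg j)).val ≤ (σ.len (σ.reg k)).val then 1 else 0)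

/-- Programs: finite objects, built from the instructions by composition, branching and loops
(both controlled by whether a register is nonzero). -/
inductive Prog
  | instr (c : Instr)
  | seq (p q : Prog)
  | ite (r : ℕ) (p q : Prog)
  | loop (r : ℕ) (p : Prog)

/-- `Exec d w s p σ t τ`: started in the configuration `σ`, on the instance `d` and a machine with
`w`-bit words and `s` cells in each of the two memories, the program `p` halts after exactly `t`
steps, without having executed an illegal instruction, in the configuration `τ`. Every instruction
and every test costs one step. -/
inductive Exec {n : ℕ} (d : Fin n → Fin n → ℝ) (w s : ℕ) :
    Prog → Config → ℕ → Config → Prop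
  | instr (c : Instr) (σ : Config) (h : c.Legal n w s σ) :
      Exec d w s (.instr c) σ 1 (c.apply d σ)
  | seq (p q : Prog) (σ τ ρ : Config) (t u : ℕ) (hp : Exec d w s p σ t τ)
      (hq : Exec d w s q τ u ρ) : Exec d w s (.seq p q) σ (t + u) ρ
  | ite_true (r : ℕ) (p q : Prog) (σ τ : Config) (t : ℕ) (h : σ.reg r ≠ 0)
      (hp : Exec d w s p σ t τ) : Exec d w s (.ite r p q) σ (t + 1) τ
  | ite_false (r : ℕ) (p q : Prog) (σ τ : Config) (t : ℕ) (h : σ.reg r = 0)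
      (hq : Exec d w s q σ t τ) : Exec d w s (.ite r p q) σ (t + 1) τ
  | loop_done (r : ℕ) (p : Prog) (σ : Config) (h : σ.reg r = 0) :
      Exec d w s (.loop r p) σ 1 σ
  | loop_step (r : ℕ) (p : Prog) (σ τ ρ : Config) (t u : ℕ) (h : σ.reg r ≠ 0)
      (hp : Exec d w s p σ t τ) (hl : Exec d w s (.loop r p) τ u ρ) :
      Exec d w s (.loop r p) σ (t + u + 1) ρ

/-- The initial configuration: register `0` holds the number of cities, all else is zero. -/
def initial (n : ℕ) : Config where
  reg := fun i => if i = 0 then n else 0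
  mem := fun _ => 0
  len := fun _ => ⟨0, 0⟩

/-- On the instance `d` and a machine with `w`-bit words, the program `p` halts after exactly `t`
steps, using at most `s` cells of each of the two memories, with the minimum tour length in cell `0`
of the length memory. -/
def SolvesWith {n : ℕ} (p : Prog) (d : Fin n → Fin n → ℝ) (w t s : ℕ) : Prop :=
  ∃ τ : Config, Exec d w s p (initial n) t τ ∧ IsOptimum d (τ.len 0).val

/-! ### Feasible space-time tradeoffs -/

/-- `(S, T)` is a feasible space-time tradeoff for the travelling salesman problem: a single
program, on machines with words of `O(n)` bits, solves every instance with `n` cities simultaneously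
in time `T ^ (n + o(n))` and space `S ^ (n + o(n))`. The `o(n)` terms depend on `n` only.
The read-only input is not counted as space. -/
def Feasible (S T : ℝ) : Prop :=
  1 ≤ S ∧ 1 ≤ T ∧
  ∃ (p : Prog) (c : ℕ) (δ ε : ℕ → ℝ), 1 ≤ c ∧
    δ =o[atTop] (fun n : ℕ => (n : ℝ)) ∧ ε =o[atTop] (fun n : ℕ => (n : ℝ)) ∧
    ∀ n : ℕ, 1 ≤ n → ∀ d : Fin n → Fin n → ℝ, ∃ t s : ℕ,
      SolvesWith p d (c * (n + 1)) t s ∧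
      (t : ℝ) ≤ T ^ ((n : ℝ) + ε n) ∧
      ((2 * s : ℕ) : ℝ) ≤ S ^ ((n : ℝ) + δ n)

end TSP

set_option linter.unusedSimpArgs false

namespace TSP

/-! ### A weakest-precondition calculus for loop-free programs -/

/-- Weakest precondition of a loop-free program. -/
def wp {n : ℕ} (d : Fin n → Fin n → ℝ) (w s : ℕ) : Prog → (Config → Prop) → Config → Prop
  | .instr c, Q, σ => c.Legal n w s σ ∧ Q (c.apply d σ)
  | .seq p q, Q, σ => wp d w s p (wp d w s q Q) σ
  | .ite r p q, Q, σ => (σ.reg r ≠ 0 → wp d w s p Q σ) ∧ (σ.reg r = 0 → wp d w s q Q σ)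
  | .loop _ _, _, _ => False

/-- An upper bound for the running time of a loop-free program. -/
def Prog.size : Prog → ℕ
  | .instr _ => 1
  | .seq p q => p.size + q.size
  | .ite _ p q => p.size + q.size + 1
  | .loop _ _ => 0

theorem wp_exec {n : ℕ} {d : Fin n → Fin n → ℝ} {w s : ℕ} (p : Prog) :
    ∀ {Q : Config → Prop} {σ : Config}, wp d w s p Q σ →
      ∃ t τ, t ≤ p.size ∧ Exec d w s p σ t τ ∧ Q τ := by
  induction p with
  | instr c => exact fun {Q σ} h => ⟨1, _, le_rfl, .instr c σ h.1, h.2⟩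
  | seq p q ihp ihq =>
    intro Q σ h
    obtain ⟨t, τ, ht, he, hτ⟩ := ihp h
    obtain ⟨u, ρ, hu, he', hρ⟩ := ihq hτ
    exact ⟨t + u, ρ, Nat.add_le_add ht hu, .seq _ _ _ _ _ _ _ he he', hρ⟩
  | ite r p q ihp ihq =>
    intro Q σ h
    by_cases hr : σ.reg r = 0
    · obtain ⟨t, τ, ht, he, hτ⟩ := ihq (h.2 hr)
      exact ⟨t + 1, τ, by simp only [Prog.size]; omega, .ite_false _ _ _ _ _ _ hr he, hτ⟩
    · obtain ⟨t, τ, ht, he, hτ⟩ := ihp (h.1 hr)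
      exact ⟨t + 1, τ, by simp only [Prog.size]; omega, .ite_true _ _ _ _ _ _ hr he, hτ⟩
  | loop r p => exact fun {Q σ} h => h.elim

/-- A loop whose body decreases a counter register by one. -/
theorem exec_loop {n : ℕ} {d : Fin n → Fin n → ℝ} {w s r : ℕ} {p : Prog}
    (Inv : ℕ → Config → Prop) (hreg : ∀ q σ, Inv q σ → σ.reg r = q)
    {N : ℕ} (hstep : ∀ q σ, q < N → Inv (q + 1) σ → wp d w s p (Inv q) σ) :
    ∀ q σ, q ≤ N → Inv q σ → ∃ t τ, t ≤ (p.size + 1) * q + 1 ∧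
      Exec d w s (.loop r p) σ t τ ∧ Inv 0 τ := by
  intro q
  induction q with
  | zero => exact fun σ _ h => ⟨1, σ, by omega, .loop_done _ _ _ (hreg _ _ h), h⟩
  | succ q ih =>
    intro σ hq h
    obtain ⟨t, τ, ht, he, hτ⟩ := wp_exec p (hstep q σ hq h)
    obtain ⟨u, ρ, hu, he', hρ⟩ := ih τ (by omega) hτ
    refine ⟨t + u + 1, ρ, ?_, .loop_step _ _ _ _ _ _ _ ?_ he he', hρ⟩
    · rw [Nat.mul_succ]; omega
    · rw [hreg _ _ h]; omega

/-! ### Lookup of a function with a finite domain -/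

/-- Write `f x` into register `36`, where `x < M` is the content of register `35`. -/
def lookup (f : ℕ → ℕ) : ℕ → Prog
  | 0 => .instr (.const 36 0)
  | M + 1 => .seq (.instr (.const 37 M)) (.seq (.instr (.op .eq 37 35 37))
      (.ite 37 (.instr (.const 36 (f M))) (lookup f M)))

/-- An arbitrary table of constant size becomes a chain of equality tests in the program text. Its
cost depends on the table only, not on `n`. -/
theorem wp_lookup {n : ℕ} {d : Fin n → Fin n → ℝ} {w s : ℕ} (f : ℕ → ℕ)
    {Q : Config → Prop} (hw : 1 < 2 ^ w) :
    ∀ {M : ℕ} {σ : Config}, σ.reg 35 < M → M < 2 ^ w → (∀ x < M, f x < 2 ^ w) →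
      (∀ τ : Config, τ.mem = σ.mem → τ.len = σ.len → τ.reg 36 = f (σ.reg 35) →
        (∀ r, r ≠ 36 → r ≠ 37 → τ.reg r = σ.reg r) → Q τ) →
      wp d w s (lookup f M) Q σ := by
  intro M
  induction M with
  | zero => exact fun h => absurd h (Nat.not_lt_zero _)
  | succ M ih =>
    intro σ h hM hf hQ
    refine ⟨(Nat.lt_succ_self M).trans hM, ?_, ?_, ?_⟩
    · change (if _ then 1 else 0) < 2 ^ w
      split_ifs <;> omega
    · intro h1
      have h2 : σ.reg 35 = M := by
        by_contra h2
        simp [Instr.apply, Config.setReg, Op.eval, h2] at h1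
      refine ⟨hf _ (Nat.lt_succ_self M), hQ _ rfl rfl ?_ ?_⟩
      · simp [Instr.apply, Config.setReg, h2]
      · intro r h36 h37
        simp [Instr.apply, Config.setReg, h36, h37]
    · intro h1
      have h2 : σ.reg 35 ≠ M := by
        intro h2
        simp [Instr.apply, Config.setReg, Op.eval, h2] at h1
      refine ih ?_ (by omega) (fun x hx => hf x (by omega)) ?_
      · simp [Instr.apply, Config.setReg]; omega
      · intro τ hm hl h36 hr
        refine hQ τ hm hl ?_ ?_
        · rw [h36]; simp [Instr.apply, Config.setReg]
        · intro r hr36 hr37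
          rw [hr r hr36 hr37]; simp [Instr.apply, Config.setReg, hr37]

/-! ### The relaxation step -/

/-- A table assigns to every cell a stamp and a length. -/
abbrev Table := ℕ → ℕ × Length

/-- The part of the memory that is used as a table. The two cells before it are auxiliary. -/
def Config.view (σ : Config) : Table := fun c => (σ.mem (c + 2), σ.len (c + 2))

open Classical in
/-- Record the length `L` with stamp `a` in the cell `c`, unless there is already a smaller one. -/
noncomputable def Table.relax (V : Table) (c a : ℕ) (L : Length) : Table :=
  if (V c).1 = a ∧ (V c).2.val ≤ L.val then V else Function.update V c (a, L)

theorem Table.relax_of_le {V : Table} {c a : ℕ} {L : Length} (h : (V c).1 = a)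
    (h' : (V c).2.val ≤ L.val) : V.relax c a L = V := if_pos ⟨h, h'⟩

theorem Table.relax_of_not {V : Table} {c a : ℕ} {L : Length}
    (h : (V c).1 = a → L.val < (V c).2.val) :
    V.relax c a L = Function.update V c (a, L) := if_neg fun h' => not_le_of_gt (h h'.1) h'.2

/-- The sum of a length and an input distance. -/
noncomputable def Length.addDist {n : ℕ} (L : Length) (d : Fin n → Fin n → ℝ) (u v : ℕ) : Length :=
  ⟨L.val + distAt d u v, L.terms + 1⟩

/-- The `i`-th digit in base `2 ^ l`. -/
def dig (l x i : ℕ) : ℕ := x / 2 ^ (i * l) % 2 ^ l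

/-- Replace the `i`-th digit `a` of `x` in base `2 ^ l` by `a'`. -/
def setDig (l x i a a' : ℕ) : ℕ := x + a' * 2 ^ (i * l) - a * 2 ^ (i * l)

/-- In phase `y`, relax the arcs that leave the state `x` with last city `v` by visiting the element
`e` of block `i`, or by closing the tour. -/
noncomputable def relaxArc {n : ℕ} (d : Fin n → Fin n → ℝ) (k ls lN b : ℕ) (tab : ℕ → ℕ → ℕ → ℕ)
    (e i v x y : ℕ) (V : Table) : Table :=
  if (V (1 + (x * n + v))).1 ≠ y + 1 then V
  else if x + 1 = 2 ^ (ls * b) then V.relax 0 1 ((V (1 + (x * n + v))).2.addDist d v 0)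
  else if tab (dig lN y i) (dig ls x i) e = 0 then V
  else if i * k + e < n ∧ 0 < i * k + e then
    V.relax (1 + (setDig ls x i (dig ls x i) (tab (dig lN y i) (dig ls x i) e) * n + (i * k + e)))
      (y + 1) ((V (1 + (x * n + v))).2.addDist d v (i * k + e))
  else
    V.relax (1 + (setDig ls x i (dig ls x i) (tab (dig lN y i) (dig ls x i) e) * n + v))
      (y + 1) (V (1 + (x * n + v))).2

/-- Step number `q` of the algorithm. -/
noncomputable def relaxStep {n : ℕ} (d : Fin n → Fin n → ℝ) (k ls lN b : ℕ)
    (tab : ℕ → ℕ → ℕ → ℕ) (q : ℕ) (V : Table) : Table :=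
  relaxArc d k ls lN b tab (q % k) (q / k % b) (q / k / b % n) (q / k / b / n % 2 ^ (ls * b))
    (q / k / b / n / 2 ^ (ls * b) / (b * (k + 2)))
    (Function.update V 1 (q / k / b / n / 2 ^ (ls * b) / (b * (k + 2)) + 1, ⟨0, 0⟩))

/-! ### The program -/

/-- A sequence of instructions, followed by a program. -/
def Prog.straight : List Instr → Prog → Prog
  | [], p => p
  | c :: l, p => .seq (.instr c) (Prog.straight l p)

/-- A program that changes nothing but register `45`. -/
def Prog.skip : Prog := .instr (.const 45 0)

/-- Put the cell number, stamp and state into registers. -/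
def decodeProg : Prog :=
  .straight [.op .sub 1 1 5, .op .mod 20 1 6, .op .div 21 1 6, .op .mod 22 21 2, .op .div 21 21 2,
    .op .mod 23 21 0, .op .div 21 21 0, .op .mod 24 21 3, .op .div 21 21 3, .op .div 25 21 4,
    .op .add 26 25 5, .store 12 26, .zeroLen 12, .op .mul 27 24 0, .op .add 27 27 23,
    .op .add 27 27 12, .load 28 27] (.instr (.op .eq 28 28 26))

/-- Record the length in cell `0` in the cell given by register `30`, with the stamp in
register `31`, unless there is already a smaller one. -/
def relaxProg : Prog :=
  .straight [.load 44 30, .op .eq 44 44 31]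
    (.seq (.ite 44 (.instr (.leLen 44 30 13)) .skip)
      (.ite 44 .skip (.straight [.store 30 31] (.instr (.copyLen 30 13)))))

/-- Relax the arc to the sink. -/
def sinkProg : Prog :=
  .straight [.readDist 5 23 13, .addLen 13 13 5, .op .add 30 11 13, .op .add 31 5 13] relaxProg

/-- Compute the number of an arc in the transition table. -/
def arcIndexProg : Prog :=
  .straight [.op .mul 32 22 9, .op .shl 32 5 32, .op .mul 33 22 10, .op .shr 33 25 33,
    .op .mod 33 33 8, .op .div 34 24 32, .op .mod 34 34 7, .op .mul 35 33 7, .op .add 35 35 34,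
    .op .mul 35 35 6] (.instr (.op .add 35 35 20))

/-- Relax the arc to the cell given by registers `38` and `43`. -/
def cellProg : Prog :=
  .straight [.op .mul 30 38 0, .op .add 30 30 43, .op .add 30 30 12, .op .add 31 26 13] relaxProg

/-- Follow the arc whose new digit is in register `36`. -/
def arcProg : Prog :=
  .straight [.op .mul 38 36 32, .op .add 38 24 38, .op .mul 39 34 32, .op .sub 38 38 39,
    .op .mul 40 22 6, .op .add 40 40 20, .op .lt 41 40 0, .op .lt 42 13 40, .op .mul 41 41 42]
  (.seq (.ite 41 (.straight [.readDist 5 23 40, .addLen 13 13 5] (.instr (.op .add 43 40 13)))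
      (.instr (.op .add 43 23 13)))
    cellProg)

/-- The body of the main loop. -/
def bodyProg (f : ℕ → ℕ) (M : ℕ) : Prog :=
  .seq decodeProg (.ite 28
    (.straight [.copyLen 13 27, .op .add 29 24 5, .op .eq 29 29 3]
      (.ite 29 sinkProg (.seq arcIndexProg (.seq (lookup f M) (.ite 36 arcProg .skip)))))
    .skip)

/-- The registers that hold the parameters. -/
structure Params (n k ls lN b : ℕ) (σ : Config) : Prop where
  r0 : σ.reg 0 = n
  r2 : σ.reg 2 = b
  r3 : σ.reg 3 = 2 ^ (ls * b)
  r4 : σ.reg 4 = b * (k + 2)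
  r5 : σ.reg 5 = 1
  r6 : σ.reg 6 = k
  r7 : σ.reg 7 = 2 ^ ls
  r8 : σ.reg 8 = 2 ^ lN
  r9 : σ.reg 9 = ls
  r10 : σ.reg 10 = lN
  r11 : σ.reg 11 = 2
  r12 : σ.reg 12 = 3
  r13 : σ.reg 13 = 0

/-- Register `1` is exempt because it is the loop counter, the only register below `14` that the
loop body writes. -/
theorem Params.congr {n k ls lN b : ℕ} {σ τ : Config} (h : Params n k ls lN b σ)
    (hr : ∀ r < 14, r ≠ 1 → τ.reg r = σ.reg r) : Params n k ls lN b τ where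
  r0 := (hr 0 (by decide) (by decide)).trans h.r0
  r2 := (hr 2 (by decide) (by decide)).trans h.r2
  r3 := (hr 3 (by decide) (by decide)).trans h.r3
  r4 := (hr 4 (by decide) (by decide)).trans h.r4
  r5 := (hr 5 (by decide) (by decide)).trans h.r5
  r6 := (hr 6 (by decide) (by decide)).trans h.r6
  r7 := (hr 7 (by decide) (by decide)).trans h.r7
  r8 := (hr 8 (by decide) (by decide)).trans h.r8
  r9 := (hr 9 (by decide) (by decide)).trans h.r9
  r10 := (hr 10 (by decide) (by decide)).trans h.r10
  r11 := (hr 11 (by decide) (by decide)).trans h.r11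
  r12 := (hr 12 (by decide) (by decide)).trans h.r12
  r13 := (hr 13 (by decide) (by decide)).trans h.r13

section Projections
variable (σ : Config) (a v : ℕ) (x : Length)

@[simp] theorem Config.setReg_reg : (σ.setReg a v).reg = Function.update σ.reg a v := rfl
@[simp] theorem Config.setReg_mem : (σ.setReg a v).mem = σ.mem := rfl
@[simp] theorem Config.setReg_len : (σ.setReg a v).len = σ.len := rfl
@[simp] theorem Config.setMem_reg : (σ.setMem a v).reg = σ.reg := rfl
@[simp] theorem Config.setMem_mem : (σ.setMem a v).mem = Function.update σ.mem a v := rfl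
@[simp] theorem Config.setMem_len : (σ.setMem a v).len = σ.len := rfl
@[simp] theorem Config.setLen_reg : (σ.setLen a x).reg = σ.reg := rfl
@[simp] theorem Config.setLen_mem : (σ.setLen a x).mem = σ.mem := rfl
@[simp] theorem Config.setLen_len : (σ.setLen a x).len = Function.update σ.len a x := rfl

end Projections

/-! ### Weakest preconditions of the pieces of the loop body -/

section
variable {n : ℕ} {d : Fin n → Fin n → ℝ} {w s : ℕ}

/-- The postcondition sees only the registers below `14` and the table; everything else is scratch
that the next step recomputes. -/
theorem wp_relaxProg {Q : Config → Prop} {σ : Config} (h13 : σ.reg 13 = 0)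
    (hw : 1 < 2 ^ w) {c a : ℕ} (h30 : σ.reg 30 = c + 2) (h31 : σ.reg 31 = a)
    (hc : c + 2 < s)
    (hQ : ∀ τ : Config, (∀ r < 14, τ.reg r = σ.reg r) →
      τ.view = σ.view.relax c a (σ.len 0) → Q τ) :
    wp d w s relaxProg Q σ := by
  have hs : 0 < s := by omega
  have hw0 : 0 < 2 ^ w := by omega
  have hframe : ∀ r < 14, r ≠ 44 ∧ r ≠ 45 := fun r hr => by omega
  simp only [relaxProg, Prog.straight, Prog.skip, wp, Instr.Legal, Instr.apply,
    Op.eval, Function.update_apply, Config.setReg_reg, Config.setReg_mem, Config.setReg_len,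
    Config.setMem_reg, Config.setMem_mem, Config.setMem_len, Config.setLen_reg]
  norm_num [h30, h31, h13, hc, hs, hw0]
  refine ⟨by split_ifs <;> omega, ?_, ?_⟩
  · intro hm
    refine ⟨?_, ?_⟩
    · intro hle
      refine hQ _ (fun r hr => by simp [hframe r hr]) ?_
      rw [Table.relax_of_le hm hle]
      rfl
    · intro hle
      refine hQ _ (fun r hr => by simp [hframe r hr]) ?_
      rw [Table.relax_of_not fun _ => hle]
      funext e
      by_cases he : e = c <;> simp [Config.view, he]
  · intro hm
    have hm' : ¬ σ.mem (c + 2) = a := hm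
    simp only [hm', false_imp_iff, true_and, not_false_eq_true, true_imp_iff]
    refine hQ _ (fun r hr => by simp [hframe r hr]) ?_
    rw [Table.relax_of_not fun h => absurd h hm]
    funext e
    by_cases he : e = c <;> simp [Config.view, he]

theorem wp_sinkProg {Q : Config → Prop} {σ : Config} {k ls lN b v : ℕ}
    (hσ : Params n k ls lN b σ) (hw : 4 < 2 ^ w) (h23 : σ.reg 23 = v) (hv : v < n) (hs : 3 ≤ s)
    (ht : (σ.len 0).terms + 1 < 2 ^ w)
    (hQ : ∀ τ : Config, (∀ r < 14, τ.reg r = σ.reg r) →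
      τ.view = σ.view.relax 0 1 ((σ.len 0).addDist d v 0) → Q τ) :
    wp d w s sinkProg Q σ := by
  have hs0 : 0 < s := by omega
  have hs1 : 1 < s := by omega
  have hn : 0 < n := by omega
  have hw1 : 1 < 2 ^ w := by omega
  have hw2 : 2 < 2 ^ w := by omega
  simp only [sinkProg, Prog.straight, wp, Instr.Legal, Instr.apply,
    Op.eval, Function.update_apply, Config.setReg_reg, Config.setReg_mem, Config.setReg_len,
    Config.setMem_reg, Config.setMem_mem, Config.setMem_len, Config.setLen_reg, Config.setLen_mem,
    Config.setLen_len]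
  norm_num [hσ.r5, hσ.r11, hσ.r13, h23, hs0, hs1, hn, hv, hw1, hw2, ht]
  refine wp_relaxProg (c := 0) (a := 1) ?_ (by omega) ?_ ?_ (by omega) fun τ hr hV => hQ τ ?_ ?_
  · simp [hσ.r13]
  · simp
  · simp
  · intro r hr'
    have : r ≠ 30 ∧ r ≠ 31 := by omega
    rw [hr r hr']; simp [this]
  · rw [hV]
    have : (σ.setLen 1 ⟨distAt d v 0, 1⟩).view = σ.view := by
      funext c; simp [Config.view]
    congr 1

theorem wp_arcIndexProg {Q : Config → Prop} {σ : Config} {k ls lN b e i x y : ℕ}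
    (hσ : Params n k ls lN b σ) (h20 : σ.reg 20 = e) (h22 : σ.reg 22 = i) (h24 : σ.reg 24 = x)
    (h25 : σ.reg 25 = y) (he : e < k) (hi : i < b) (hx : x < 2 ^ w) (hy : y < 2 ^ w)
    (h1 : b * ls < 2 ^ w) (h2 : b * lN < 2 ^ w) (h3 : 2 ^ (ls * b) < 2 ^ w)
    (h4 : 2 ^ lN * 2 ^ ls * k < 2 ^ w)
    (hQ : ∀ τ : Config, τ.mem = σ.mem → τ.len = σ.len →
      (∀ r, r < 32 → τ.reg r = σ.reg r) → τ.reg 32 = 2 ^ (i * ls) → τ.reg 34 = dig ls x i →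
      τ.reg 35 = (dig lN y i * 2 ^ ls + dig ls x i) * k + e → Q τ) :
    wp d w s arcIndexProg Q σ := by
  have hN : dig lN y i < 2 ^ lN := Nat.mod_lt _ (by positivity)
  have hS : dig ls x i < 2 ^ ls := Nat.mod_lt _ (by positivity)
  have a1 : i * ls < 2 ^ w := lt_of_le_of_lt (Nat.mul_le_mul_right _ hi.le) h1
  have a2 : i * lN < 2 ^ w := lt_of_le_of_lt (Nat.mul_le_mul_right _ hi.le) h2
  have a3 : 1 <<< (i * ls) < 2 ^ w := by
    rw [Nat.one_shiftLeft]
    refine lt_of_le_of_lt (Nat.pow_le_pow_right (by norm_num) ?_) h3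
    rw [mul_comm]; exact Nat.mul_le_mul_left _ hi.le
  have a4 : y >>> (i * lN) < 2 ^ w := by
    rw [Nat.shiftRight_eq_div_pow]
    exact lt_of_le_of_lt (Nat.div_le_self _ _) hy
  have a4' : y >>> (i * lN) % 2 ^ lN < 2 ^ w := lt_of_le_of_lt (Nat.mod_le _ _) a4
  have a5 : x / 1 <<< (i * ls) < 2 ^ w := lt_of_le_of_lt (Nat.div_le_self _ _) hx
  have a5' : x / 1 <<< (i * ls) % 2 ^ ls < 2 ^ w := lt_of_le_of_lt (Nat.mod_le _ _) a5
  have e1 : y >>> (i * lN) % 2 ^ lN = dig lN y i := by rw [Nat.shiftRight_eq_div_pow, dig]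
  have e2 : x / 1 <<< (i * ls) % 2 ^ ls = dig ls x i := by rw [Nat.one_shiftLeft, dig]
  have b1 : dig lN y i * 2 ^ ls + dig ls x i + 1 ≤ 2 ^ lN * 2 ^ ls := by
    have := Nat.mul_le_mul_right (2 ^ ls) (Nat.succ_le_of_lt hN)
    rw [Nat.succ_mul] at this
    omega
  have b2 : (dig lN y i * 2 ^ ls + dig ls x i) * k + e < 2 ^ w := by
    have := Nat.mul_le_mul_right k b1
    rw [Nat.succ_mul] at this
    omega
  have b3 : (dig lN y i * 2 ^ ls + dig ls x i) * k < 2 ^ w := by omega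
  have b4 : dig lN y i * 2 ^ ls + dig ls x i < 2 ^ w := by
    refine lt_of_le_of_lt ?_ b3
    exact Nat.le_mul_of_pos_right _ (by omega)
  have b5 : dig lN y i * 2 ^ ls < 2 ^ w := by omega
  simp only [arcIndexProg, Prog.straight, wp, Instr.Legal, Instr.apply,
    Op.eval, Function.update_apply, Config.setReg_reg, Config.setReg_mem, Config.setReg_len]
  norm_num [hσ.r5, hσ.r6, hσ.r7, hσ.r8, hσ.r9, hσ.r10, h20, h22, h24, h25, a1, a2, a3, a4, a4', a5,
    a5']
  rw [e1, e2]
  refine ⟨b5, b4, b3, b2, hQ _ rfl rfl ?_ ?_ ?_ ?_⟩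
  · intro r hr
    have : r ≠ 32 ∧ r ≠ 33 ∧ r ≠ 34 ∧ r ≠ 35 := by omega
    simp [this]
  · simp [Nat.one_shiftLeft]
  · simp
  · simp

end

/-! ### Digits -/

theorem dig_lt (l x i : ℕ) : dig l x i < 2 ^ l := Nat.mod_lt _ (by positivity)

theorem dig_mul_le (l x i : ℕ) : dig l x i * 2 ^ (i * l) ≤ x :=
  (Nat.mul_le_mul_right _ (Nat.mod_le _ _)).trans (Nat.div_mul_le_self _ _)

/-- Part above the digit, the digit itself, part below it; the facts about `setDig` are read off
from this splitting. -/
theorem digit_decomp (l x i : ℕ) :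
    x = x / 2 ^ ((i + 1) * l) * 2 ^ ((i + 1) * l) + dig l x i * 2 ^ (i * l) + x % 2 ^ (i * l) := by
  have h1 : x / 2 ^ ((i + 1) * l) = x / 2 ^ (i * l) / 2 ^ l := by
    rw [Nat.div_div_eq_div_mul, ← pow_add, Nat.succ_mul]
  have h2 : (2 : ℕ) ^ ((i + 1) * l) = 2 ^ l * 2 ^ (i * l) := by
    rw [← pow_add, Nat.succ_mul, add_comm]
  rw [h1, h2, ← mul_assoc, ← add_mul, dig, Nat.div_add_mod', Nat.div_add_mod']

/-- The contribution of the old digit is contained in `x`, so the truncated subtraction in `setDig`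
is exact. -/
theorem setDig_eq (l x i a' : ℕ) : setDig l x i (dig l x i) a' =
    x / 2 ^ ((i + 1) * l) * 2 ^ ((i + 1) * l) + a' * 2 ^ (i * l) + x % 2 ^ (i * l) := by
  have := digit_decomp l x i
  rw [setDig]
  omega

theorem setDig_low {l i a' : ℕ} (x : ℕ) (ha : a' < 2 ^ l) :
    a' * 2 ^ (i * l) + x % 2 ^ (i * l) < 2 ^ ((i + 1) * l) := by
  have h2 : (2 : ℕ) ^ ((i + 1) * l) = 2 ^ l * 2 ^ (i * l) := by
    rw [← pow_add, Nat.succ_mul, add_comm]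
  have h3 := Nat.mod_lt x (show 2 ^ (i * l) > 0 by positivity)
  have h4 := Nat.mul_le_mul_right (2 ^ (i * l)) (Nat.succ_le_of_lt ha)
  rw [Nat.succ_mul] at h4
  omega

theorem setDig_div {l x i a' : ℕ} (ha : a' < 2 ^ l) :
    setDig l x i (dig l x i) a' / 2 ^ ((i + 1) * l) = x / 2 ^ ((i + 1) * l) := by
  rw [setDig_eq, add_assoc, add_comm, Nat.add_mul_div_right _ _ (by positivity),
    Nat.div_eq_of_lt (setDig_low x ha), zero_add]

theorem setDig_mod {l x i a' : ℕ} :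
    setDig l x i (dig l x i) a' % 2 ^ (i * l) = x % 2 ^ (i * l) := by
  have h2 : (2 : ℕ) ^ ((i + 1) * l) = 2 ^ l * 2 ^ (i * l) := by
    rw [← pow_add, Nat.succ_mul, add_comm]
  rw [setDig_eq, h2, ← mul_assoc, ← add_mul, Nat.mul_add_mod', Nat.mod_mod]

theorem dig_setDig_self {l x i a' : ℕ} (ha : a' < 2 ^ l) :
    dig l (setDig l x i (dig l x i) a') i = a' := by
  have h2 : (2 : ℕ) ^ ((i + 1) * l) = 2 ^ l * 2 ^ (i * l) := by
    rw [← pow_add, Nat.succ_mul, add_comm]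
  rw [dig, setDig_eq, h2, ← mul_assoc, ← add_mul, add_comm,
    Nat.add_mul_div_right _ _ (by positivity), Nat.div_eq_of_lt (Nat.mod_lt _ (by positivity)),
    zero_add, Nat.mul_add_mod', Nat.mod_eq_of_lt ha]

/-- Lower digits depend only on the residue modulo $2^{il}$, higher ones only on the quotient by
$2^{(i+1)l}$, and the replacement preserves both. -/
theorem dig_setDig_of_ne {l x i a' i' : ℕ} (ha : a' < 2 ^ l) (hi : i' ≠ i) :
    dig l (setDig l x i (dig l x i) a') i' = dig l x i' := by
  rcases lt_or_gt_of_ne hi with h | h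
  · have key : ∀ z, dig l z i' = dig l (z % 2 ^ (i * l)) i' := by
      intro z
      have h3 : (2 : ℕ) ^ (i * l) = 2 ^ (i' * l) * (2 ^ l * 2 ^ ((i - i' - 1) * l)) := by
        rw [← pow_add, ← pow_add]
        congr 1
        obtain ⟨c, rfl⟩ := Nat.exists_eq_add_of_lt h
        rw [show i' + c + 1 - i' - 1 = c by omega]
        ring
      rw [dig, dig, h3, Nat.mod_mul_right_div_self, Nat.mod_mul_right_mod]
    rw [key, setDig_mod, ← key]
  · have key : ∀ z, dig l z i' = z / 2 ^ ((i + 1) * l) / 2 ^ ((i' - i - 1) * l) % 2 ^ l := by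
      intro z
      rw [dig, Nat.div_div_eq_div_mul, ← pow_add]
      congr 3
      obtain ⟨c, rfl⟩ := Nat.exists_eq_add_of_lt h
      rw [show i + c + 1 - i - 1 = c by omega]
      ring
    rw [key, setDig_div ha, ← key]

theorem setDig_lt {l x i a' b : ℕ} (ha : a' < 2 ^ l) (hi : i < b) (hx : x < 2 ^ (l * b)) :
    setDig l x i (dig l x i) a' < 2 ^ (l * b) := by
  have h3 : (2 : ℕ) ^ (l * b) = 2 ^ ((b - i - 1) * l) * 2 ^ ((i + 1) * l) := by
    rw [← pow_add]
    congr 1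
    obtain ⟨c, rfl⟩ := Nat.exists_eq_add_of_lt hi
    rw [show i + c + 1 - i - 1 = c by omega]
    ring
  rw [h3, ← Nat.div_lt_iff_lt_mul (by positivity)] at hx ⊢
  rwa [setDig_div ha]

section
variable {n : ℕ} {d : Fin n → Fin n → ℝ} {w s : ℕ}

theorem mul_add_lt_mul {x v n m : ℕ} (hx : x < m) (hv : v < n) : x * n + v < m * n := by
  have := Nat.mul_le_mul_right n (Nat.succ_le_of_lt hx)
  rw [Nat.succ_mul] at this
  omega

theorem view_setLen_of_lt (σ : Config) {a : ℕ} (ha : a < 2) (x : Length) :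
    (σ.setLen a x).view = σ.view := by
  funext c
  have : c + 2 ≠ a := by omega
  simp [Config.view, this]

theorem wp_arcProg {Q : Config → Prop} {σ : Config} {k ls lN b e i v x y a a' : ℕ}
    (hσ : Params n k ls lN b σ) (h20 : σ.reg 20 = e) (h22 : σ.reg 22 = i) (h23 : σ.reg 23 = v)
    (h24 : σ.reg 24 = x) (h26 : σ.reg 26 = y + 1) (h32 : σ.reg 32 = 2 ^ (i * ls))
    (h34 : σ.reg 34 = a) (h36 : σ.reg 36 = a') (he : e < k) (hi : i < b) (hv : v < n)
    (hx : x < 2 ^ (ls * b)) (ha : a * 2 ^ (i * ls) ≤ x) (ha' : a' < 2 ^ ls)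
    (hx' : setDig ls x i a a' < 2 ^ (ls * b)) (hy : y + 1 < 2 ^ w) (hw4 : 3 < 2 ^ w)
    (hs : 3 + 2 ^ (ls * b) * n ≤ s) (hsw : s ≤ 2 ^ w) (h1 : b * k < 2 ^ w)
    (h3 : 2 * 2 ^ (ls * b) < 2 ^ w)
    (ht : (σ.len 0).terms + 1 < 2 ^ w)
    (hQ : ∀ τ : Config, (∀ r < 14, τ.reg r = σ.reg r) →
      τ.view = (if i * k + e < n ∧ 0 < i * k + e then
          σ.view.relax (1 + (setDig ls x i a a' * n + (i * k + e))) (y + 1)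
            ((σ.len 0).addDist d v (i * k + e))
        else σ.view.relax (1 + (setDig ls x i a a' * n + v)) (y + 1) (σ.len 0)) → Q τ) :
    wp d w s arcProg Q σ := by
  have hn : 0 < n := by omega
  have hs0 : 0 < s := by omega
  have hs1 : 1 < s := by omega
  have hw1 : 1 < 2 ^ w := by omega
  have hw0 : 0 < 2 ^ w := by omega
  have hap : a' * 2 ^ (i * ls) < 2 ^ (ls * b) := by
    have h := setDig_lt (x := 0) ha' hi (show 0 < 2 ^ (ls * b) by positivity)
    rwa [setDig_eq, Nat.zero_div, Nat.zero_mod, zero_mul, zero_add, add_zero] at h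
  have c1 : a' * 2 ^ (i * ls) < 2 ^ w := by omega
  have c2 : x + a' * 2 ^ (i * ls) < 2 ^ w := by omega
  have c3 : a * 2 ^ (i * ls) < 2 ^ w := by omega
  have c4 : x + a' * 2 ^ (i * ls) - a * 2 ^ (i * ls) < 2 ^ w := by omega
  have c5 : i * k + e < 2 ^ w := lt_trans (mul_add_lt_mul hi he) h1
  have c6 : i * k < 2 ^ w := by omega
  -- Both cases end in `cellProg`: visiting a city `u`, and passing over city `0` or a padding
  -- element, where `u` is the old last city.
  have key : ∀ {u : ℕ} {L : Length} {σ' : Config}, u < n → σ'.reg 38 = setDig ls x i a a' →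
      (∀ r < 32, σ'.reg r = σ.reg r) → σ'.reg 43 = u → σ'.view = σ.view → σ'.len 0 = L →
      (∀ τ : Config, (∀ r < 14, τ.reg r = σ.reg r) →
        τ.view = σ.view.relax (1 + (setDig ls x i a a' * n + u)) (y + 1) L → Q τ) →
      wp d w s cellProg Q σ' := by
    intro u L σ' hu h38 hr' h43 hV hL hQ'
    have g1 := mul_add_lt_mul hx' hu
    have g2 : setDig ls x i a a' * n + u + 3 < 2 ^ w := by omega
    have g3 : setDig ls x i a a' * n + u < 2 ^ w := by omega
    have g4 : setDig ls x i a a' * n < 2 ^ w := by omega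
    simp only [cellProg, Prog.straight, wp, Instr.Legal, Instr.apply,
      Op.eval, Function.update_apply, Config.setReg_reg, Config.setReg_mem, Config.setReg_len]
    norm_num [hr', hσ.r0, hσ.r12, hσ.r13, h38, h43, h26, g2, g3, g4, hy]
    refine wp_relaxProg (c := 1 + (setDig ls x i a a' * n + u)) (a := y + 1) ?_ hw1 ?_ ?_
      (by omega) fun τ hr hV' => hQ' τ ?_ ?_
    · simp [hr', hσ.r13]
    · simp; omega
    · simp
    · intro r hr14
      have : r ≠ 30 ∧ r ≠ 31 := by omega
      rw [hr r hr14]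
      simp [this, hr' r (by omega)]
    · rw [hV']
      have e1 : (((((σ'.setReg 30 (setDig ls x i a a' * n)).setReg 30
        (setDig ls x i a a' * n + u)).setReg 30 (setDig ls x i a a' * n + u + 3)).setReg 31
        (y + 1)).view) = σ.view := hV
      rw [e1, ← hL]
      rfl
  have hnw : n ≤ 2 ^ (ls * b) * n := Nat.le_mul_of_pos_left _ (by positivity)
  obtain ⟨u, hu⟩ : ∃ u, i * k + e = u := ⟨_, rfl⟩
  rw [hu] at c5 hQ
  have d1 : ∀ p : Prop, [Decidable p] → (if p then 1 else 0) < 2 ^ w := by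
    intro p _; split_ifs <;> omega
  -- The product of the two comparison bits is the conjunction: the element is a city other than the
  -- start `0`.
  have d2 : (if u < n then 1 else 0) * (if 0 < u then 1 else 0) < 2 ^ w := by
    split_ifs <;> omega
  have d3 : (if u < n then 1 else 0) * (if 0 < u then 1 else 0) ≠ 0 ↔ u < n ∧ 0 < u := by
    split_ifs <;> simp [*]
  have d4 : (if u < n then 1 else 0) * (if 0 < u then 1 else 0) = 0 ↔ ¬ (u < n ∧ 0 < u) := by
    rw [← d3, not_not]
  simp only [arcProg, Prog.straight, wp, Instr.Legal, Instr.apply,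
    Op.eval, Function.update_apply, Config.setReg_reg, Config.setReg_mem, Config.setReg_len]
  simp only [hσ.r0, hσ.r5, hσ.r6, hσ.r13, h20, h22, h23, h24, h26, h32, h34, h36, hu, c1, c2, c3,
    c4, c5, c6, d1, d2, d3, d4, Nat.reduceEqDiff, reduceIte, true_and, Config.setLen_reg,
    Config.setReg_reg, Config.setLen_len, Function.update_apply, add_zero, hs0, hs1]
  refine ⟨fun hu' => ⟨⟨hv, hu'.1⟩, by simpa using ht, ?_⟩, fun hu' => ⟨by omega, ?_⟩⟩
  · refine key hu'.1 ?_ ?_ ?_ ?_ ?_ fun τ hr hV => hQ τ hr (hV.trans (if_pos hu').symm)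
    · simp [setDig]
    · intro r hr
      have : r ≠ 38 ∧ r ≠ 39 ∧ r ≠ 40 ∧ r ≠ 41 ∧ r ≠ 42 ∧ r ≠ 43 := by omega
      simp [this]
    · simp
    · rfl
    · simp [Length.addDist]
  · refine key hv ?_ ?_ ?_ ?_ ?_ fun τ hr hV => hQ τ hr (hV.trans (if_neg hu').symm)
    · simp [setDig]
    · intro r hr
      have : r ≠ 38 ∧ r ≠ 39 ∧ r ≠ 40 ∧ r ≠ 41 ∧ r ≠ 42 ∧ r ≠ 43 := by omega
      simp [this]
    · simp
    · rfl
    · simp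

/-- The counter is a mixed-radix number with digits, from the lowest: element, block, last city,
state, round, phase. The round is discarded by the division by `b * (k + 2)`, since the arc does not
depend on it. The start cell is rewritten in every step, so a new phase needs no separate
initialization. -/
theorem wp_decodeProg {Q : Config → Prop} {σ : Config} {k ls lN b q : ℕ}
    (hσ : Params n k ls lN b σ) (hq : σ.reg 1 = q + 1) (hn : 0 < n) (hqw : q + 1 < 2 ^ w)
    (hs : 3 + 2 ^ (ls * b) * n ≤ s) (hsw : s ≤ 2 ^ w)
    (hQ : ∀ (τ : Config) (i v x y : ℕ), i = q / k % b → v = q / k / b % n →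
      x = q / k / b / n % 2 ^ (ls * b) → y = q / k / b / n / 2 ^ (ls * b) / (b * (k + 2)) →
      (∀ r < 14, r ≠ 1 → τ.reg r = σ.reg r) → τ.reg 1 = q → τ.reg 20 = q % k →
      τ.reg 22 = i → τ.reg 23 = v → τ.reg 24 = x → τ.reg 25 = y → τ.reg 26 = y + 1 →
      τ.reg 27 = 3 + (x * n + v) →
      τ.reg 28 = (if (τ.view (1 + (x * n + v))).1 = y + 1 then 1 else 0) →
      τ.view = Function.update σ.view 1 (y + 1, ⟨0, 0⟩) → Q τ) :
    wp d w s decodeProg Q σ := by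
  obtain ⟨q1, h1⟩ : ∃ q1, q1 = q / k := ⟨_, rfl⟩
  obtain ⟨q2, h2⟩ : ∃ q2, q2 = q1 / b := ⟨_, rfl⟩
  obtain ⟨q3, h3⟩ : ∃ q3, q3 = q2 / n := ⟨_, rfl⟩
  obtain ⟨q4, h4⟩ : ∃ q4, q4 = q3 / 2 ^ (ls * b) := ⟨_, rfl⟩
  obtain ⟨i, hi⟩ : ∃ i, i = q1 % b := ⟨_, rfl⟩
  obtain ⟨v, hv⟩ : ∃ v, v = q2 % n := ⟨_, rfl⟩
  obtain ⟨x, hx⟩ : ∃ x, x = q3 % 2 ^ (ls * b) := ⟨_, rfl⟩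
  obtain ⟨y, hy⟩ : ∃ y, y = q4 / (b * (k + 2)) := ⟨_, rfl⟩
  have l1 : q1 ≤ q := h1 ▸ Nat.div_le_self _ _
  have l2 : q2 ≤ q1 := h2 ▸ Nat.div_le_self _ _
  have l3 : q3 ≤ q2 := h3 ▸ Nat.div_le_self _ _
  have l4 : q4 ≤ q3 := h4 ▸ Nat.div_le_self _ _
  have l5 : i ≤ q1 := hi ▸ Nat.mod_le _ _
  have l6 : v < n := hv ▸ Nat.mod_lt _ hn
  have l7 : x < 2 ^ (ls * b) := hx ▸ Nat.mod_lt _ (by positivity)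
  have l8 : y ≤ q4 := hy ▸ Nat.div_le_self _ _
  have l9 : q % k ≤ q := Nat.mod_le _ _
  have l10 : v ≤ q2 := hv ▸ Nat.mod_le _ _
  have l11 : x ≤ q3 := hx ▸ Nat.mod_le _ _
  have g1 := mul_add_lt_mul l7 l6
  have w1 : q < 2 ^ w := by omega
  have w2 : q1 < 2 ^ w := by omega
  have w3 : q2 < 2 ^ w := by omega
  have w4 : q3 < 2 ^ w := by omega
  have w5 : q4 < 2 ^ w := by omega
  have w6 : i < 2 ^ w := by omega
  have w7 : v < 2 ^ w := by omega
  have w8 : x < 2 ^ w := by omega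
  have w9 : y < 2 ^ w := by omega
  have w10 : y + 1 < 2 ^ w := by omega
  have w11 : q % k < 2 ^ w := by omega
  have w12 : x * n + v + 3 < 2 ^ w := by omega
  have w13 : x * n + v < 2 ^ w := by omega
  have w14 : x * n < 2 ^ w := by omega
  have w15 : x * n + v + 3 < s := by omega
  have w16 : 3 < s := by omega
  have hw1 : 1 < 2 ^ w := by omega
  have hw0 : 0 < 2 ^ w := by omega
  have d1 : ∀ p : Prop, [Decidable p] → (if p then 1 else 0) < 2 ^ w := by
    intro p _; split_ifs <;> omega
  simp only [decodeProg, Prog.straight, wp, Instr.Legal, Instr.apply,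
    Op.eval, Function.update_apply, Config.setReg_reg, Config.setReg_mem, Config.setReg_len,
    Config.setMem_reg, Config.setMem_mem, Config.setLen_reg, Config.setLen_mem]
  simp only [hσ.r0, hσ.r2, hσ.r3, hσ.r4, hσ.r5, hσ.r6, hσ.r12, hq, Nat.reduceEqDiff, reduceIte,
    Nat.add_sub_cancel, ← h1, ← h2, ← h3, ← h4, ← hi, ← hv, ← hx, ← hy, w1, w2, w3, w4, w5, w6, w7,
    w8, w9, w10, w11, w12, w13, w14, w15, w16, d1, true_and, Config.setLen_reg, Config.setMem_reg,
    Config.setReg_reg, Config.setReg_mem, Function.update_apply]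
  subst h1 h2 h3 h4
  refine hQ _ i v x y hi hv hx hy ?_ ?_ ?_ ?_ ?_ ?_ ?_ ?_ ?_ ?_ ?_
  · intro r hr hr1
    have : r ≠ 20 ∧ r ≠ 21 ∧ r ≠ 22 ∧ r ≠ 23 ∧ r ≠ 24 ∧ r ≠ 25 ∧ r ≠ 26 ∧ r ≠ 27 ∧ r ≠ 28 := by
      omega
    simp [this, hr1]
  · simp
  · simp
  · simp
  · simp
  · simp
  · simp
  · simp
  · simp [add_comm]
  · simp [Config.view, add_comm, add_left_comm, Function.update_apply]
  · funext c
    by_cases hc : c = 1 <;> simp [Config.view, hc]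

/-- The bound `ht` spares cell `0`: the sink is never the source of an arc, so only the other
lengths must leave room for one more distance. -/
theorem wp_bodyProg {Q : Config → Prop} {σ : Config} {k ls lN b q M : ℕ} {tab : ℕ → ℕ → ℕ → ℕ}
    {f : ℕ → ℕ}
    (hσ : Params n k ls lN b σ) (hq : σ.reg 1 = q + 1) (hn : 0 < n) (hk : 0 < k) (hb : 0 < b)
    (hw4 : 4 < 2 ^ w) (hqw : q + 1 < 2 ^ w)
    (hs : 3 + 2 ^ (ls * b) * n ≤ s) (hsw : s ≤ 2 ^ w)
    (h0 : b * k + 1 < 2 ^ w) (h1 : b * ls < 2 ^ w) (h2 : b * lN < 2 ^ w)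
    (h3 : 2 * 2 ^ (ls * b) < 2 ^ w) (hM : M = 2 ^ lN * 2 ^ ls * k) (h4 : M < 2 ^ w)
    (hf : ∀ j a e, j < 2 ^ lN → a < 2 ^ ls → e < k → f ((j * 2 ^ ls + a) * k + e) = tab j a e)
    (hfw : ∀ x < M, f x < 2 ^ ls) (hls : 2 ^ ls < 2 ^ w)
    (ht : ∀ c, 1 ≤ c → (σ.view c).2.terms ≤ b * k)
    (hQ : ∀ τ : Config, Params n k ls lN b τ → τ.reg 1 = q →
      τ.view = relaxStep d k ls lN b tab q σ.view → Q τ) :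
    wp d w s (bodyProg f M) Q σ := by
  refine wp_decodeProg hσ hq hn hqw hs hsw ?_
  intro τ i v x y hi hv hx hy hr r1 r20 r22 r23 r24 r25 r26 r27 r28 hV
  have hτ := hσ.congr hr
  have hil : i < b := hi ▸ Nat.mod_lt _ hb
  have hvl : v < n := hv ▸ Nat.mod_lt _ hn
  have hxl : x < 2 ^ (ls * b) := hx ▸ Nat.mod_lt _ (by positivity)
  have hel : q % k < k := Nat.mod_lt _ hk
  have hyq : y ≤ q := by
    rw [hy]
    exact (Nat.div_le_self _ _).trans <| (Nat.div_le_self _ _).trans <|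
      (Nat.div_le_self _ _).trans <| (Nat.div_le_self _ _).trans (Nat.div_le_self _ _)
  have g1 := mul_add_lt_mul hxl hvl
  have hstep : relaxStep d k ls lN b tab q σ.view =
      relaxArc d k ls lN b tab (q % k) i v x y τ.view := by
    rw [hV, hi, hv, hx, hy]; rfl
  rw [hstep] at hQ
  have ht' : ∀ c, 1 ≤ c → (τ.view c).2.terms ≤ b * k := by
    intro c hc
    rw [hV, Function.update_apply]
    split_ifs
    · exact Nat.zero_le _
    · exact ht c hc
  have hskip : ∀ {ρ : Config}, Params n k ls lN b ρ → ρ.reg 1 = q →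
      ρ.view = relaxArc d k ls lN b tab (q % k) i v x y τ.view → wp d w s .skip Q ρ := by
    intro ρ hρ h1 hV
    refine ⟨by change 0 < 2 ^ w; omega, hQ _ (hρ.congr ?_) ?_ ?_⟩
    · intro r hr _
      have : r ≠ 45 := by omega
      simp [Instr.apply, this]
    · simpa [Instr.apply] using h1
    · rw [← hV]; rfl
  constructor
  swap
  · intro h
    refine hskip hτ r1 ?_
    have : (τ.view (1 + (x * n + v))).1 ≠ y + 1 := by
      intro h'; rw [r28, if_pos h'] at h; exact one_ne_zero h
    rw [relaxArc, if_pos this]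
  intro h
  have hst : (τ.view (1 + (x * n + v))).1 = y + 1 := by
    by_contra h'; rw [r28, if_neg h'] at h; exact h rfl
  have hsrc : (τ.view (1 + (x * n + v))).2 = τ.len (3 + (x * n + v)) := by
    simp only [Config.view]; congr 1; omega
  have hterms : (τ.len (3 + (x * n + v))).terms ≤ b * k := hsrc ▸ ht' _ (by omega)
  have w1 : 0 < s := by omega
  have w2 : 3 + (x * n + v) < s := by omega
  have w3 : x + 1 < 2 ^ w := by omega
  have d1 : (if x + 1 = 2 ^ (ls * b) then 1 else 0) < 2 ^ w := by split_ifs <;> omega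
  simp only [Prog.straight, wp, Instr.Legal, Instr.apply,
    Op.eval, Function.update_apply, Config.setReg_reg, Config.setReg_mem, Config.setReg_len,
    Config.setMem_reg, Config.setMem_mem, Config.setLen_reg, Config.setLen_mem]
  simp only [hτ.r3, hτ.r5, hτ.r13, r24, r27, Nat.reduceEqDiff, reduceIte, w1, w2, w3, d1, true_and,
    Config.setLen_reg, Config.setReg_reg, Function.update_apply]
  set L := τ.len (3 + (x * n + v))
  generalize hρ : ((τ.setLen 0 L).setReg 29 (x + 1)).setReg 29
    (if x + 1 = 2 ^ (ls * b) then 1 else 0) = ρ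
  have ρr : ∀ r < 29, ρ.reg r = τ.reg r := by
    intro r hr
    have : r ≠ 29 := by omega
    simp [← hρ, this]
  have ρV : ρ.view = τ.view := by
    rw [← hρ]; exact view_setLen_of_lt τ (a := 0) (by norm_num) L
  have ρL : ρ.len 0 = L := by simp [← hρ]
  have ρP : Params n k ls lN b ρ := hτ.congr fun r hr _ => ρr r (by omega)
  constructor
  · intro hx
    have hx' : x + 1 = 2 ^ (ls * b) := by
      by_contra h'; exact hx (if_neg h')
    refine wp_sinkProg ρP hw4 (v := v) (by rw [ρr 23 (by norm_num), r23]) hvl (by omega)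
      (by rw [ρL]; omega) ?_
    intro μ hμ hμV
    refine hQ μ (ρP.congr fun r hr _ => hμ r hr) ?_ ?_
    · rw [hμ 1 (by norm_num), ρr 1 (by norm_num), r1]
    · rw [hμV, relaxArc, if_neg (not_not.mpr hst), if_pos hx', ρV, ρL, hsrc]
  · intro hx
    have hx' : x + 1 ≠ 2 ^ (ls * b) := by
      intro h'; rw [if_pos h'] at hx; exact one_ne_zero hx
    refine wp_arcIndexProg ρP (e := q % k) (i := i) (x := x) (y := y) (by rw [ρr 20 (by norm_num), r20])
      (by rw [ρr 22 (by norm_num), r22]) (by rw [ρr 24 (by norm_num), r24])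
      (by rw [ρr 25 (by norm_num), r25]) hel hil (by omega) (by omega) h1 h2 (by omega)
      (hM ▸ h4) ?_
    intro μ μm μl μr μ32 μ34 μ35
    have hN := dig_lt lN y i
    have hS := dig_lt ls x i
    have b1 := mul_add_lt_mul (mul_add_lt_mul hN hS) hel
    rw [← hM] at b1
    refine wp_lookup f (by omega) (by rw [μ35]; exact b1) h4 (fun x hx => (hfw x hx).trans hls) ?_
    intro κ κm κl κ36 κr
    rw [μ35, hf _ _ _ hN hS hel] at κ36
    have κP : Params n k ls lN b κ := ρP.congr fun r hr _ => by
      rw [κr r (by omega) (by omega), μr r (by omega)]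
    have κV : κ.view = τ.view := by
      rw [← ρV]; funext c; simp only [Config.view, κm, κl, μm, μl]
    have κL : κ.len 0 = L := by rw [κl, μl, ρL]
    have κr' : ∀ r < 29, κ.reg r = τ.reg r := fun r hr => by
      rw [κr r (by omega) (by omega), μr r (by omega), ρr r hr]
    constructor
    swap
    · intro h36
      rw [κ36] at h36
      refine hskip κP (by rw [κr' 1 (by norm_num), r1]) ?_
      rw [κV, relaxArc, if_neg (not_not.mpr hst), if_neg hx', if_pos h36]
    · intro h36
      have htab : tab (dig lN y i) (dig ls x i) (q % k) < 2 ^ ls := by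
        rw [← hf _ _ _ hN hS hel]; exact hfw _ b1
      refine wp_arcProg κP (e := q % k) (i := i) (v := v) (x := x) (y := y) (a := dig ls x i)
        (by rw [κr' 20 (by norm_num), r20]) (by rw [κr' 22 (by norm_num), r22])
        (by rw [κr' 23 (by norm_num), r23]) (by rw [κr' 24 (by norm_num), r24])
        (by rw [κr' 26 (by norm_num), r26])
        (by rw [κr 32 (by norm_num) (by norm_num), μ32])
        (by rw [κr 34 (by norm_num) (by norm_num), μ34]) κ36 hel hil hvl hxl
        (dig_mul_le _ _ _) htab (setDig_lt htab hil hxl) (by omega) (by omega) hs hsw (by omega)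
        h3 (by rw [κL]; omega) ?_
      intro ν hν hνV
      refine hQ ν (κP.congr fun r hr _ => hν r hr) ?_ ?_
      · rw [hν 1 (by norm_num), κr' 1 (by norm_num), r1]
      · rw [κ36] at h36
        rw [hνV, relaxArc, if_neg (not_not.mpr hst), if_neg hx', if_neg h36, κV, κL, hsrc]

end

/-! ### Initialization and the whole program -/

/-- The number of steps of the main loop. -/
def steps (n k ls lN b : ℕ) : ℕ := 2 ^ (lN * b) * (b * (k + 2)) * 2 ^ (ls * b) * n * b * k

/-- Compute the parameters. -/
def initProg (k ls lN : ℕ) (p : Prog) : Prog :=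
  .straight [.const 5 1, .const 6 k, .const 9 ls, .const 10 lN, .const 11 2, .const 12 3,
    .op .div 2 0 6, .op .add 2 2 5, .op .mul 3 9 2, .op .shl 3 5 3, .op .add 20 6 11,
    .op .mul 4 2 20, .op .shl 7 5 9, .op .shl 8 5 10, .op .mul 20 10 2, .op .shl 1 5 20,
    .op .mul 1 1 4, .op .mul 1 1 3, .op .mul 1 1 0, .op .mul 1 1 2] p

/-- The whole program. -/
def mainProg (k ls lN : ℕ) (f : ℕ → ℕ) (M : ℕ) : Prog :=
  .seq (initProg k ls lN (.instr (.op .mul 1 1 6)))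
    (.seq (.loop 1 (bodyProg f M)) (.instr (.copyLen 13 11)))

theorem Prog.straight_size (l : List Instr) (p : Prog) :
    (Prog.straight l p).size = l.length + p.size := by
  induction l with
  | nil => simp [Prog.straight]
  | cons c l ih => simp only [Prog.straight, Prog.size, List.length_cons, ih]; omega

theorem wp_initProg {n : ℕ} {d : Fin n → Fin n → ℝ} {w s k ls lN b : ℕ} {Q : Config → Prop}
    (hn : 0 < n) (hk : 0 < k) (hb : b = n / k + 1) (hw : 4 < 2 ^ w) (hkw : k + 2 < 2 ^ w)
    (hlb : ls * b < 2 ^ w) (hlb' : lN * b < 2 ^ w) (hQw : steps n k ls lN b < 2 ^ w)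
    (hQ : ∀ τ : Config, Params n k ls lN b τ → τ.reg 1 = steps n k ls lN b →
      τ.mem = (fun _ => 0) → τ.len = (fun _ => ⟨0, 0⟩) → Q τ) :
    wp d w s (initProg k ls lN (.instr (.op .mul 1 1 6))) Q (initial n) := by
  have hb0 : 0 < b := hb ▸ Nat.succ_pos _
  have hw1 : 1 < 2 ^ w := by omega
  have hw2 : 2 < 2 ^ w := by omega
  have hw3 : 3 < 2 ^ w := by omega
  have hw0 : 0 < 2 ^ w := by omega
  have p1 : 0 < 2 ^ (lN * b) := by positivity
  have p2 : 0 < 2 ^ (ls * b) := by positivity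
  have p3 : 0 < b * (k + 2) := by positivity
  -- All factors are positive, so every partial product is bounded by the final one, and `hQw` alone
  -- excludes overflow in the chain of multiplications.
  have s5 : 2 ^ (lN * b) * (b * (k + 2)) * 2 ^ (ls * b) * n * b * k < 2 ^ w := hQw
  have s4 : 2 ^ (lN * b) * (b * (k + 2)) * 2 ^ (ls * b) * n * b < 2 ^ w :=
    (Nat.le_mul_of_pos_right _ hk).trans_lt s5
  have s3 : 2 ^ (lN * b) * (b * (k + 2)) * 2 ^ (ls * b) * n < 2 ^ w :=
    (Nat.le_mul_of_pos_right _ hb0).trans_lt s4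
  have s2 : 2 ^ (lN * b) * (b * (k + 2)) * 2 ^ (ls * b) < 2 ^ w :=
    (Nat.le_mul_of_pos_right _ hn).trans_lt s3
  have s1 : 2 ^ (lN * b) * (b * (k + 2)) < 2 ^ w :=
    (Nat.le_mul_of_pos_right _ p2).trans_lt s2
  have s0 : 2 ^ (lN * b) < 2 ^ w := (Nat.le_mul_of_pos_right _ p3).trans_lt s1
  have t1 : b * (k + 2) < 2 ^ w := (Nat.le_mul_of_pos_left _ p1).trans_lt s1
  have t2 : 2 ^ (ls * b) < 2 ^ w := (Nat.le_mul_of_pos_left _ (by positivity)).trans_lt s2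
  have u1 : k < 2 ^ w := by omega
  have u2 : ls < 2 ^ w := (Nat.le_mul_of_pos_right _ hb0).trans_lt hlb
  have u3 : lN < 2 ^ w := (Nat.le_mul_of_pos_right _ hb0).trans_lt hlb'
  have u4 : b < 2 ^ w := (Nat.le_mul_of_pos_right _ (by omega)).trans_lt t1
  have u5 : n / k < 2 ^ w := (hb ▸ Nat.lt_succ_self _ : n / k < b).trans u4
  have u6 : 2 ^ ls < 2 ^ w :=
    (Nat.pow_le_pow_right (by norm_num) (Nat.le_mul_of_pos_right _ hb0)).trans_lt t2
  have u7 : 2 ^ lN < 2 ^ w :=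
    (Nat.pow_le_pow_right (by norm_num) (Nat.le_mul_of_pos_right _ hb0)).trans_lt s0
  have hr0 : (initial n).reg 0 = n := rfl
  simp only [initProg, Prog.straight, wp, Instr.Legal, Instr.apply,
    Op.eval, Function.update_apply, Config.setReg_reg, Config.setReg_mem, Config.setReg_len]
  simp only [hr0, Nat.reduceEqDiff, reduceIte, OfNat.zero_ne_ofNat, hw1, hw2, hw3, hw0, ← hb,
    Nat.one_shiftLeft, u1, u2, u3, u4, u5, u6, u7, hlb, hlb', t1, t2, hkw, s0, s1, s2, s3, s4, s5,
    true_and, zero_ne_one]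
  refine hQ _ ?_ ?_ ?_ ?_
  · constructor <;> simp [initial]
  · simp [steps]
  · rfl
  · rfl

/-- This leaves the machine behind: what remains is an invariant `I` of tables under `relaxStep`
with decreasing step number. The `23` consists of 21 initial instructions, the last loop test and
the copying of the result. -/
theorem mainProg_exec {n : ℕ} {d : Fin n → Fin n → ℝ} {w s k ls lN b M : ℕ}
    {tab : ℕ → ℕ → ℕ → ℕ} {f : ℕ → ℕ} (I : ℕ → Table → Prop)
    (hn : 0 < n) (hk : 0 < k) (hb : b = n / k + 1)
    (hw4 : 4 < 2 ^ w) (hkw : k + 2 < 2 ^ w) (hqw : steps n k ls lN b < 2 ^ w)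
    (hs : 3 + 2 ^ (ls * b) * n ≤ s) (hsw : s ≤ 2 ^ w)
    (h0 : b * k + 1 < 2 ^ w) (h1 : b * ls < 2 ^ w) (h2 : b * lN < 2 ^ w)
    (h3 : 2 * 2 ^ (ls * b) < 2 ^ w) (hM : M = 2 ^ lN * 2 ^ ls * k) (h4 : M < 2 ^ w)
    (hf : ∀ j a e, j < 2 ^ lN → a < 2 ^ ls → e < k → f ((j * 2 ^ ls + a) * k + e) = tab j a e)
    (hfw : ∀ x < M, f x < 2 ^ ls)
    (hI0 : I (steps n k ls lN b) fun _ => (0, ⟨0, 0⟩))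
    (hIstep : ∀ q < steps n k ls lN b, ∀ V, I (q + 1) V → I q (relaxStep d k ls lN b tab q V))
    (hIt : ∀ q V, I q V → ∀ c, 1 ≤ c → (V c).2.terms ≤ b * k) :
    ∃ t τ, t ≤ ((bodyProg f M).size + 1) * steps n k ls lN b + 23 ∧
      Exec d w s (mainProg k ls lN f M) (initial n) t τ ∧
      ∃ V : Table, I 0 V ∧ τ.len 0 = (V 0).2 := by
  have hb0 : 0 < b := hb ▸ Nat.succ_pos _
  have hls : 2 ^ ls < 2 ^ w := by
    refine lt_of_le_of_lt (Nat.pow_le_pow_right (by norm_num) (Nat.le_mul_of_pos_right ls hb0)) ?_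
    omega
  obtain ⟨t, σ, ht, he, hσ, hr1, hm, hl⟩ := wp_exec _ (wp_initProg (d := d) (s := s)
    (Q := fun τ => Params n k ls lN b τ ∧ τ.reg 1 = steps n k ls lN b ∧
      τ.mem = (fun _ => 0) ∧ τ.len = (fun _ => ⟨0, 0⟩)) hn hk hb hw4 hkw
    (by rwa [mul_comm]) (by rwa [mul_comm]) hqw fun τ a1 a2 a3 a4 => ⟨a1, a2, a3, a4⟩)
  have hsize : (initProg k ls lN (.instr (.op .mul 1 1 6))).size = 21 := by
    rw [initProg, Prog.straight_size]; rfl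
  have hV : σ.view = fun _ => (0, ⟨0, 0⟩) := by
    funext c; simp [Config.view, hm, hl]
  obtain ⟨u, ρ, hu, he', hρ, -, hρI⟩ := exec_loop (d := d) (w := w) (s := s) (r := 1)
    (p := bodyProg f M) (N := steps n k ls lN b)
    (fun q σ => Params n k ls lN b σ ∧ σ.reg 1 = q ∧ I q σ.view) (fun q σ h => h.2.1)
    (fun q σ hq h => wp_bodyProg h.1 h.2.1 hn hk hb0 hw4 (by omega) hs hsw h0 h1 h2 h3 hM h4 hf hfw
      hls (hIt _ _ h.2.2) fun τ h1 h2 hV => ⟨h1, h2, hV ▸ hIstep q hq _ h.2.2⟩)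
    (steps n k ls lN b) σ le_rfl ⟨hσ, hr1, hV ▸ hI0⟩
  refine ⟨t + (u + 1), _, ?_, .seq _ _ _ _ _ _ _ he (.seq _ _ _ _ _ _ _ he'
    (.instr (.copyLen 13 11) ρ ?_)), ρ.view, hρI, ?_⟩
  · omega
  · have : 3 ≤ s := by omega
    simp only [Instr.Legal, hρ.r11, hρ.r13]; omega
  · simp [Instr.apply, hρ.r11, hρ.r13, Config.view]

/-! ### Analysis of the relaxation -/

section
variable {n : ℕ} {d : Fin n → Fin n → ℝ}

theorem Table.relax_apply (V : Table) (c a : ℕ) (L : Length) (c' : ℕ) :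
    V.relax c a L c' = V c' ∨ c' = c ∧ V.relax c a L c' = (a, L) := by
  rw [Table.relax]
  split_ifs
  · exact .inl rfl
  · rw [Function.update_apply]
    split_ifs with h
    · exact .inr ⟨h, rfl⟩
    · exact .inl rfl

/-- The cell `c` has stamp `a` and contains a length of value at most `z`. -/
def Table.Done (V : Table) (c a : ℕ) (z : ℝ) : Prop := (V c).1 = a ∧ (V c).2.val ≤ z

/-- With equal stamps a relaxation can only lower the value; `hc` excludes overwriting by a
different stamp. -/
theorem Table.Done.relax {V : Table} {c a c' a' : ℕ} {z : ℝ} {L : Length} (h : V.Done c a z)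
    (hc : c = c' → a = a') : (V.relax c' a' L).Done c a z := by
  rw [Table.relax]
  split_ifs with hif
  · exact h
  · rw [Done, Function.update_apply]
    split_ifs with hcc
    · subst hcc
      obtain rfl := hc rfl
      rw [not_and, not_le] at hif
      exact ⟨rfl, (hif h.1).le.trans h.2⟩
    · exact h

theorem Table.done_relax (V : Table) (c a : ℕ) (L : Length) :
    (V.relax c a L).Done c a L.val := by
  rw [Table.relax]
  split_ifs with hif
  · exact hif
  · simp [Done]

theorem cell_inj {x v x' v' : ℕ} (hv : v < n) (hv' : v' < n)
    (h : 1 + (x * n + v) = 1 + (x' * n + v')) : x = x' ∧ v = v' := by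
  have h' : x * n + v = x' * n + v' := by omega
  have hn : 0 < n := by omega
  have h1 := congrArg (· / n) h'
  have h2 := congrArg (· % n) h'
  simp only [Nat.mul_add_mod', Nat.mod_eq_of_lt hv, Nat.mod_eq_of_lt hv'] at h2
  simp only [mul_comm _ n, Nat.mul_add_div hn, Nat.div_eq_of_lt hv, Nat.div_eq_of_lt hv',
    add_zero] at h1
  exact ⟨h1, h2⟩

/-- What a correct transition table has to satisfy. The state `a` of the system number `j` represents
the set `dec j a`, and every linear order (given by positions `f`) is accepted by some system. -/
structure Transitions (k ls lN : ℕ) (tab : ℕ → ℕ → ℕ → ℕ) (dec : ℕ → ℕ → Finset ℕ) : Prop where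
  dec_zero : ∀ j < 2 ^ lN, dec j 0 = ∅
  dec_full : ∀ j < 2 ^ lN, dec j (2 ^ ls - 1) = Finset.range k
  tab_lt : ∀ j < 2 ^ lN, ∀ a < 2 ^ ls, ∀ e < k, tab j a e < 2 ^ ls
  sound : ∀ j < 2 ^ lN, ∀ a < 2 ^ ls, ∀ e < k, tab j a e ≠ 0 →
    e ∉ dec j a ∧ dec j (tab j a e) = insert e (dec j a)
  cover : ∀ f : ℕ → ℕ, Set.InjOn f (Set.Iio k) → ∃ j < 2 ^ lN, ∃ α : ℕ → ℕ, (∀ t, α t < 2 ^ ls) ∧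
    (∀ t, (∀ e < k, t ≤ f e) → α t = 0) ∧ (∀ t, (∀ e < k, f e < t) → α t = 2 ^ ls - 1) ∧
    (∀ t, (∀ e < k, f e ≠ t) → α (t + 1) = α t) ∧
    ∀ e < k, tab j (α (f e)) e = α (f e + 1) ∧ α (f e + 1) ≠ 0

/-- The last city on a walk; elements that are not in `[1, n)` are ignored, and walks start in
city `0`. -/
def lastCity (n : ℕ) : List ℕ → ℕ
  | [] => 0
  | e :: l => if e < n ∧ 0 < e then e else lastCity n l

/-- The length of a walk. -/
noncomputable def walkCost (d : Fin n → Fin n → ℝ) : List ℕ → ℝ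
  | [] => 0
  | e :: l => if e < n ∧ 0 < e then walkCost d l + distAt d (lastCity n l) e else walkCost d l

theorem lastCity_lt (hn : 0 < n) (l : List ℕ) : lastCity n l < n := by
  induction l with
  | nil => exact hn
  | cons e l ih =>
    rw [lastCity]
    split_ifs with h
    · exact h.1
    · exact ih

variable {k ls lN b : ℕ} {tab : ℕ → ℕ → ℕ → ℕ} {dec : ℕ → ℕ → Finset ℕ}

/-- The walk `l` leads to the state `x` in phase `y`. -/
structure Reach (k ls lN b : ℕ) (dec : ℕ → ℕ → Finset ℕ) (y x : ℕ) (l : List ℕ) : Prop where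
  nodup : l.Nodup
  lt : ∀ e ∈ l, e < b * k
  mem : ∀ i < b, ∀ e < k, e ∈ dec (dig lN y i) (dig ls x i) ↔ i * k + e ∈ l

theorem dig_zero (l i : ℕ) : dig l 0 i = 0 := by simp [dig]

theorem Reach.length_le {y x : ℕ} {l : List ℕ} (h : Reach k ls lN b dec y x l) :
    l.length ≤ b * k := by
  rw [← List.toFinset_card_of_nodup h.nodup]
  calc l.toFinset.card ≤ (Finset.range (b * k)).card := Finset.card_le_card fun e he => by
        simpa using h.lt e (by simpa using he)
    _ = b * k := by simp

theorem Reach.nil (hT : Transitions k ls lN tab dec) (y : ℕ) :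
    Reach k ls lN b dec y 0 [] where
  nodup := List.nodup_nil
  lt := by simp
  mem i _ e _ := by simp [dig_zero, hT.dec_zero _ (dig_lt lN y i)]

theorem mul_add_eq_iff {i e i' e' k : ℕ} (he : e < k) (he' : e' < k) :
    i * k + e = i' * k + e' ↔ i = i' ∧ e = e' :=
  ⟨fun h => cell_inj he he' (by omega), fun h => by rw [h.1, h.2]⟩

/-- A nonzero table entry certifies that `e` is new in its block, so the walk repeats nothing; the
digits of the other blocks are untouched. -/
theorem Reach.cons (hT : Transitions k ls lN tab dec) {y x i e : ℕ} {l : List ℕ}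
    (h : Reach k ls lN b dec y x l) (hi : i < b) (he : e < k)
    (htab : tab (dig lN y i) (dig ls x i) e ≠ 0) :
    Reach k ls lN b dec y (setDig ls x i (dig ls x i) (tab (dig lN y i) (dig ls x i) e))
      ((i * k + e) :: l) := by
  have hj := dig_lt lN y i
  have ha := dig_lt ls x i
  have ha' := hT.tab_lt _ hj _ ha _ he
  obtain ⟨h1, h2⟩ := hT.sound _ hj _ ha _ he htab
  refine ⟨List.nodup_cons.2 ⟨fun hl => h1 ((h.mem i hi e he).2 hl), h.nodup⟩, ?_, ?_⟩
  · intro c hc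
    rcases List.mem_cons.1 hc with rfl | hc
    · exact mul_add_lt_mul hi he
    · exact h.lt c hc
  · intro i' hi' e' he'
    rw [List.mem_cons, mul_add_eq_iff he' he]
    by_cases hii : i' = i
    · subst hii
      rw [dig_setDig_self ha', h2, Finset.mem_insert, h.mem i' hi' e' he']
      simp
    · rw [dig_setDig_of_ne ha' hii, h.mem i' hi' e' he']
      simp [hii]

/-- Every stamped cell holds the length of a walk, and the sink holds the length of a tour. -/
structure Sound (d : Fin n → Fin n → ℝ) (k ls lN b : ℕ) (dec : ℕ → ℕ → Finset ℕ) (V : Table) :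
    Prop where
  walk : ∀ y x v, x < 2 ^ (ls * b) → v < n → (V (1 + (x * n + v))).1 = y + 1 → ∃ l,
    Reach k ls lN b dec y x l ∧ lastCity n l = v ∧ (V (1 + (x * n + v))).2.val = walkCost d l ∧
    (V (1 + (x * n + v))).2.terms ≤ l.length
  sink : (V 0).1 ≠ 0 → ∃ l y, Reach k ls lN b dec y (2 ^ (ls * b) - 1) l ∧
    (V 0).2.val = walkCost d l + distAt d (lastCity n l) 0
  terms : ∀ c, 1 ≤ c → (V c).2.terms ≤ b * k

/-- The stamp of a cell names the phase in which its state is to be decoded. Cells left over from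
other phases thus stay meaningful, and the table is never cleared. -/
theorem Sound.relax {V : Table} (h : Sound d k ls lN b dec V) {y x : ℕ} {l : List ℕ} {L : Length}
    {v : ℕ} (hv : v < n) (hl : Reach k ls lN b dec y x l) (hlast : lastCity n l = v)
    (hval : L.val = walkCost d l) (hterms : L.terms ≤ l.length) :
    Sound d k ls lN b dec (V.relax (1 + (x * n + v)) (y + 1) L) where
  walk y' x' v' hx' hv' hst := by
    rcases V.relax_apply (1 + (x * n + v)) (y + 1) L (1 + (x' * n + v')) with h' | ⟨h', h''⟩
    · rw [h'] at hst ⊢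
      exact h.walk y' x' v' hx' hv' hst
    · obtain ⟨rfl, rfl⟩ := cell_inj hv' hv h'
      rw [h''] at hst ⊢
      obtain rfl : y = y' := Nat.succ.inj hst
      exact ⟨l, hl, hlast, hval, hterms⟩
  sink hst := by
    rcases V.relax_apply (1 + (x * n + v)) (y + 1) L 0 with h' | ⟨h', -⟩
    · rw [h'] at hst ⊢
      exact h.sink hst
    · omega
  terms c hc := by
    rcases V.relax_apply (1 + (x * n + v)) (y + 1) L c with h' | ⟨-, h''⟩
    · rw [h']; exact h.terms c hc
    · rw [h'']; exact hterms.trans hl.length_le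

theorem Sound.relax_sink {V : Table} (h : Sound d k ls lN b dec V) {y : ℕ} {l : List ℕ}
    {L : Length} (hl : Reach k ls lN b dec y (2 ^ (ls * b) - 1) l)
    (hval : L.val = walkCost d l + distAt d (lastCity n l) 0) :
    Sound d k ls lN b dec (V.relax 0 1 L) where
  walk y' x' v' hx' hv' hst := by
    rcases V.relax_apply 0 1 L (1 + (x' * n + v')) with h' | ⟨h', -⟩
    · rw [h'] at hst ⊢
      exact h.walk y' x' v' hx' hv' hst
    · omega
  sink hst := by
    rcases V.relax_apply 0 1 L 0 with h' | ⟨-, h''⟩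
    · rw [h'] at hst ⊢
      exact h.sink hst
    · rw [h'']
      exact ⟨l, y, hl, hval⟩
  terms c hc := by
    rcases V.relax_apply 0 1 L c with h' | ⟨h', -⟩
    · rw [h']; exact h.terms c hc
    · omega

/-- Cell `1` belongs to state `0` and last city `0`, that is, to the empty walk, of length zero. -/
theorem Sound.start (hT : Transitions k ls lN tab dec) (hn : 0 < n) {V : Table}
    (h : Sound d k ls lN b dec V) (y : ℕ) :
    Sound d k ls lN b dec (Function.update V 1 (y + 1, ⟨0, 0⟩)) where
  walk y' x' v' hx' hv' hst := by
    rw [Function.update_apply] at hst ⊢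
    split_ifs at hst ⊢ with h1
    · obtain ⟨rfl, rfl⟩ := cell_inj (x := x') (x' := 0) (v' := 0) hv' hn (by omega)
      obtain rfl : y = y' := Nat.succ.inj hst
      exact ⟨[], Reach.nil hT y, rfl, rfl, le_rfl⟩
    · exact h.walk y' x' v' hx' hv' hst
  sink hst := by
    rw [Function.update_of_ne (by norm_num)] at hst ⊢
    exact h.sink hst
  terms c hc := by
    rw [Function.update_apply]
    split_ifs
    · exact Nat.zero_le _
    · exact h.terms c hc

theorem Sound.relaxArc (hT : Transitions k ls lN tab dec) {V : Table}
    (h : Sound d k ls lN b dec V) {e i v x y : ℕ} (he : e < k) (hi : i < b) (hv : v < n)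
    (hx : x < 2 ^ (ls * b)) : Sound d k ls lN b dec (relaxArc d k ls lN b tab e i v x y V) := by
  rw [TSP.relaxArc]
  split_ifs with h1 h2 h3 h4
  · exact h
  · obtain ⟨l, hl, hlast, hval, -⟩ := h.walk y x v hx hv (not_not.1 h1)
    obtain rfl : x = 2 ^ (ls * b) - 1 := by omega
    exact h.relax_sink hl (by rw [Length.addDist, hval, hlast])
  · exact h
  · obtain ⟨l, hl, hlast, hval, ht⟩ := h.walk y x v hx hv (not_not.1 h1)
    refine h.relax h4.1 (hl.cons hT hi he h3) (if_pos h4) ?_ ?_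
    · rw [walkCost, if_pos h4, Length.addDist, hval, hlast]
    · exact Nat.succ_le_succ ht
  · obtain ⟨l, hl, hlast, hval, ht⟩ := h.walk y x v hx hv (not_not.1 h1)
    refine h.relax hv (hl.cons hT hi he h3) ((if_neg h4).trans hlast) ?_ ?_
    · rw [walkCost, if_neg h4, hval]
    · rw [List.length_cons]; omega

theorem Sound.relaxStep (hT : Transitions k ls lN tab dec) (hn : 0 < n) (hk : 0 < k) (hb : 0 < b)
    {V : Table} (h : Sound d k ls lN b dec V) (q : ℕ) :
    Sound d k ls lN b dec (relaxStep d k ls lN b tab q V) :=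
  (h.start hT hn _).relaxArc hT (Nat.mod_lt _ hk) (Nat.mod_lt _ hb) (Nat.mod_lt _ hn)
    (Nat.mod_lt _ (by positivity))

theorem sound_init : Sound d k ls lN b dec fun _ => (0, ⟨0, 0⟩) where
  walk y x v _ _ h := absurd h (by simp)
  sink h := absurd rfl h
  terms _ _ := Nat.zero_le _

end

/-! ### Completeness of the relaxation -/

section
variable {n : ℕ} {d : Fin n → Fin n → ℝ} {k ls lN b : ℕ} {tab : ℕ → ℕ → ℕ → ℕ}
  {dec : ℕ → ℕ → Finset ℕ}

/-- The number of steps in one round. -/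
def roundSize (n k ls b : ℕ) : ℕ := 2 ^ (ls * b) * n * b * k

/-- The number of the step that relaxes a given arc in the round number `m`. -/
def arcCode (n k ls b m x v i e : ℕ) : ℕ := (((m * 2 ^ (ls * b) + x) * n + v) * b + i) * k + e

/-- With `arcCode_lt`, this places all arcs of round `m` in a window of length `roundSize`. -/
theorem le_arcCode (m x v i e : ℕ) : m * roundSize n k ls b ≤ arcCode n k ls b m x v i e := by
  rw [arcCode, roundSize, show m * (2 ^ (ls * b) * n * b * k) = m * 2 ^ (ls * b) * n * b * k by ring]
  refine (Nat.mul_le_mul_right k ?_).trans (Nat.le_add_right _ _)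
  refine (Nat.mul_le_mul_right b ?_).trans (Nat.le_add_right _ _)
  refine (Nat.mul_le_mul_right n ?_).trans (Nat.le_add_right _ _)
  exact Nat.le_add_right _ _

theorem arcCode_lt {m x v i e : ℕ} (hx : x < 2 ^ (ls * b)) (hv : v < n) (hi : i < b) (he : e < k) :
    arcCode n k ls b m x v i e < (m + 1) * roundSize n k ls b := by
  rw [arcCode, roundSize,
    show (m + 1) * (2 ^ (ls * b) * n * b * k) = (m + 1) * 2 ^ (ls * b) * n * b * k by ring]
  refine mul_add_lt_mul (mul_add_lt_mul (mul_add_lt_mul ?_ hv) hi) he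
  rw [add_mul, one_mul]
  exact Nat.add_lt_add_left hx _

theorem mul_add_div_of_lt {a b k : ℕ} (h : b < k) : (a * k + b) / k = a := by
  rw [mul_comm, Nat.mul_add_div (by omega), Nat.div_eq_of_lt h, add_zero]

theorem relaxStep_arcCode {y ρ x v i e : ℕ} (hρ : ρ < b * (k + 2)) (hx : x < 2 ^ (ls * b))
    (hv : v < n) (hi : i < b) (he : e < k) (V : Table) :
    relaxStep d k ls lN b tab (arcCode n k ls b (y * (b * (k + 2)) + ρ) x v i e) V =
      relaxArc d k ls lN b tab e i v x y (Function.update V 1 (y + 1, ⟨0, 0⟩)) := by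
  simp only [relaxStep, arcCode, mul_add_div_of_lt he, mul_add_div_of_lt hi, mul_add_div_of_lt hv,
    mul_add_div_of_lt hx, mul_add_div_of_lt hρ, Nat.mul_add_mod', Nat.mod_eq_of_lt he,
    Nat.mod_eq_of_lt hi, Nat.mod_eq_of_lt hv, Nat.mod_eq_of_lt hx]

theorem phase_eq {q y : ℕ} (h1 : y * (b * (k + 2)) * roundSize n k ls b ≤ q)
    (h2 : q < (y + 1) * (b * (k + 2)) * roundSize n k ls b) :
    q / k / b / n / 2 ^ (ls * b) / (b * (k + 2)) = y := by
  rw [Nat.div_div_eq_div_mul, Nat.div_div_eq_div_mul, Nat.div_div_eq_div_mul,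
    Nat.div_div_eq_div_mul]
  refine Nat.div_eq_of_lt_le ?_ ?_
  · refine le_trans (le_of_eq ?_) h1
    rw [roundSize]; ring
  · refine lt_of_lt_of_le h2 (le_of_eq ?_)
    rw [roundSize]; ring

theorem Table.Done.relaxArc {V : Table} {c a : ℕ} {z : ℝ} (h : V.Done c a z) {e i v x y : ℕ}
    (hc : c = 0 → a = 1) (hc' : c ≠ 0 → a = y + 1) :
    (relaxArc d k ls lN b tab e i v x y V).Done c a z := by
  rw [TSP.relaxArc]
  split_ifs
  · exact h
  · exact h.relax hc
  · exact h
  · exact h.relax fun h' => hc' (by omega)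
  · exact h.relax fun h' => hc' (by omega)

theorem Table.Done.update {V : Table} {c a : ℕ} {z : ℝ} (h : V.Done c a z) (hc : c ≠ 1)
    (p : ℕ × Length) : Table.Done (Function.update V 1 p) c a z := by
  rw [Done, Function.update_of_ne hc]; exact h

/-- The sink has stamp `1` in all phases, so its value survives a change of phase; for other cells,
`relaxStep_done` has to stay within phase `y`. -/
theorem relaxStep_done_sink {V : Table} {z : ℝ} (h : V.Done 0 1 z) (q : ℕ) :
    (relaxStep d k ls lN b tab q V).Done 0 1 z :=
  (h.update (by norm_num) _).relaxArc (fun _ => rfl) (fun h => absurd rfl h)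

theorem relaxStep_done {V : Table} {z : ℝ} {c q y : ℕ} (h : V.Done c (y + 1) z) (hc : 2 ≤ c)
    (hy : q / k / b / n / 2 ^ (ls * b) / (b * (k + 2)) = y) :
    (relaxStep d k ls lN b tab q V).Done c (y + 1) z := by
  rw [relaxStep, hy]
  exact (h.update (by omega) _).relaxArc (fun h => by omega) (fun _ => rfl)

theorem relaxStep_done_start {V : Table} {q y : ℕ}
    (hy : q / k / b / n / 2 ^ (ls * b) / (b * (k + 2)) = y) :
    (relaxStep d k ls lN b tab q V).Done 1 (y + 1) 0 := by
  rw [relaxStep, hy]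
  refine Table.Done.relaxArc ?_ (fun h => by omega) (fun _ => rfl)
  simp [Table.Done]

/-- A path of length `m` in the state space of phase `y`. -/
structure Path (d : Fin n → Fin n → ℝ) (k ls lN b : ℕ) (tab : ℕ → ℕ → ℕ → ℕ) (y m : ℕ)
    (x v i e : ℕ → ℕ) (c : ℕ → ℝ) : Prop where
  x_zero : x 0 = 0
  v_zero : v 0 = 0
  c_zero : c 0 = 0
  x_lt : ∀ r ≤ m, x r < 2 ^ (ls * b)
  v_lt : ∀ r ≤ m, v r < n
  i_lt : ∀ r < m, i r < b
  e_lt : ∀ r < m, e r < k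
  x_ne_full : ∀ r < m, x r + 1 ≠ 2 ^ (ls * b)
  x_ne_zero : ∀ r < m, x (r + 1) ≠ 0
  tab_ne : ∀ r < m, tab (dig lN y (i r)) (dig ls (x r) (i r)) (e r) ≠ 0
  x_succ : ∀ r < m, x (r + 1) = setDig ls (x r) (i r) (dig ls (x r) (i r))
    (tab (dig lN y (i r)) (dig ls (x r) (i r)) (e r))
  visit : ∀ r < m, i r * k + e r < n ∧ 0 < i r * k + e r →
    v (r + 1) = i r * k + e r ∧ c (r + 1) = c r + distAt d (v r) (i r * k + e r)
  skip : ∀ r < m, ¬ (i r * k + e r < n ∧ 0 < i r * k + e r) → v (r + 1) = v r ∧ c (r + 1) = c r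
  x_full : x m + 1 = 2 ^ (ls * b)

/-! ### Propagation along one path during the countdown -/

section Path
variable {y m : ℕ} {x v i e : ℕ → ℕ} {c : ℕ → ℝ}

/-- After this many remaining steps, the end of the path of length `r` has been reached. -/
def deadline (n k ls b y : ℕ) (x v i e : ℕ → ℕ) : ℕ → ℕ
  | 0 => (y * (b * (k + 2)) + b * (k + 2)) * roundSize n k ls b - 1
  | r + 1 => arcCode n k ls b (y * (b * (k + 2)) + (b * (k + 2) - r - 2)) (x r) (v r) (i r) (e r)

/-- The step in which the tour is closed. -/
def sinkDeadline (n k ls b y m : ℕ) (x v : ℕ → ℕ) : ℕ :=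
  arcCode n k ls b (y * (b * (k + 2)) + (b * (k + 2) - m - 2)) (x m) (v m) 0 0

/-- Rounds are run with decreasing numbers. The arc leaving the end of the path of length `r` is
scheduled in round `b * (k + 2) - r - 2`, and the end itself is reached before that round begins;
hence the order of the arcs within a round does not matter. The `+ 2` in `hr` pays for an idle first
round and the round that closes the tour. -/
theorem le_deadline (hn : 0 < n) (hk : 0 < k)
    (hb : 0 < b) {r : ℕ} (hr : r + 2 ≤ b * (k + 2)) :
    (y * (b * (k + 2)) + (b * (k + 2) - r - 2) + 1) * roundSize n k ls b ≤
      deadline n k ls b y x v i e r := by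
  cases r with
  | zero =>
    have h : 0 < roundSize n k ls b := by rw [roundSize]; positivity
    rw [deadline]
    refine Nat.le_sub_of_add_le ?_
    calc _ ≤ (y * (b * (k + 2)) + (b * (k + 2) - 0 - 2) + 1) * roundSize n k ls b +
          roundSize n k ls b := by omega
      _ = (y * (b * (k + 2)) + (b * (k + 2) - 0 - 2) + 2) * roundSize n k ls b := by ring
      _ ≤ _ := Nat.mul_le_mul_right _ (by omega)
  | succ r =>
    refine le_trans ?_ (le_arcCode _ _ _ _ _)
    exact Nat.mul_le_mul_right _ (by omega)

/-- One step of the Bellman–Ford induction. Either the deadline has already passed and `Done`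
persists, or this step relaxes exactly the scheduled arc, whose source is ready by `hsrc`. -/
theorem Path.done (hP : Path d k ls lN b tab y m x v i e c) (hn : 0 < n) (hk : 0 < k)
    (hb : 0 < b) (hm : m + 2 ≤ b * (k + 2)) {q : ℕ} {V : Table}
    (hV : (y * (b * (k + 2)) * roundSize n k ls b ≤ q + 1 → ∀ r ≤ m,
      q + 1 ≤ deadline n k ls b y x v i e r → V.Done (1 + (x r * n + v r)) (y + 1) (c r)) ∧
      (q + 1 ≤ sinkDeadline n k ls b y m x v → V.Done 0 1 (c m + distAt d (v m) 0))) :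
    (y * (b * (k + 2)) * roundSize n k ls b ≤ q → ∀ r ≤ m,
      q ≤ deadline n k ls b y x v i e r →
        (relaxStep d k ls lN b tab q V).Done (1 + (x r * n + v r)) (y + 1) (c r)) ∧
      (q ≤ sinkDeadline n k ls b y m x v →
        (relaxStep d k ls lN b tab q V).Done 0 1 (c m + distAt d (v m) 0)) := by
  have hR : 0 < roundSize n k ls b := by rw [roundSize]; positivity
  -- Cell `1` is overwritten in every step; after its start the path avoids it because its states
  -- are nonzero.
  have hcell : ∀ r < m, 2 ≤ 1 + (x (r + 1) * n + v (r + 1)) := by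
    intro r hr
    have : 0 < x (r + 1) * n := Nat.mul_pos (Nat.pos_of_ne_zero (hP.x_ne_zero r hr)) hn
    omega
  have hsrc : ∀ r ≤ m, ∀ x' v' i' e', x' < 2 ^ (ls * b) → v' < n → i' < b → e' < k →
      q = arcCode n k ls b (y * (b * (k + 2)) + (b * (k + 2) - r - 2)) x' v' i' e' →
      Table.Done (Function.update V 1 (y + 1, ⟨0, 0⟩)) (1 + (x r * n + v r)) (y + 1) (c r) := by
    intro r hr x' v' i' e' hx' hv' hi' he' hq
    cases r with
    | zero => simp [Table.Done, hP.x_zero, hP.v_zero, hP.c_zero]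
    | succ r =>
      refine (hV.1 ?_ (r + 1) hr ?_).update (by have := hcell r hr; omega) _
      · refine le_trans (Nat.mul_le_mul_right _ (Nat.le_add_right _ _)) (hq ▸ le_arcCode _ _ _ _ _ |>.trans (Nat.le_succ _))
      · refine le_trans ?_ (le_deadline hn hk hb (by omega))
        rw [hq]
        exact arcCode_lt hx' hv' hi' he'
  constructor
  · intro hqy r hr hqr
    have hphase : q / k / b / n / 2 ^ (ls * b) / (b * (k + 2)) = y := by
      refine phase_eq hqy (hqr.trans_lt ?_)
      cases r with
      | zero =>
        rw [deadline, add_mul y, one_mul]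
        refine Nat.sub_lt ?_ one_pos
        have : 0 < b * (k + 2) := by positivity
        positivity
      | succ r =>
        have hr' : r < m := hr
        refine (arcCode_lt (hP.x_lt r (by omega)) (hP.v_lt r (by omega)) (hP.i_lt r hr)
          (hP.e_lt r hr)).trans_le (Nat.mul_le_mul_right _ ?_)
        rw [add_mul y, one_mul]
        omega
    cases r with
    | zero =>
      have := relaxStep_done_start (d := d) (lN := lN) (tab := tab) (V := V) hphase
      simpa [hP.x_zero, hP.v_zero, hP.c_zero] using this
    | succ r =>
      have hr' : r < m := hr
      rcases Nat.lt_or_ge q (deadline n k ls b y x v i e (r + 1)) with h | h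
      · exact relaxStep_done (hV.1 (by omega) (r + 1) hr h) (hcell r hr) hphase
      · have hq : q = arcCode n k ls b (y * (b * (k + 2)) + (b * (k + 2) - r - 2)) (x r) (v r) (i r)
          (e r) := le_antisymm hqr h
        have hs := hsrc r (by omega) _ _ _ _ (hP.x_lt r (by omega)) (hP.v_lt r (by omega))
          (hP.i_lt r hr) (hP.e_lt r hr) hq
        rw [hq, relaxStep_arcCode (by omega) (hP.x_lt r (by omega)) (hP.v_lt r (by omega))
          (hP.i_lt r hr) (hP.e_lt r hr), relaxArc, if_neg (not_not.2 hs.1),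
          if_neg (hP.x_ne_full r hr), if_neg (hP.tab_ne r hr), ← hP.x_succ r hr]
        split_ifs with hvis
        · obtain ⟨h1, h2⟩ := hP.visit r hr hvis
          rw [← h1]
          have h3 := Table.done_relax (Function.update V 1 (y + 1, ⟨0, 0⟩))
            (1 + (x (r + 1) * n + v (r + 1))) (y + 1)
            (Length.addDist (Function.update V 1 (y + 1, ⟨0, 0⟩) (1 + (x r * n + v r))).2 d (v r)
              (v (r + 1)))
          refine ⟨h3.1, h3.2.trans ?_⟩
          rw [h2, Length.addDist, ← h1]
          exact add_le_add_left hs.2 _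
        · obtain ⟨h1, h2⟩ := hP.skip r hr hvis
          rw [← h1]
          have h3 := Table.done_relax (Function.update V 1 (y + 1, ⟨0, 0⟩))
            (1 + (x (r + 1) * n + v (r + 1))) (y + 1)
            (Function.update V 1 (y + 1, ⟨0, 0⟩) (1 + (x r * n + v (r + 1)))).2
          refine ⟨h3.1, h3.2.trans ?_⟩
          rw [h2, h1]
          exact hs.2
  · intro hq
    rcases Nat.lt_or_ge q (sinkDeadline n k ls b y m x v) with h | h
    · exact relaxStep_done_sink (hV.2 h) q
    · have hq : q = arcCode n k ls b (y * (b * (k + 2)) + (b * (k + 2) - m - 2)) (x m) (v m) 0 0 :=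
        le_antisymm hq h
      have hs := hsrc m le_rfl _ _ _ _ (hP.x_lt m le_rfl) (hP.v_lt m le_rfl) hb hk hq
      rw [hq, relaxStep_arcCode (by omega) (hP.x_lt m le_rfl) (hP.v_lt m le_rfl) hb hk, relaxArc,
        if_neg (not_not.2 hs.1), if_pos hP.x_full]
      have h3 := Table.done_relax (Function.update V 1 (y + 1, ⟨0, 0⟩)) 0 1
        (Length.addDist (Function.update V 1 (y + 1, ⟨0, 0⟩) (1 + (x m * n + v m))).2 d (v m) 0)
      refine ⟨h3.1, h3.2.trans ?_⟩
      rw [Length.addDist]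
      exact add_le_add_left hs.2 _

theorem mul_roundSize_le_steps (hy : y < 2 ^ (lN * b)) :
    (y * (b * (k + 2)) + b * (k + 2)) * roundSize n k ls b ≤ steps n k ls lN b := by
  have h1 : steps n k ls lN b = 2 ^ (lN * b) * (b * (k + 2)) * roundSize n k ls b := by
    rw [steps, roundSize]; ring
  rw [h1, ← Nat.succ_mul]
  exact Nat.mul_le_mul_right _ (Nat.mul_le_mul_right _ hy)

theorem Path.deadline_lt (hP : Path d k ls lN b tab y m x v i e c) (hn : 0 < n) (hk : 0 < k)
    (hb : 0 < b) (hm : m + 2 ≤ b * (k + 2)) (hy : y < 2 ^ (lN * b)) {r : ℕ} (hr : r ≤ m) :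
    deadline n k ls b y x v i e r < steps n k ls lN b := by
  refine lt_of_lt_of_le ?_ (mul_roundSize_le_steps hy)
  cases r with
  | zero =>
    have h : 0 < roundSize n k ls b := by rw [roundSize]; positivity
    refine Nat.sub_lt ?_ one_pos
    positivity
  | succ r =>
    refine (arcCode_lt (hP.x_lt r (by omega)) (hP.v_lt r (by omega)) (hP.i_lt r hr)
          (hP.e_lt r hr)).trans_le (Nat.mul_le_mul_right _ ?_)
    omega

theorem Path.sinkDeadline_lt (hP : Path d k ls lN b tab y m x v i e c) (hk : 0 < k)
    (hb : 0 < b) (hm : m + 2 ≤ b * (k + 2)) (hy : y < 2 ^ (lN * b)) :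
    sinkDeadline n k ls b y m x v < steps n k ls lN b := by
  refine lt_of_lt_of_le ?_ (mul_roundSize_le_steps hy)
  refine (arcCode_lt (hP.x_lt m le_rfl) (hP.v_lt m le_rfl) hb hk).trans_le
    (Nat.mul_le_mul_right _ ?_)
  omega

end Path

end

/-! ### Walks and tours -/

section
variable {n : ℕ} {d : Fin n → Fin n → ℝ}

/-- The walk that visits `g 0, …, g (t - 1)`. -/
def walkOf (g : ℕ → ℕ) : ℕ → List ℕ
  | 0 => []
  | t + 1 => g t :: walkOf g t

theorem walkOf_congr {g h : ℕ → ℕ} {t : ℕ} (H : ∀ i < t, g i = h i) : walkOf g t = walkOf h t := by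
  induction t with
  | zero => rfl
  | succ t ih => rw [walkOf, walkOf, H t (Nat.lt_succ_self t), ih fun i hi => H i (by omega)]

/-- Walks carry their most recent element at the head, hence the `reverse`. -/
theorem walkOf_getD (l : List ℕ) : walkOf (fun t => l.reverse.getD t 0) l.length = l := by
  induction l with
  | nil => rfl
  | cons e l ih =>
    rw [List.length_cons, walkOf]
    congr 1
    · simp [List.getD_eq_getElem?_getD]
    · refine (walkOf_congr fun i hi => ?_).trans ih
      have : i < l.reverse.length := by simpa using hi
      simp only [List.reverse_cons]
      rw [List.getD_append _ _ _ _ this]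

theorem walkOf_prefix {g : ℕ → ℕ} (g0 : g 0 = 0) (hg : ∀ t < n, 0 < t → g t < n ∧ 0 < g t) {t : ℕ}
    (ht : t < n) : lastCity n (walkOf g (t + 1)) = g t ∧
      walkCost d (walkOf g (t + 1)) = ∑ i ∈ Finset.range t, distAt d (g i) (g (i + 1)) := by
  induction t with
  | zero => simp [walkOf, lastCity, walkCost, g0]
  | succ t ih =>
    obtain ⟨h1, h2⟩ := ih (by omega)
    rw [walkOf, lastCity, walkCost, if_pos (hg _ ht (Nat.succ_pos t)),
      if_pos (hg _ ht (Nat.succ_pos t)), h1, h2, Finset.sum_range_succ]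
    exact ⟨rfl, rfl⟩

theorem walkOf_dummies {g : ℕ → ℕ} (hg : ∀ t, n ≤ t → n ≤ g t) (t : ℕ) :
    lastCity n (walkOf g (n + t)) = lastCity n (walkOf g n) ∧
      walkCost d (walkOf g (n + t)) = walkCost d (walkOf g n) := by
  induction t with
  | zero => exact ⟨rfl, rfl⟩
  | succ t ih =>
    have : ¬ (g (n + t) < n ∧ 0 < g (n + t)) := fun h => by
      have := hg (n + t) (by omega); omega
    rw [← add_assoc, walkOf, lastCity, walkCost, if_neg this, if_neg this]
    exact ih

theorem walkOf_tour {g : ℕ → ℕ} (hn : 0 < n) (π : Equiv.Perm (Fin n)) (hg : ∀ i : Fin n, g i = π i)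
    (g0 : g 0 = 0) : walkCost d (walkOf g n) + distAt d (lastCity n (walkOf g n)) 0 =
      tourLength d π := by
  obtain ⟨m, rfl⟩ : ∃ m, n = m + 1 := ⟨n - 1, by omega⟩
  have hpos : ∀ t < m + 1, 0 < t → g t < m + 1 ∧ 0 < g t := by
    intro t ht ht0
    have h1 := hg ⟨t, ht⟩
    have h2 := hg 0
    refine ⟨by rw [h1]; exact (π _).2, Nat.pos_of_ne_zero fun h => ?_⟩
    have h3 : π ⟨t, ht⟩ = π 0 := Fin.ext (by rw [← h1, ← h2, h]; exact g0.symm)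
    have h4 := congrArg Fin.val (π.injective h3)
    simp at h4
    omega
  obtain ⟨h1, h2⟩ := walkOf_prefix (d := d) g0 hpos (Nat.lt_succ_self m)
  have hd : ∀ i j : Fin (m + 1), distAt d (g i) (g j) = d (π i) (π j) := by
    intro i j
    rw [hg, hg, distAt, dif_pos ⟨(π i).2, (π j).2⟩]
  rw [h1, h2, tourLength, Fin.sum_univ_castSucc, finRotate_last, Finset.sum_range]
  have e0 : distAt d (g m) 0 = d (π (Fin.last m)) (π 0) := by
    rw [← hd, Fin.val_last, Fin.val_zero, g0]
  rw [e0]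
  congr 1
  refine Finset.sum_congr rfl fun i _ => ?_
  have : finRotate (m + 1) i.castSucc = i.succ := by
    rw [finRotate_apply, Fin.coeSucc_eq_succ]
  rw [this, ← hd, Fin.val_castSucc, Fin.val_succ]

theorem lastCity_filter (l : List ℕ) :
    lastCity n (l.filter (fun e => e < n ∧ 0 < e)) = lastCity n l := by
  induction l with
  | nil => rfl
  | cons e l ih =>
    by_cases h : e < n ∧ 0 < e
    · rw [List.filter_cons_of_pos (by simpa using h), lastCity, lastCity, if_pos h, if_pos h]
    · rw [List.filter_cons_of_neg (by simpa using h), lastCity, if_neg h, ih]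

theorem walkCost_filter (l : List ℕ) :
    walkCost d (l.filter (fun e => e < n ∧ 0 < e)) = walkCost d l := by
  induction l with
  | nil => rfl
  | cons e l ih =>
    by_cases h : e < n ∧ 0 < e
    · rw [List.filter_cons_of_pos (by simpa using h), walkCost, walkCost, if_pos h, if_pos h, ih,
        lastCity_filter]
    · rw [List.filter_cons_of_neg (by simpa using h), walkCost, if_neg h, ih]

theorem lastCity_append_zero (l : List ℕ) : lastCity n (l ++ [0]) = lastCity n l := by
  induction l with
  | nil => simp [lastCity]
  | cons e l ih => rw [List.cons_append, lastCity, lastCity, ih]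

theorem walkCost_append_zero (l : List ℕ) : walkCost d (l ++ [0]) = walkCost d l := by
  induction l with
  | nil => simp [walkCost]
  | cons e l ih => rw [List.cons_append, walkCost, walkCost, ih, lastCity_append_zero]

/-- A walk that visits every city exactly once is a tour. -/
theorem exists_tour (hn : 0 < n) {l : List ℕ} (hl : l.Nodup) (hmem : ∀ e < n, 0 < e → e ∈ l) :
    ∃ π : Equiv.Perm (Fin n), walkCost d l + distAt d (lastCity n l) 0 = tourLength d π := by
  -- Padding elements and city `0` affect neither the cost nor the last city. They are dropped, and
  -- `0` is put back as the oldest entry, so that exactly the `n` cities remain.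
  set r := l.filter (fun e => e < n ∧ 0 < e) ++ [0] with hr
  have hrn : r.Nodup := by
    refine List.Nodup.append (hl.filter _) (List.nodup_singleton 0) ?_
    simp
  have hrm : ∀ e, e ∈ r ↔ e < n := by
    intro e
    simp only [hr, List.mem_append, List.mem_filter, List.mem_singleton, decide_eq_true_eq]
    constructor
    · rintro (h | h) <;> omega
    · intro h
      rcases Nat.eq_zero_or_pos e with h0 | h0
      · exact .inr h0
      · exact .inl ⟨hmem e h h0, h, h0⟩
  have hlen : r.length = n := by
    rw [← List.toFinset_card_of_nodup hrn]
    conv_rhs => rw [← Finset.card_range n]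
    congr 1
    ext e
    simp [hrm]
  set g : ℕ → ℕ := fun t => r.reverse.getD t 0 with hg
  have hgl : ∀ t (ht : t < n), ∃ h : t < r.reverse.length, g t = r.reverse[t] := by
    intro t ht
    have h : t < r.reverse.length := by rw [List.length_reverse, hlen]; exact ht
    exact ⟨h, List.getD_eq_getElem _ _ h⟩
  have hglt : ∀ t : Fin n, g t < n := by
    intro t
    obtain ⟨h, h'⟩ := hgl t t.2
    rw [h', ← hrm, ← List.mem_reverse]
    exact List.getElem_mem h
  have hinj : Function.Injective fun t : Fin n => (⟨g t, hglt t⟩ : Fin n) := by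
    intro s t hst
    have hst' : g s = g t := congrArg Fin.val hst
    obtain ⟨h1, h1'⟩ := hgl s s.2
    obtain ⟨h2, h2'⟩ := hgl t t.2
    rw [h1', h2'] at hst'
    exact Fin.ext ((List.Nodup.getElem_inj_iff (List.nodup_reverse.2 hrn)).1 hst')
  refine ⟨Equiv.ofBijective _ (Finite.injective_iff_bijective.1 hinj), ?_⟩
  have hw : walkOf g n = r := by
    rw [← hlen]; exact walkOf_getD r
  rw [← walkOf_tour (g := g) hn _ (fun i => rfl) (by simp [hg, hr, List.getD_eq_getElem?_getD]), hw, hr,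
    walkCost_append_zero, lastCity_append_zero, walkCost_filter, lastCity_filter]

theorem tourLength_rotate [NeZero n] (π : Equiv.Perm (Fin n)) (r : Fin n) :
    tourLength d ((Equiv.addRight r).trans π) = tourLength d π := by
  obtain ⟨m, rfl⟩ : ∃ m, n = m + 1 := ⟨n - 1, by have := NeZero.pos n; omega⟩
  rw [tourLength, tourLength]
  refine Eq.trans ?_ (Equiv.sum_comp (Equiv.addRight r)
    fun i => d (π i) (π (finRotate (m + 1) i)))
  refine Finset.sum_congr rfl fun i _ => ?_
  simp only [Equiv.trans_apply, Equiv.coe_addRight, finRotate_apply]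
  rw [add_right_comm]

/-- All walks start in city `0`; cyclic invariance of the length makes this harmless. -/
theorem exists_rotate (hn : 0 < n) (π : Equiv.Perm (Fin n)) :
    ∃ π' : Equiv.Perm (Fin n), π' ⟨0, hn⟩ = ⟨0, hn⟩ ∧ tourLength d π' = tourLength d π := by
  have : NeZero n := ⟨hn.ne'⟩
  refine ⟨(Equiv.addRight (π.symm ⟨0, hn⟩)).trans π, ?_, tourLength_rotate π _⟩
  have : (⟨0, hn⟩ : Fin n) = 0 := rfl
  simp [this]

end

/-! ### Correctness of the algorithm -/

section
variable {n : ℕ} {d : Fin n → Fin n → ℝ} {k ls lN b : ℕ} {tab : ℕ → ℕ → ℕ → ℕ}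
  {dec : ℕ → ℕ → Finset ℕ}

/-- The number with given digits in base `2 ^ l`. -/
def ofDigs (l b : ℕ) (α : ℕ → ℕ) : ℕ := ∑ i ∈ Finset.range b, α i * 2 ^ (i * l)

theorem ofDigs_lt {l b : ℕ} {α : ℕ → ℕ} (h : ∀ i < b, α i < 2 ^ l) : ofDigs l b α < 2 ^ (l * b) := by
  induction b with
  | zero => simp [ofDigs]
  | succ b ih =>
    have h1 := ih fun i hi => h i (by omega)
    have h2 := Nat.mul_le_mul_right (2 ^ (b * l)) (Nat.succ_le_of_lt (h b (Nat.lt_succ_self b)))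
    rw [Nat.succ_mul] at h2
    rw [ofDigs, Finset.sum_range_succ, ← ofDigs, Nat.mul_succ, pow_add, mul_comm (2 ^ (l * b))]
    rw [mul_comm b l] at h2 ⊢
    omega

theorem dig_ofDigs {l b : ℕ} {α : ℕ → ℕ} (h : ∀ i < b, α i < 2 ^ l) {i : ℕ} (hi : i < b) :
    dig l (ofDigs l b α) i = α i := by
  induction b with
  | zero => omega
  | succ b ih =>
    have h1 : ofDigs l b α < 2 ^ (b * l) := by
      rw [mul_comm]; exact ofDigs_lt fun i hi => h i (by omega)
    rw [ofDigs, Finset.sum_range_succ, ← ofDigs]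
    rcases Nat.lt_or_ge i b with hib | hib
    · rw [← ih (fun i hi => h i (by omega)) hib, dig, dig]
      have h3 : α b * 2 ^ (b * l) = α b * 2 ^ ((b - i - 1) * l) * 2 ^ l * 2 ^ (i * l) := by
        rw [mul_assoc, mul_assoc, ← pow_add, ← pow_add]
        congr 2
        obtain ⟨c, rfl⟩ := Nat.exists_eq_add_of_lt hib
        rw [show i + c + 1 - i - 1 = c by omega]
        ring
      rw [h3, Nat.add_mul_div_right _ _ (by positivity), Nat.add_mul_mod_self_right]
    · obtain rfl : i = b := by omega
      rw [dig, Nat.add_mul_div_right _ _ (by positivity), Nat.div_eq_of_lt h1, zero_add,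
        Nat.mod_eq_of_lt (h i hi)]

theorem ofDigs_full (l b : ℕ) : ofDigs l b (fun _ => 2 ^ l - 1) + 1 = 2 ^ (l * b) := by
  induction b with
  | zero => simp [ofDigs]
  | succ b ih =>
    rw [ofDigs, Finset.sum_range_succ, ← ofDigs, add_right_comm, ih, Nat.mul_succ, pow_add,
      mul_comm b l, mul_comm (2 ^ (l * b))]
    have : 1 ≤ 2 ^ l := Nat.one_le_two_pow
    have h2 := Nat.mul_le_mul_right (2 ^ (l * b)) this
    rw [Nat.sub_mul]
    omega

theorem ofDigs_update {l b : ℕ} {α α' : ℕ → ℕ} (h : ∀ i < b, α i < 2 ^ l) {i : ℕ} (hi : i < b)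
    (hα : ∀ j < b, j ≠ i → α' j = α j) :
    ofDigs l b α' = setDig l (ofDigs l b α) i (dig l (ofDigs l b α) i) (α' i) := by
  have hmem := Finset.mem_range.2 hi
  rw [setDig, dig_ofDigs h hi, ofDigs, ofDigs, ← Finset.add_sum_erase _ _ hmem,
    ← Finset.add_sum_erase _ _ hmem]
  have : ∑ x ∈ (Finset.range b).erase i, α' x * 2 ^ (x * l) =
      ∑ x ∈ (Finset.range b).erase i, α x * 2 ^ (x * l) := by
    refine Finset.sum_congr rfl fun j hj => ?_
    rw [Finset.mem_erase, Finset.mem_range] at hj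
    rw [hα j hj.2 hj.1]
  omega

/-- The final content of the sink is the length of a tour. -/
theorem Sound.exists_tour (hT : Transitions k ls lN tab dec) (hn : 0 < n) (hnb : n ≤ b * k)
    {V : Table} (h : Sound d k ls lN b dec V) (h0 : (V 0).1 ≠ 0) :
    ∃ π : Equiv.Perm (Fin n), (V 0).2.val = tourLength d π := by
  obtain ⟨l, y, hl, hval⟩ := h.sink h0
  rw [hval]
  refine TSP.exists_tour hn hl.nodup fun e he _ => ?_
  have hk : 0 < k := Nat.pos_of_ne_zero fun hk => by subst hk; omega
  have hi : e / k < b := by rw [Nat.div_lt_iff_lt_mul hk]; omega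
  rw [← Nat.div_add_mod' e k, ← hl.mem _ hi _ (Nat.mod_lt _ hk)]
  have hfull : 2 ^ (ls * b) - 1 = ofDigs ls b (fun _ => 2 ^ ls - 1) := by
    rw [← ofDigs_full, Nat.add_sub_cancel]
  rw [hfull, dig_ofDigs (fun _ _ => Nat.sub_lt (by positivity) one_pos) hi,
    hT.dec_full _ (dig_lt lN y _), Finset.mem_range]
  exact Nat.mod_lt _ hk

/-- Every tour that starts in city `0` is a path in the state space of some phase. -/
theorem exists_path (hT : Transitions k ls lN tab dec) (hn : 0 < n) (hk : 0 < k) (hnb : n ≤ b * k)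
    (π : Equiv.Perm (Fin n)) (hπ : π ⟨0, hn⟩ = ⟨0, hn⟩) :
    ∃ y < 2 ^ (lN * b), ∃ (x v i e : ℕ → ℕ) (c : ℕ → ℝ),
      Path d k ls lN b tab y (b * k) x v i e c ∧
      c (b * k) + distAt d (v (b * k)) 0 = tourLength d π := by
  -- The tour is continued by the padding elements in their natural order, so that all `b * k`
  -- elements are visited; `pos` is the inverse of `g`.
  set g : ℕ → ℕ := fun t => if h : t < n then π ⟨t, h⟩ else t with hg
  set pos : ℕ → ℕ := fun t => if h : t < n then π.symm ⟨t, h⟩ else t with hpos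
  have hgn : ∀ i : Fin n, g i = π i := fun i => by simp [hg]
  have hgge : ∀ t, n ≤ t → g t = t := fun t ht => by simp [hg, not_lt.2 ht]
  have hglt : ∀ t, t < n → g t < n := fun t ht => by simp [hg, ht]
  have hpg : ∀ t, pos (g t) = t := by
    intro t
    by_cases ht : t < n
    · have h1 := hgn ⟨t, ht⟩
      simp only at h1
      rw [h1]
      simp [hpos]
    · rw [hgge t (not_lt.1 ht)]
      simp [hpos, ht]
  have hgp : ∀ t, g (pos t) = t := by
    intro t
    by_cases ht : t < n
    · simp [hpos, hg, ht]
    · simp [hpos, hg, ht]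
  have hgm : ∀ t < b * k, g t < b * k := by
    intro t ht
    by_cases htn : t < n
    · exact (hglt t htn).trans_le hnb
    · rwa [hgge t (not_lt.1 htn)]
  have hposm : ∀ t < b * k, pos t < b * k := by
    intro t ht
    by_contra h
    have := hgge (pos t) (by omega)
    rw [hgp] at this
    omega
  -- Each block is ordered by the visiting times of its elements. This determines a system `j i`
  -- and, for each global time `t`, a state `α i t`.
  have hcover := fun i => hT.cover (fun e => pos (i * k + e)) (by
    intro e _ e' _ h
    have h' := congrArg g h
    simp only [hgp] at h'
    omega)
  choose j hj α hαlt hα0 hαfull hαconst hαstep using hcover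
  have hdy : ∀ i < b, dig lN (ofDigs lN b j) i = j i := fun i hi => dig_ofDigs (fun i _ => hj i) hi
  have hdx : ∀ t, ∀ i < b, dig ls (ofDigs ls b fun i => α i t) i = α i t :=
    fun t i hi => dig_ofDigs (fun i _ => hαlt i t) hi
  have hil : ∀ r < b * k, g r / k < b := fun r hr => by
    rw [Nat.div_lt_iff_lt_mul hk]; exact hgm r hr
  have hel : ∀ r, g r % k < k := fun r => Nat.mod_lt _ hk
  have hpr : ∀ r, pos (g r / k * k + g r % k) = r := fun r => by rw [Nat.div_add_mod', hpg]
  have hstep : ∀ r, tab (j (g r / k)) (α (g r / k) r) (g r % k) = α (g r / k) (r + 1) ∧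
      α (g r / k) (r + 1) ≠ 0 := by
    intro r
    have := hαstep (g r / k) (g r % k) (hel r)
    rwa [hpr] at this
  have hcost : walkCost d (walkOf g (b * k)) + distAt d (lastCity n (walkOf g (b * k))) 0 =
      tourLength d π := by
    obtain ⟨t, ht⟩ := Nat.exists_eq_add_of_le hnb
    obtain ⟨h1, h2⟩ := walkOf_dummies (d := d) (g := g) (fun t ht => ht.trans (hgge t ht).ge) t
    rw [ht, h1, h2]
    refine walkOf_tour hn π hgn ?_
    have := hgn ⟨0, hn⟩
    rw [hπ] at this
    exact this
  have hfullne : ∀ (x i : ℕ), i < b → dig ls x i ≠ 2 ^ ls - 1 → x + 1 ≠ 2 ^ (ls * b) := by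
    intro x i hi hx h
    apply hx
    rw [← ofDigs_full, Nat.add_right_cancel_iff] at h
    rw [h]
    exact dig_ofDigs (fun _ _ => Nat.sub_lt (by positivity) one_pos) hi
  refine ⟨ofDigs lN b j, ofDigs_lt fun i _ => hj i, fun t => ofDigs ls b fun i => α i t,
    fun t => lastCity n (walkOf g t), fun t => g t / k, fun t => g t % k,
    fun t => walkCost d (walkOf g t), ⟨?_, rfl, rfl, ?_, ?_, ?_, ?_, ?_, ?_, ?_, ?_, ?_, ?_, ?_⟩, hcost⟩
  · exact Finset.sum_eq_zero fun i _ => by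
      simp only [hα0 i 0 fun e _ => Nat.zero_le _, zero_mul]
  · exact fun r _ => ofDigs_lt fun i _ => hαlt i r
  · exact fun r _ => lastCity_lt hn _
  · exact hil
  · exact fun r _ => hel r
  · intro r hr
    refine hfullne _ (g r / k) (hil r hr) ?_
    rw [hdx r _ (hil r hr)]
    intro h
    have h1 := hstep r
    rw [← h1.1] at h1
    -- The block of the next element cannot be in its full state, since that element is still
    -- missing.
    have h2 := (hT.sound _ (hj (g r / k)) _ (hαlt (g r / k) r) _ (hel r) h1.2).1
    rw [h, hT.dec_full _ (hj _), Finset.mem_range] at h2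
    exact h2 (hel r)
  · intro r hr h
    have h1 := hdx (r + 1) _ (hil r hr)
    rw [h, dig_zero] at h1
    exact (hstep r).2 h1.symm
  · intro r hr
    rw [hdy _ (hil r hr), hdx r _ (hil r hr), (hstep r).1]
    exact (hstep r).2
  · intro r hr
    rw [hdy _ (hil r hr)]
    conv_rhs => rw [hdx r _ (hil r hr), (hstep r).1, ← hdx r _ (hil r hr)]
    -- At time `r` only the block containing `g r` changes its state.
    refine ofDigs_update (fun i _ => hαlt i r) (hil r hr) fun i hi hne => ?_
    refine hαconst i r fun e he h => hne ?_
    have h1 := hgp (i * k + e)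
    rw [h] at h1
    rw [h1, mul_add_div_of_lt he]
  · intro r hr h
    simp only [Nat.div_add_mod'] at h ⊢
    rw [walkOf, lastCity, walkCost, if_pos h, if_pos h]
    exact ⟨rfl, rfl⟩
  · intro r hr h
    simp only [Nat.div_add_mod'] at h ⊢
    rw [walkOf, lastCity, walkCost, if_neg h, if_neg h]
    exact ⟨rfl, rfl⟩
  · rw [← ofDigs_full]
    congr 1
    refine Finset.sum_congr rfl fun i hi => ?_
    simp only [hαfull i _ fun e he => hposm _ (mul_add_lt_mul (Finset.mem_range.1 hi) he)]

/-- The invariant of the main loop. -/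
structure LoopInv (d : Fin n → Fin n → ℝ) (k ls lN b : ℕ) (tab : ℕ → ℕ → ℕ → ℕ)
    (dec : ℕ → ℕ → Finset ℕ) (q : ℕ) (V : Table) : Prop where
  sound : Sound d k ls lN b dec V
  complete : ∀ y < 2 ^ (lN * b), ∀ (x v i e : ℕ → ℕ) (c : ℕ → ℝ),
    Path d k ls lN b tab y (b * k) x v i e c →
    (y * (b * (k + 2)) * roundSize n k ls b ≤ q → ∀ r ≤ b * k,
      q ≤ deadline n k ls b y x v i e r → V.Done (1 + (x r * n + v r)) (y + 1) (c r)) ∧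
      (q ≤ sinkDeadline n k ls b y (b * k) x v → V.Done 0 1 (c (b * k) + distAt d (v (b * k)) 0))

/-- All deadlines lie below the initial counter, so completeness is vacuous at the start. -/
theorem LoopInv.init (hn : 0 < n) (hk : 0 < k) (hb : 0 < b) :
    LoopInv d k ls lN b tab dec (steps n k ls lN b) fun _ => (0, ⟨0, 0⟩) where
  sound := sound_init
  complete y hy x v i e c hP := by
    have hm : b * k + 2 ≤ b * (k + 2) := by rw [mul_add]; omega
    refine ⟨fun _ r hr h => absurd h (not_le_of_gt (hP.deadline_lt hn hk hb hm hy hr)),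
      fun h => absurd h (not_le_of_gt (hP.sinkDeadline_lt hk hb hm hy))⟩

theorem LoopInv.step (hT : Transitions k ls lN tab dec) (hn : 0 < n) (hk : 0 < k) (hb : 0 < b)
    {q : ℕ} {V : Table} (h : LoopInv d k ls lN b tab dec (q + 1) V) :
    LoopInv d k ls lN b tab dec q (relaxStep d k ls lN b tab q V) where
  sound := h.sound.relaxStep hT hn hk hb q
  complete y hy x v i e c hP :=
    hP.done hn hk hb (by rw [mul_add]; omega) (h.complete y hy x v i e c hP)

/-- At counter `0` every deadline has passed, so the sink is at most the length of every tour; by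
soundness it is itself the length of one. -/
theorem LoopInv.isOptimum (hT : Transitions k ls lN tab dec) (hn : 0 < n) (hk : 0 < k)
    (hnb : n ≤ b * k) {V : Table} (h : LoopInv d k ls lN b tab dec 0 V) :
    IsOptimum d (V 0).2.val := by
  have key : ∀ π : Equiv.Perm (Fin n), (V 0).1 = 1 ∧ (V 0).2.val ≤ tourLength d π := by
    intro π
    obtain ⟨π', h0, hπ⟩ := exists_rotate (d := d) hn π
    obtain ⟨y, hy, x, v, i, e, c, hP, hc⟩ := exists_path (d := d) hT hn hk hnb π' h0
    have := (h.complete y hy x v i e c hP).2 (Nat.zero_le _)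
    rwa [hc, hπ] at this
  constructor
  · obtain ⟨π, hπ⟩ := h.sound.exists_tour hT hn hnb (by rw [(key 1).1]; exact one_ne_zero)
    exact ⟨π, hπ.symm⟩
  · rintro _ ⟨π, rfl⟩
    exact (key π).2

end

/-! ### Asymptotics -/

/-- A polynomial factor moves into the exponent as $\log_T(C(n+1)^p)=O(\log n)$. -/
theorem exists_isLittleO_exponent {T : ℝ} (hT : 1 < T) {C : ℝ} (hC : 0 < C) (p : ℕ) :
    ∃ ε : ℕ → ℝ, ε =o[atTop] (fun n : ℕ => (n : ℝ)) ∧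
      ∀ n : ℕ, T ^ ((n : ℝ) + ε n) = C * ((n : ℝ) + 1) ^ p * T ^ (n : ℝ) := by
  have hT0 : 0 < T := by linarith
  refine ⟨fun n => Real.logb T (C * ((n : ℝ) + 1) ^ p), ?_, fun n => ?_⟩
  · have h1 : (fun n : ℕ => Real.logb T (C * ((n : ℝ) + 1) ^ p)) =
        fun n : ℕ => Real.log C / Real.log T + p / Real.log T * Real.log ((n : ℝ) + 1) := by
      funext n
      have : (0 : ℝ) < (n : ℝ) + 1 := by positivity
      rw [Real.logb, Real.log_mul hC.ne' (by positivity), Real.log_pow]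
      ring
    rw [h1]
    have h2 : Tendsto (fun n : ℕ => (n : ℝ) + 1) atTop atTop :=
      tendsto_atTop_add_const_right _ _ tendsto_natCast_atTop_atTop
    have h3 : (fun n : ℕ => (n : ℝ) + 1) =O[atTop] (fun n : ℕ => (n : ℝ)) := by
      refine Asymptotics.IsBigO.of_bound 2 ?_
      filter_upwards [eventually_ge_atTop 1] with n hn
      have : (1 : ℝ) ≤ n := by exact_mod_cast hn
      rw [Real.norm_of_nonneg (by positivity), Real.norm_of_nonneg (by positivity)]
      linarith
    refine Asymptotics.IsLittleO.add ?_ (Asymptotics.IsLittleO.const_mul_left ?_ _)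
    · exact Asymptotics.isLittleO_const_left.2
        (.inr (tendsto_norm_atTop_atTop.comp tendsto_natCast_atTop_atTop))
    · exact (Real.isLittleO_log_id_atTop.comp_tendsto h2).trans_isBigO h3
  · have : (0 : ℝ) < (n : ℝ) + 1 := by positivity
    rw [Real.rpow_add hT0, Real.rpow_logb hT0 hT.ne' (by positivity), mul_comm]

section
variable {k ls lN : ℕ} {tab : ℕ → ℕ → ℕ → ℕ} {dec : ℕ → ℕ → Finset ℕ}

theorem steps_le {n b : ℕ} (hb : b ≤ n + 1) :
    steps n k ls lN b ≤ 2 ^ ((lN + ls) * b) * ((n + 1) ^ 3 * ((k + 2) * k)) := by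
  rw [steps, add_mul, pow_add]
  calc 2 ^ (lN * b) * (b * (k + 2)) * 2 ^ (ls * b) * n * b * k
      = 2 ^ (lN * b) * 2 ^ (ls * b) * (b * n * b * ((k + 2) * k)) := by ring
    _ ≤ 2 ^ (lN * b) * 2 ^ (ls * b) * ((n + 1) * (n + 1) * (n + 1) * ((k + 2) * k)) := by
        gcongr; omega
    _ = _ := by ring

/-- The program solves every instance, provided that there is a transition table. -/
theorem mainProg_solves (hT : Transitions k ls lN tab dec) (hk : 0 < k) {n : ℕ} (hn : 1 ≤ n)
    (d : Fin n → Fin n → ℝ) :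
    ∃ t, SolvesWith (mainProg k ls lN (fun x => tab (x / k / 2 ^ ls) (x / k % 2 ^ ls) (x % k))
        (2 ^ lN * 2 ^ ls * k)) d ((lN + ls + 2 * k + 10) * (n + 1)) t
        (3 + 2 ^ (ls * (n / k + 1)) * n) ∧
      t ≤ ((bodyProg (fun x => tab (x / k / 2 ^ ls) (x / k % 2 ^ ls) (x % k))
        (2 ^ lN * 2 ^ ls * k)).size + 1) * steps n k ls lN (n / k + 1) + 23 := by
  set f : ℕ → ℕ := fun x => tab (x / k / 2 ^ ls) (x / k % 2 ^ ls) (x % k) with hf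
  obtain ⟨b, hb⟩ : ∃ b, b = n / k + 1 := ⟨_, rfl⟩
  obtain ⟨u, hu⟩ : ∃ u, u = n + 1 := ⟨_, rfl⟩
  -- A generous linear word length: every quantity below is bounded by $2^{cu}$ with `c` at most
  -- this coefficient.
  obtain ⟨w, hw⟩ : ∃ w, w = (lN + ls + 2 * k + 10) * u := ⟨_, rfl⟩
  have hbu : b ≤ u := by
    have := Nat.div_le_self n k
    omega
  have hu1 : 1 ≤ u := by omega
  have hpow : ∀ a c, a ≤ c → (2 : ℕ) ^ a ≤ 2 ^ c := fun a c h => Nat.pow_le_pow_right (by norm_num) h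
  have hb2 : b < 2 ^ u := hbu.trans_lt Nat.lt_two_pow_self
  have hn2 : n < 2 ^ u := by have := @Nat.lt_two_pow_self u; omega
  have hc : ∀ c, c < 2 ^ (c * u) := fun c =>
    (Nat.lt_two_pow_self).trans_le (hpow _ _ (Nat.le_mul_of_pos_right _ hu1))
  have hle : ∀ {a c : ℕ}, c ≤ lN + ls + 2 * k + 10 → a ≤ 2 ^ (c * u) → a ≤ 2 ^ w :=
    fun hc ha => ha.trans (hpow _ _ (hw ▸ Nat.mul_le_mul_right _ hc))
  have hlt : ∀ {a c : ℕ}, c ≤ lN + ls + 2 * k + 10 → a < 2 ^ (c * u) → a < 2 ^ w :=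
    fun hc ha => ha.trans_le (hpow _ _ (hw ▸ Nat.mul_le_mul_right _ hc))
  have hlsb : 2 ^ (ls * b) ≤ 2 ^ (ls * u) := hpow _ _ (Nat.mul_le_mul_left _ hbu)
  have hlNb : 2 ^ (lN * b) ≤ 2 ^ (lN * u) := hpow _ _ (Nat.mul_le_mul_left _ hbu)
  have h1u : 4 ≤ 2 ^ u := hpow 2 u (by omega)
  have hsteps : steps n k ls lN b < 2 ^ w := by
    have : steps n k ls lN b ≤ 2 ^ ((lN + ls + 2 * k + 5) * u) := by
      rw [steps]
      calc 2 ^ (lN * b) * (b * (k + 2)) * 2 ^ (ls * b) * n * b * k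
          ≤ 2 ^ (lN * u) * (2 ^ u * 2 ^ ((k + 2) * u)) * 2 ^ (ls * u) * 2 ^ u * 2 ^ u *
              2 ^ (k * u) := by
            have := hc (k + 2)
            have := hc k
            gcongr
        _ = _ := by
            rw [← pow_add, ← pow_add, ← pow_add, ← pow_add, ← pow_add, ← pow_add]
            congr 1
            ring
    refine this.trans_lt ?_
    rw [hw]
    refine Nat.pow_lt_pow_right (by norm_num) ?_
    exact Nat.mul_lt_mul_of_pos_right (by omega) hu1
  have hs : 3 + 2 ^ (ls * b) * n ≤ 2 ^ w := by
    refine hle (c := ls + 3) (by omega) ?_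
    have h1 : 2 ^ (ls * b) * n ≤ 2 ^ (ls * u) * 2 ^ u := Nat.mul_le_mul hlsb hn2.le
    have h2 : 2 ^ ((ls + 3) * u) = 2 ^ (ls * u) * 2 ^ u * 2 ^ u * 2 ^ u := by
      rw [← pow_add, ← pow_add, ← pow_add]; congr 1; ring
    have h3 : 1 ≤ 2 ^ (ls * u) := Nat.one_le_two_pow
    have h4 : 1 * 4 ≤ 2 ^ (ls * u) * 2 ^ u := Nat.mul_le_mul h3 h1u
    have h5 := Nat.mul_le_mul (Nat.mul_le_mul_left (2 ^ (ls * u) * 2 ^ u) h1u) h1u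
    rw [h2]
    linarith
  have hT' : ∀ x < 2 ^ lN * 2 ^ ls * k, f x < 2 ^ ls := by
    intro x hx
    refine hT.tab_lt _ ?_ _ (Nat.mod_lt _ (by positivity)) _ (Nat.mod_lt _ hk)
    rw [Nat.div_lt_iff_lt_mul (by positivity), Nat.div_lt_iff_lt_mul hk]
    exact hx
  obtain ⟨t, τ, ht, he, V, hV, hτ⟩ := mainProg_exec (d := d) (w := w) (s := 3 + 2 ^ (ls * b) * n)
    (k := k) (ls := ls) (lN := lN) (b := b) (M := 2 ^ lN * 2 ^ ls * k) (tab := tab) (f := f)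
    (LoopInv d k ls lN b tab dec) hn hk hb
    (hlt (c := 3) (by omega) (lt_of_lt_of_le (by norm_num) (hpow 3 (3 * u) (by omega))))
    (hlt (by omega) (hc (k + 2))) hsteps le_rfl hs
    (by
      refine hlt (c := k + 2) (by omega) ?_
      have h1 : b * k ≤ 2 ^ u * 2 ^ (k * u) := Nat.mul_le_mul hb2.le (hc k).le
      have h2 : 2 ^ ((k + 2) * u) = 2 ^ u * 2 ^ (k * u) * 2 ^ u := by
        rw [← pow_add, ← pow_add]; congr 1; ring
      have h3 : 4 * 1 ≤ 2 ^ u * 2 ^ (k * u) := Nat.mul_le_mul h1u Nat.one_le_two_pow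
      have h4 := Nat.mul_le_mul_left (2 ^ u * 2 ^ (k * u)) h1u
      rw [h2]
      linarith)
    (by
      refine hlt (c := ls + 1) (by omega) ?_
      rw [add_mul, one_mul, pow_add, mul_comm b]
      exact Nat.mul_lt_mul'' (hc ls) hb2)
    (by
      refine hlt (c := lN + 1) (by omega) ?_
      rw [add_mul, one_mul, pow_add, mul_comm b]
      exact Nat.mul_lt_mul'' (hc lN) hb2)
    (by
      refine hlt (c := ls + 2) (by omega) ?_
      have h2 : 2 ^ ((ls + 2) * u) = 2 ^ (ls * u) * 2 ^ u * 2 ^ u := by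
        rw [← pow_add, ← pow_add]; congr 1; ring
      have h3 : 1 ≤ 2 ^ (ls * u) := Nat.one_le_two_pow
      have h4 := Nat.mul_le_mul (Nat.mul_le_mul_left (2 ^ (ls * u)) h1u) h1u
      rw [h2]
      linarith)
    rfl
    (by
      refine hlt (c := lN + ls + k) (by omega) ?_
      rw [add_mul, add_mul, pow_add, pow_add]
      refine Nat.mul_lt_mul_of_le_of_lt ?_ (hc k) (by positivity)
      exact Nat.mul_le_mul (hpow _ _ (Nat.le_mul_of_pos_right _ hu1))
        (hpow _ _ (Nat.le_mul_of_pos_right _ hu1)))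
    (by
      intro j a e _ ha he
      simp only [hf]
      rw [mul_add_div_of_lt he, mul_add_div_of_lt ha, Nat.mul_add_mod', Nat.mul_add_mod',
        Nat.mod_eq_of_lt he, Nat.mod_eq_of_lt ha])
    hT' (LoopInv.init hn hk (hb ▸ Nat.succ_pos _))
    (fun q _ V h => h.step hT hn hk (hb ▸ Nat.succ_pos _)) (fun q V h => h.sound.terms)
  refine ⟨t, ⟨τ, ?_, ?_⟩, hb ▸ ht⟩
  · rw [← hu, ← hw, ← hb]
    exact he
  · rw [hτ]
    refine hV.isOptimum hT hn hk ?_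
    rw [hb, add_mul, one_mul]
    have h1 := Nat.div_add_mod' n k
    have h2 := Nat.mod_lt n hk
    omega

/-- As `k` is fixed, rounding up to whole blocks costs only the constant factors $2^{lN+ls}$ in time
and $2^{ls}$ in space, and the size of the loop body is a constant too. -/
theorem feasible_of_transitions (hT : Transitions k ls lN tab dec) (hk : 0 < k)
    (hls : 2 * ls = k) : Feasible (Real.sqrt 2) ((2 : ℝ) ^ (((lN + ls : ℕ) : ℝ) / k)) := by
  have hk' : (0 : ℝ) < k := by exact_mod_cast hk
  have hexp : 0 < ((lN + ls : ℕ) : ℝ) / k := by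
    have : 0 < lN + ls := by omega
    positivity
  have hT1 : 1 < (2 : ℝ) ^ (((lN + ls : ℕ) : ℝ) / k) := Real.one_lt_rpow (by norm_num) hexp
  have hS1 : 1 < Real.sqrt 2 := Real.lt_sqrt_of_sq_lt (by norm_num)
  set f : ℕ → ℕ := fun x => tab (x / k / 2 ^ ls) (x / k % 2 ^ ls) (x % k) with hf
  set z := (bodyProg f (2 ^ lN * 2 ^ ls * k)).size with hz
  obtain ⟨ε, hε, hε'⟩ := exists_isLittleO_exponent hT1
    (C := (2 : ℝ) ^ (lN + ls) * ((z + 1) * ((k + 2) * k) + 23)) (by positivity) 3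
  obtain ⟨δ, hδ, hδ'⟩ := exists_isLittleO_exponent hS1 (C := (2 : ℝ) ^ ls * 8) (by positivity) 1
  have hdiv : ∀ n : ℕ, ((n / k + 1 : ℕ) : ℝ) ≤ n / k + 1 := by
    intro n
    push_cast
    gcongr
    exact Nat.cast_div_le
  have hpow : ∀ m n : ℕ, (2 : ℝ) ^ (m * (n / k + 1)) ≤ 2 ^ m * ((2 : ℝ) ^ ((m : ℝ) / k)) ^ (n : ℝ) := by
    intro m n
    rw [← Real.rpow_natCast, ← Real.rpow_natCast, ← Real.rpow_mul (by norm_num),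
      ← Real.rpow_add (by norm_num)]
    refine Real.rpow_le_rpow_of_exponent_le (by norm_num) ?_
    push_cast
    have h1 := hdiv n
    push_cast at h1
    calc (m : ℝ) * ((n / k : ℕ) + 1) ≤ m * (n / k + 1) := by gcongr
      _ = m + m / k * n := by ring
  have hsqrt : (2 : ℝ) ^ ((ls : ℝ) / k) = Real.sqrt 2 := by
    rw [Real.sqrt_eq_rpow]
    congr 1
    rw [← hls]
    have : (ls : ℝ) ≠ 0 := by
      have : ls ≠ 0 := by omega
      exact_mod_cast this
    push_cast
    field_simp
  refine ⟨hS1.le, hT1.le, mainProg k ls lN f (2 ^ lN * 2 ^ ls * k), lN + ls + 2 * k + 10, δ, ε,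
    by omega, hδ, hε, fun n hn d => ?_⟩
  obtain ⟨t, hsol, ht⟩ := mainProg_solves hT hk hn d
  replace ht : t ≤ (z + 1) * steps n k ls lN (n / k + 1) + 23 := ht
  refine ⟨t, _, hsol, ?_, ?_⟩
  · rw [hε']
    have hb : n / k + 1 ≤ n + 1 := Nat.succ_le_succ (Nat.div_le_self _ _)
    have h1 : t ≤ 2 ^ ((lN + ls) * (n / k + 1)) * (n + 1) ^ 3 * ((z + 1) * ((k + 2) * k) + 23) := by
      have h2 := Nat.mul_le_mul_left (z + 1) (steps_le (k := k) (ls := ls) (lN := lN) hb)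
      have h3 : 1 ≤ 2 ^ ((lN + ls) * (n / k + 1)) * (n + 1) ^ 3 := Nat.one_le_iff_ne_zero.2 (by positivity)
      calc t ≤ (z + 1) * (2 ^ ((lN + ls) * (n / k + 1)) * ((n + 1) ^ 3 * ((k + 2) * k))) + 23 * 1 := by
            omega
        _ ≤ (z + 1) * (2 ^ ((lN + ls) * (n / k + 1)) * ((n + 1) ^ 3 * ((k + 2) * k))) +
            23 * (2 ^ ((lN + ls) * (n / k + 1)) * (n + 1) ^ 3) := by gcongr
        _ = _ := by ring
    calc (t : ℝ) ≤ (2 : ℝ) ^ ((lN + ls) * (n / k + 1)) * (n + 1) ^ 3 *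
          ((z + 1) * ((k + 2) * k) + 23) := by exact_mod_cast h1
      _ ≤ 2 ^ (lN + ls) * ((2 : ℝ) ^ (((lN + ls : ℕ) : ℝ) / k)) ^ (n : ℝ) * (n + 1) ^ 3 *
          ((z + 1) * ((k + 2) * k) + 23) := by
          gcongr
          exact hpow _ _
      _ = _ := by ring
  · rw [hδ', pow_one]
    have h1 : 2 * (3 + 2 ^ (ls * (n / k + 1)) * n) ≤ 8 * (2 ^ (ls * (n / k + 1)) * (n + 1)) := by
      have h3 : 1 ≤ 2 ^ (ls * (n / k + 1)) := Nat.one_le_two_pow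
      nlinarith
    calc ((2 * (3 + 2 ^ (ls * (n / k + 1)) * n) : ℕ) : ℝ)
        ≤ 8 * ((2 : ℝ) ^ (ls * (n / k + 1)) * (n + 1)) := by exact_mod_cast h1
      _ ≤ 8 * (2 ^ ls * ((2 : ℝ) ^ ((ls : ℝ) / k)) ^ (n : ℝ) * (n + 1)) := by
          gcongr
          exact hpow _ _
      _ = _ := by rw [hsqrt]; ring

end

/-! ### Transition tables from families of set systems -/

section
variable {k ls lN : ℕ}

open Classical in
/-- A number for every set in the system `F`. -/
noncomputable def encodeSet (k s : ℕ) (F : Finset (Finset ℕ)) (A : Finset ℕ) : ℕ :=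
  if A = ∅ then 0 else if A = Finset.range k then s - 1
  else if h : A ∈ F then 1 + (F.equivFin ⟨A, h⟩).val else 0

/-- The system `F`, together with the empty and the full set. -/
def withTrivial (k : ℕ) (F : Finset (Finset ℕ)) : Finset (Finset ℕ) :=
  insert ∅ (insert (Finset.range k) F)

theorem encodeSet_empty (s : ℕ) (F : Finset (Finset ℕ)) : encodeSet k s F ∅ = 0 := if_pos rfl

theorem range_ne_empty (hk : 0 < k) : Finset.range k ≠ ∅ := by
  rw [Ne, Finset.range_eq_empty_iff]; exact hk.ne'

theorem encodeSet_full (hk : 0 < k) (s : ℕ) (F : Finset (Finset ℕ)) :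
    encodeSet k s F (Finset.range k) = s - 1 := by
  rw [encodeSet, if_neg (range_ne_empty hk), if_pos rfl]

theorem encodeSet_of_mem {s : ℕ} {F : Finset (Finset ℕ)} {A : Finset ℕ} (h0 : A ≠ ∅)
    (h1 : A ≠ Finset.range k) (h : A ∈ F) :
    encodeSet k s F A = 1 + (F.equivFin ⟨A, h⟩).val := by
  rw [encodeSet, if_neg h0, if_neg h1, dif_pos h]

theorem encodeSet_lt {s : ℕ} {F : Finset (Finset ℕ)} (hs : 2 ≤ s) (hF : F.card ≤ s - 2)
    (A : Finset ℕ) : encodeSet k s F A < s := by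
  rw [encodeSet]
  split_ifs with h0 h1 h2
  · omega
  · omega
  · have := (F.equivFin ⟨A, h2⟩).2; omega
  · omega

theorem encodeSet_ne_zero {s : ℕ} {F : Finset (Finset ℕ)} (hs : 2 ≤ s) {A : Finset ℕ}
    (hA : A ∈ withTrivial k F) (h0 : A ≠ ∅) : encodeSet k s F A ≠ 0 := by
  rw [encodeSet, if_neg h0]
  split_ifs with h1 h2
  · omega
  · omega
  · simp only [withTrivial, Finset.mem_insert] at hA
    tauto

/-- The numbers `0` and `s - 1` are reserved for the empty and the full set, which leaves `s - 2`
for the rest of `F`. The value `0` can also mean "no transition", because no transition leads to the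
empty set. -/
theorem encodeSet_injOn {s : ℕ} {F : Finset (Finset ℕ)} (hs : 2 ≤ s) (hF : F.card ≤ s - 2)
    (hk : 0 < k) : Set.InjOn (encodeSet k s F) (withTrivial k F) := by
  have key : ∀ A ∈ withTrivial k F, ∀ B ∈ withTrivial k F, encodeSet k s F A = encodeSet k s F B →
      A = ∅ → A = B := by
    rintro A hA B hB h rfl
    by_contra hne
    rw [encodeSet_empty] at h
    exact encodeSet_ne_zero hs hB (Ne.symm hne) h.symm
  have key2 : ∀ A ∈ withTrivial k F, ∀ B ∈ withTrivial k F, encodeSet k s F A = encodeSet k s F B →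
      A = Finset.range k → B ≠ ∅ → A = B := by
    rintro A hA B hB h rfl hB0
    by_contra hne
    have hB' : B ∈ F := by
      simp only [withTrivial, Finset.mem_insert] at hB
      rcases hB with hB | hB | hB
      · exact absurd hB hB0
      · exact absurd hB.symm hne
      · exact hB
    rw [encodeSet_full hk, encodeSet_of_mem hB0 (Ne.symm hne) hB'] at h
    have := (F.equivFin ⟨B, hB'⟩).2
    omega
  intro A hA B hB h
  by_cases hA0 : A = ∅
  · exact key A hA B hB h hA0
  by_cases hB0 : B = ∅
  · exact (key B hB A hA h.symm hB0).symm
  by_cases hA1 : A = Finset.range k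
  · exact key2 A hA B hB h hA1 hB0
  by_cases hB1 : B = Finset.range k
  · exact (key2 B hB A hA h.symm hB1 hA0).symm
  have hA' : A ∈ F := by
    have := Finset.mem_coe.1 hA
    simp only [withTrivial, Finset.mem_insert] at this
    tauto
  have hB' : B ∈ F := by
    have := Finset.mem_coe.1 hB
    simp only [withTrivial, Finset.mem_insert] at this
    tauto
  rw [encodeSet_of_mem hA0 hA1 hA', encodeSet_of_mem hB0 hB1 hB', Nat.add_left_cancel_iff,
    Fin.val_inj, EmbeddingLike.apply_eq_iff_eq, Subtype.mk.injEq] at h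
  exact h

open Classical in
/-- The set with a given number. -/
noncomputable def decodeSet (k s : ℕ) (F : Finset (Finset ℕ)) (a : ℕ) : Finset ℕ :=
  if h : ∃ A ∈ withTrivial k F, encodeSet k s F A = a then h.choose else ∅

theorem decodeSet_encodeSet {s : ℕ} {F : Finset (Finset ℕ)} (hs : 2 ≤ s) (hF : F.card ≤ s - 2)
    (hk : 0 < k) {A : Finset ℕ} (hA : A ∈ withTrivial k F) :
    decodeSet k s F (encodeSet k s F A) = A := by
  have h : ∃ B ∈ withTrivial k F, encodeSet k s F B = encodeSet k s F A := ⟨A, hA, rfl⟩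
  rw [decodeSet, dif_pos h]
  exact encodeSet_injOn hs hF hk h.choose_spec.1 hA h.choose_spec.2

open Classical in
/-- The transition table of a set system. -/
noncomputable def transition (k s : ℕ) (F : Finset (Finset ℕ)) (a e : ℕ) : ℕ :=
  if e ∉ decodeSet k s F a ∧ insert e (decodeSet k s F a) ∈ withTrivial k F then
    encodeSet k s F (insert e (decodeSet k s F a)) else 0

/-- The state at time `t` is the number of the initial segment of elements placed before `t`.
Injectivity of the positions ensures that these segments grow by one element at a time. -/
theorem transitions_of_family (hk : 0 < k) (hls : 1 ≤ ls) (F : ℕ → Finset (Finset ℕ))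
    (hF : ∀ j, (F j).card ≤ 2 ^ ls - 2)
    (hcover : ∀ f : ℕ → ℕ, Set.InjOn f (Set.Iio k) → ∃ j < 2 ^ lN,
      ∀ t, (Finset.range k).filter (fun e => f e < t) ∈ F j) :
    Transitions k ls lN (fun j => transition k (2 ^ ls) (F j))
      (fun j => decodeSet k (2 ^ ls) (F j)) where
  dec_zero j _ := by
    have hs : 2 ≤ 2 ^ ls := by simpa using Nat.pow_le_pow_right (n := 2) (by norm_num) hls
    conv_lhs => rw [← encodeSet_empty (k := k) (2 ^ ls) (F j)]
    exact decodeSet_encodeSet hs (hF j) hk (by simp [withTrivial])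
  dec_full j _ := by
    have hs : 2 ≤ 2 ^ ls := by simpa using Nat.pow_le_pow_right (n := 2) (by norm_num) hls
    conv_lhs => rw [← encodeSet_full hk (2 ^ ls) (F j)]
    exact decodeSet_encodeSet hs (hF j) hk (by simp [withTrivial])
  tab_lt j _ a _ e _ := by
    have hs : 2 ≤ 2 ^ ls := by simpa using Nat.pow_le_pow_right (n := 2) (by norm_num) hls
    simp only [transition]
    split_ifs
    · exact encodeSet_lt hs (hF j) _
    · omega
  sound j _ a _ e _ h := by
    have hs : 2 ≤ 2 ^ ls := by simpa using Nat.pow_le_pow_right (n := 2) (by norm_num) hls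
    simp only [transition] at h ⊢
    split_ifs at h ⊢ with h'
    · exact ⟨h'.1, decodeSet_encodeSet hs (hF j) hk h'.2⟩
    · exact absurd rfl h
  cover f hf := by
    have hs : 2 ≤ 2 ^ ls := by simpa using Nat.pow_le_pow_right (n := 2) (by norm_num) hls
    obtain ⟨j, hj, hjt⟩ := hcover f hf
    have hmem : ∀ t, (Finset.range k).filter (fun e => f e < t) ∈ withTrivial k (F j) := fun t => by
      simp [withTrivial, hjt t]
    refine ⟨j, hj, fun t => encodeSet k (2 ^ ls) (F j) ((Finset.range k).filter (fun e => f e < t)),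
      fun t => encodeSet_lt hs (hF j) _, ?_, ?_, ?_, ?_⟩
    · intro t ht
      have : (Finset.range k).filter (fun e => f e < t) = ∅ := by
        rw [Finset.filter_eq_empty_iff]
        intro e he
        have := ht e (Finset.mem_range.1 he)
        omega
      simp only [this, encodeSet_empty]
    · intro t ht
      have : (Finset.range k).filter (fun e => f e < t) = Finset.range k := by
        rw [Finset.filter_eq_self]
        exact fun e he => ht e (Finset.mem_range.1 he)
      simp only [this, encodeSet_full hk]
    · intro t ht
      have : (Finset.range k).filter (fun e => f e < t + 1) =
          (Finset.range k).filter (fun e => f e < t) := by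
        refine Finset.filter_congr fun e he => ?_
        have := ht e (Finset.mem_range.1 he)
        omega
      simp only [this]
    · intro e he
      have hins : insert e ((Finset.range k).filter (fun e' => f e' < f e)) =
          (Finset.range k).filter (fun e' => f e' < f e + 1) := by
        ext e'
        simp only [Finset.mem_insert, Finset.mem_filter, Finset.mem_range]
        constructor
        · rintro (rfl | h)
          · exact ⟨he, Nat.lt_succ_self _⟩
          · exact ⟨h.1, h.2.trans (Nat.lt_succ_self _)⟩
        · rintro ⟨h1, h2⟩
          rcases Nat.lt_or_ge (f e') (f e) with h | h
          · exact .inr ⟨h1, h⟩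
          · exact .inl (hf h1 he (by omega))
      have hnot : e ∉ (Finset.range k).filter (fun e' => f e' < f e) := by simp
      simp only [transition, decodeSet_encodeSet hs (hF j) hk (hmem (f e)), hins, hnot,
        hmem (f e + 1), not_false_eq_true, and_self, if_true, true_and]
      refine encodeSet_ne_zero hs (hmem _) ?_
      rw [← hins]
      exact Finset.insert_ne_empty _ _

end

/-! ### Covering by random choice -/

/-- If every element of `O` is hit by at least `G` elements of `J`, then some `N` elements of `J` hit
all of `O`. -/
theorem exists_hitting {O J : Type*} [Fintype O] [Fintype J] [Nonempty J] (R : O → J → Prop)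
    {G N K : ℕ} (hG : ∀ o, ∃ S : Finset J, G ≤ S.card ∧ ∀ j ∈ S, R o j)
    (hN : Fintype.card J * K ≤ N * G) (hO : Fintype.card O < 2 ^ K) :
    ∃ h : Fin N → J, ∀ o, ∃ i, R o (h i) := by
  classical
  by_contra! hcon
  choose S hS hSR using hG
  have hJ : 0 < Fintype.card J := Fintype.card_pos
  -- If every choice failed, each `N`-tuple would avoid `S o` for some `o`; this is the union bound
  -- in counting form.
  have h1 : Fintype.card J ^ N ≤ ∑ o : O, (Fintype.card J - (S o).card) ^ N := by
    have : (Finset.univ : Finset (Fin N → J)) ⊆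
        Finset.univ.biUnion fun o => Fintype.piFinset fun _ => (S o)ᶜ := by
      intro h _
      obtain ⟨o, ho⟩ := hcon h
      rw [Finset.mem_biUnion]
      refine ⟨o, Finset.mem_univ o, Fintype.mem_piFinset.2 fun i => ?_⟩
      rw [Finset.mem_compl]
      exact fun hi => ho i (hSR o _ hi)
    have h2 := (Finset.card_le_card this).trans Finset.card_biUnion_le
    simpa [Fintype.card_piFinset, Finset.card_compl] using h2
  -- From $1-x\le e^{-x}$ with $x=G/|J|$ and $NG/|J|\ge K$. The contradiction then comes from
  -- $|O|<2^K\le e^K$.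
  have h2 : ∀ o, ((Fintype.card J - (S o).card : ℕ) : ℝ) ^ N ≤
      (Fintype.card J : ℝ) ^ N * Real.exp (-K) := by
    intro o
    have hle : (S o).card ≤ Fintype.card J := Finset.card_le_univ _
    have hJ' : (0 : ℝ) < Fintype.card J := by exact_mod_cast hJ
    have h3 : ((Fintype.card J - (S o).card : ℕ) : ℝ) ≤
        Fintype.card J * Real.exp (-((G : ℝ) / Fintype.card J)) := by
      have h4 := Real.add_one_le_exp (-((G : ℝ) / Fintype.card J))
      have h5 : (G : ℝ) ≤ (S o).card := by exact_mod_cast hS o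
      rw [Nat.cast_sub hle]
      calc (Fintype.card J : ℝ) - (S o).card ≤ Fintype.card J - G := by linarith
        _ = Fintype.card J * (-((G : ℝ) / Fintype.card J) + 1) := by field_simp; ring
        _ ≤ _ := by gcongr
    calc ((Fintype.card J - (S o).card : ℕ) : ℝ) ^ N
        ≤ (Fintype.card J * Real.exp (-((G : ℝ) / Fintype.card J))) ^ N := by gcongr
      _ = (Fintype.card J : ℝ) ^ N * Real.exp (-(N * G / Fintype.card J)) := by
          rw [mul_pow, ← Real.exp_nat_mul]; congr 2; ring
      _ ≤ _ := by
          gcongr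
          rw [le_div_iff₀ hJ']
          have : ((Fintype.card J * K : ℕ) : ℝ) ≤ ((N * G : ℕ) : ℝ) := by exact_mod_cast hN
          push_cast at this
          linarith
  have h3 : (Fintype.card J : ℝ) ^ N ≤
      Fintype.card O * ((Fintype.card J : ℝ) ^ N * Real.exp (-K)) := by
    calc (Fintype.card J : ℝ) ^ N ≤ ∑ o : O, ((Fintype.card J - (S o).card : ℕ) : ℝ) ^ N := by
          exact_mod_cast h1
      _ ≤ ∑ _o : O, (Fintype.card J : ℝ) ^ N * Real.exp (-K) := Finset.sum_le_sum fun o _ => h2 o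
      _ = _ := by simp
  have h4 : (Fintype.card O : ℝ) * Real.exp (-K) < 1 := by
    rw [Real.exp_neg, ← div_eq_mul_inv, div_lt_one (Real.exp_pos _)]
    calc (Fintype.card O : ℝ) < 2 ^ K := by exact_mod_cast hO
      _ ≤ (Real.exp 1) ^ K := by
          gcongr
          have := Real.add_one_le_exp 1
          linarith
      _ = Real.exp K := by rw [← Real.exp_nat_mul, mul_one]
  have h5 : (0 : ℝ) < (Fintype.card J : ℝ) ^ N := by
    have : (0 : ℝ) < Fintype.card J := by exact_mod_cast hJ
    positivity
  nlinarith

/-! ### Staircases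

A staircase is given by a list of pairs `(a, b)`, the sides of consecutive rectangles of lattice
points. -/

/-- The number of steps of a lattice path along the staircase. -/
def stairLength : List (ℕ × ℕ) → ℕ
  | [] => 0
  | (a, b) :: L => a + b + stairLength L

/-- Total width of a staircase. -/
def stairWidth : List (ℕ × ℕ) → ℕ
  | [] => 0
  | (a, _) :: L => a + stairWidth L

/-- The lattice paths through all corners of the staircase, each given by the set of the times of its
horizontal steps. The first step has time `s`. -/
def stairPaths : ℕ → List (ℕ × ℕ) → Finset (Finset ℕ)
  | _, [] => {∅}
  | s, (a, b) :: L => (Finset.powersetCard a (Finset.Ico s (s + (a + b))) ×ˢ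
      stairPaths (s + (a + b)) L).image fun p => p.1 ∪ p.2

/-- The points of the rectangles of the staircase that starts in `(x, y)`. -/
def InStair : ℕ → ℕ → List (ℕ × ℕ) → ℕ → ℕ → Prop
  | x, y, [], p, q => p = x ∧ q = y
  | x, y, (a, b) :: L, p, q =>
      (p ∈ Finset.Icc x (x + a) ∧ q ∈ Finset.Icc y (y + b)) ∨ InStair (x + a) (y + b) L p q

/-- An upper bound for the number of pairs of subsets of two `m`-sets whose sizes are in a
staircase. -/
def stairWeight (m : ℕ) : ℕ → ℕ → List (ℕ × ℕ) → ℕ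
  | x, y, [] => m.choose x * m.choose y
  | x, y, (a, b) :: L => (∑ p ∈ Finset.Icc x (x + a), m.choose p) *
      (∑ q ∈ Finset.Icc y (y + b), m.choose q) + stairWeight m (x + a) (y + b) L

/-- The number of lattice paths through all corners of a staircase. -/
def stairCount : List (ℕ × ℕ) → ℕ
  | [] => 1
  | (a, b) :: L => (a + b).choose a * stairCount L

theorem stairPaths_subset {L : List (ℕ × ℕ)} : ∀ {s : ℕ} {W : Finset ℕ}, W ∈ stairPaths s L →
    W ⊆ Finset.Ico s (s + stairLength L) := by
  induction L with
  | nil => intro s W h; simp_all [stairPaths]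
  | cons c L ih =>
    obtain ⟨a, b⟩ := c
    intro s W h
    simp only [stairPaths, Finset.mem_image, Finset.mem_product, Finset.mem_powersetCard,
      Prod.exists] at h
    obtain ⟨U, V, ⟨⟨hU, -⟩, hV⟩, rfl⟩ := h
    refine Finset.union_subset (hU.trans ?_) ((ih hV).trans ?_) <;>
    · rw [stairLength]
      refine Finset.Ico_subset_Ico ?_ ?_ <;> omega

/-- Different rectangles use disjoint time intervals, so the pieces of a path can be recovered from
their union. -/
theorem stairPaths_card {L : List (ℕ × ℕ)} : ∀ {s : ℕ}, (stairPaths s L).card = stairCount L := by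
  induction L with
  | nil => intro s; simp [stairPaths, stairCount]
  | cons c L ih =>
    obtain ⟨a, b⟩ := c
    intro s
    rw [stairPaths, Finset.card_image_of_injOn, Finset.card_product, ih,
      Finset.card_powersetCard, Nat.card_Ico, Nat.add_sub_cancel_left, stairCount]
    rintro ⟨U, V⟩ h ⟨U', V'⟩ h' heq
    simp only [Finset.coe_product, Set.mem_prod, Finset.mem_coe, Finset.mem_powersetCard] at h h' heq
    have hV := stairPaths_subset h.2
    have hV' := stairPaths_subset h'.2
    have hm : ∀ t, t ∈ U ∨ t ∈ V ↔ t ∈ U' ∨ t ∈ V' := fun t => by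
      rw [← Finset.mem_union, ← Finset.mem_union, heq]
    have hU1 : ∀ t ∈ U, t < s + (a + b) := fun t ht => (Finset.mem_Ico.1 (h.1.1 ht)).2
    have hU1' : ∀ t ∈ U', t < s + (a + b) := fun t ht => (Finset.mem_Ico.1 (h'.1.1 ht)).2
    have hV1 : ∀ t ∈ V, s + (a + b) ≤ t := fun t ht => (Finset.mem_Ico.1 (hV ht)).1
    have hV1' : ∀ t ∈ V', s + (a + b) ≤ t := fun t ht => (Finset.mem_Ico.1 (hV' ht)).1
    refine Prod.ext ?_ ?_
    · ext t
      constructor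
      · intro ht
        rcases (hm t).1 (.inl ht) with h1 | h1
        · exact h1
        · have := hU1 t ht; have := hV1' t h1; omega
      · intro ht
        rcases (hm t).2 (.inl ht) with h1 | h1
        · exact h1
        · have := hU1' t ht; have := hV1 t h1; omega
    · ext t
      constructor
      · intro ht
        rcases (hm t).1 (.inr ht) with h1 | h1
        · have := hV1 t ht; have := hU1' t h1; omega
        · exact h1
      · intro ht
        rcases (hm t).2 (.inr ht) with h1 | h1
        · have := hV1' t ht; have := hU1 t h1; omega
        · exact h1

/-- The position at time `i` is given by the numbers of horizontal and vertical steps so far. Within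
the time interval of a rectangle there are exactly `a` horizontal and `b` vertical steps, so the
path cannot leave it. -/
theorem stairPaths_inStair {L : List (ℕ × ℕ)} : ∀ {s x y i : ℕ} {W : Finset ℕ},
    W ∈ stairPaths s L → s ≤ i → i ≤ s + stairLength L → (W.filter (· < i)).card ≤ i - s ∧
      InStair x y L (x + (W.filter (· < i)).card) (y + (i - s - (W.filter (· < i)).card)) := by
  induction L with
  | nil =>
    intro s x y i W h h1 h2
    simp only [stairPaths, Finset.mem_singleton] at h
    simp only [stairLength] at h2
    have h3 : i - s = 0 := by omega
    simp [h, InStair, h3]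
  | cons c L ih =>
    obtain ⟨a, b⟩ := c
    intro s x y i W h h1 h2
    simp only [stairPaths, Finset.mem_image, Finset.mem_product, Finset.mem_powersetCard,
      Prod.exists] at h
    obtain ⟨U, V, ⟨⟨hU, hUa⟩, hV⟩, rfl⟩ := h
    have hV' := stairPaths_subset hV
    simp only [stairLength] at h2
    rcases Nat.lt_or_ge i (s + (a + b)) with hi | hi
    · have hf : (U ∪ V).filter (· < i) = U.filter (· < i) := by
        rw [Finset.filter_union, Finset.union_eq_left]
        intro t ht
        have h3 := Finset.mem_filter.1 ht
        have h4 := (Finset.mem_Ico.1 (hV' h3.1)).1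
        omega
      rw [hf]
      have hca : (U.filter (· < i)).card ≤ a := hUa ▸ Finset.card_filter_le _ _
      have hsub : U.filter (· < i) ⊆ Finset.Ico s i := fun t ht => by
        have h3 := Finset.mem_filter.1 ht
        exact Finset.mem_Ico.2 ⟨(Finset.mem_Ico.1 (hU h3.1)).1, h3.2⟩
      have hci : (U.filter (· < i)).card ≤ i - s := by
        simpa using Finset.card_le_card hsub
      -- The missing horizontal steps must fit into the remaining time; equivalently, at most `b`
      -- steps so far were vertical.
      have hcb : a ≤ (U.filter (· < i)).card + (s + (a + b) - i) := by
        have h3 : U ⊆ U.filter (· < i) ∪ Finset.Ico i (s + (a + b)) := fun t ht => by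
          rw [Finset.mem_union, Finset.mem_filter, Finset.mem_Ico]
          have := (Finset.mem_Ico.1 (hU ht)).2
          rcases Nat.lt_or_ge t i with h | h
          · exact .inl ⟨ht, h⟩
          · exact .inr ⟨h, this⟩
        have h4 := (Finset.card_le_card h3).trans (Finset.card_union_le _ _)
        rwa [hUa, Nat.card_Ico] at h4
      refine ⟨hci, .inl ⟨Finset.mem_Icc.2 ?_, Finset.mem_Icc.2 ?_⟩⟩ <;> omega
    · have hf : ((U ∪ V).filter (· < i)).card = a + (V.filter (· < i)).card := by
        have hfU : U.filter (· < i) = U := Finset.filter_true_of_mem fun t ht => by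
          have := (Finset.mem_Ico.1 (hU ht)).2; omega
        rw [Finset.filter_union, hfU, Finset.card_union_of_disjoint, hUa]
        rw [Finset.disjoint_left]
        intro t ht ht'
        have h3 := (Finset.mem_Ico.1 (hU ht)).2
        have h4 := (Finset.mem_Ico.1 (hV' (Finset.mem_filter.1 ht').1)).1
        omega
      obtain ⟨h3, h4⟩ := ih (x := x + a) (y := y + b) (i := i) hV hi (by omega)
      rw [hf]
      refine ⟨by omega, .inr ?_⟩
      have e1 : x + (a + (V.filter (· < i)).card) = x + a + (V.filter (· < i)).card := by omega
      have e2 : y + (i - s - (a + (V.filter (· < i)).card)) =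
          y + b + (i - (s + (a + b)) - (V.filter (· < i)).card) := by omega
      rw [e1, e2]
      exact h4

theorem stairPaths_card_mem {L : List (ℕ × ℕ)} : ∀ {s : ℕ} {W : Finset ℕ}, W ∈ stairPaths s L →
    W.card = stairWidth L := by
  induction L with
  | nil => intro s W h; simp_all [stairPaths, stairWidth]
  | cons c L ih =>
    obtain ⟨a, b⟩ := c
    intro s W h
    simp only [stairPaths, Finset.mem_image, Finset.mem_product, Finset.mem_powersetCard,
      Prod.exists] at h
    obtain ⟨U, V, ⟨⟨hU, hUa⟩, hV⟩, rfl⟩ := h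
    rw [Finset.card_union_of_disjoint, hUa, ih hV, stairWidth]
    rw [Finset.disjoint_left]
    intro t ht ht'
    have h3 := (Finset.mem_Ico.1 (hU ht)).2
    have h4 := (Finset.mem_Ico.1 (stairPaths_subset hV ht')).1
    omega

theorem card_powerset_filter {α : Type*} (T : Finset α) (I : Finset ℕ) :
    (T.powerset.filter (fun P => P.card ∈ I)).card = ∑ p ∈ I, T.card.choose p := by
  rw [Finset.card_eq_sum_card_fiberwise (f := Finset.card) (t := I) fun P hP => by
    simpa using (Finset.mem_filter.1 hP).2]
  refine Finset.sum_congr rfl fun p hp => ?_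
  rw [← Finset.card_powersetCard, Finset.filter_filter]
  congr 1
  ext P
  simp only [Finset.mem_filter, Finset.mem_powerset, Finset.mem_powersetCard]
  constructor
  · exact fun h => ⟨h.1, h.2.2⟩
  · exact fun h => ⟨h.1, h.2 ▸ hp, h.2⟩

theorem card_inStair_le {α : Type*} {m : ℕ} {T U : Finset α} (hT : T.card = m) (hU : U.card = m)
    {L : List (ℕ × ℕ)} : ∀ {x y : ℕ} {S : Finset (Finset α × Finset α)},
      (∀ P ∈ S, P.1 ⊆ T ∧ P.2 ⊆ U ∧ InStair x y L P.1.card P.2.card) →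
      S.card ≤ stairWeight m x y L := by
  classical
  have rect : ∀ (I J : Finset ℕ) (S : Finset (Finset α × Finset α)),
      (∀ P ∈ S, P.1 ⊆ T ∧ P.2 ⊆ U ∧ P.1.card ∈ I ∧ P.2.card ∈ J) → S.card ≤
      (∑ p ∈ I, m.choose p) * (∑ q ∈ J, m.choose q) := by
    intro I J S hS
    have : S ⊆ T.powerset.filter (fun P => P.card ∈ I) ×ˢ
        U.powerset.filter (fun P => P.card ∈ J) := fun P hP => by
      obtain ⟨h1, h2, h3, h4⟩ := hS P hP
      simp only [Finset.mem_product, Finset.mem_filter, Finset.mem_powerset]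
      exact ⟨⟨h1, h3⟩, h2, h4⟩
    refine (Finset.card_le_card this).trans_eq ?_
    rw [Finset.card_product, card_powerset_filter, card_powerset_filter, hT, hU]
  induction L with
  | nil =>
    intro x y S hS
    have := rect {x} {y} S fun P hP => by
      obtain ⟨h1, h2, h3, h4⟩ := hS P hP
      exact ⟨h1, h2, Finset.mem_singleton.2 h3, Finset.mem_singleton.2 h4⟩
    simpa [stairWeight] using this
  | cons c L ih =>
    obtain ⟨a, b⟩ := c
    intro x y S hS
    rw [stairWeight, ← Finset.card_filter_add_card_filter_not
      (fun P : Finset α × Finset α => P.1.card ∈ Finset.Icc x (x + a) ∧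
        P.2.card ∈ Finset.Icc y (y + b))]
    refine Nat.add_le_add (rect _ _ _ fun P hP => ?_) (ih fun P hP => ?_)
    · obtain ⟨h1, h2⟩ := Finset.mem_filter.1 hP
      exact ⟨(hS P h1).1, (hS P h1).2.1, h2⟩
    · obtain ⟨h1, h2⟩ := Finset.mem_filter.1 hP
      obtain ⟨h3, h4, h5⟩ := hS P h1
      exact ⟨h3, h4, h5.resolve_left h2⟩

/-! ### The set family of a staircase -/

section
variable {k m z : ℕ} {L : List (ℕ × ℕ)}

/-- The elements whose place in the order `σ` satisfies `P`. -/
def placed (σ : Equiv.Perm (Fin k)) (P : ℕ → Prop) [DecidablePred P] : Finset (Fin k) :=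
  Finset.univ.filter fun e => P (σ.symm e).val

theorem mem_placed {σ : Equiv.Perm (Fin k)} {P : ℕ → Prop} [DecidablePred P] {e : Fin k} :
    e ∈ placed σ P ↔ P (σ.symm e).val := by
  simp [placed]

theorem card_placed (σ : Equiv.Perm (Fin k)) (P : ℕ → Prop) [DecidablePred P] :
    (placed σ P).card = ((Finset.range k).filter P).card := by
  rw [← Finset.card_map (σ.symm.toEmbedding.trans Fin.valEmbedding)]
  congr 1
  ext p
  simp only [Finset.mem_map, mem_placed, Finset.mem_filter, Finset.mem_range]
  constructor
  · rintro ⟨e, he, rfl⟩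
    exact ⟨(σ.symm e).2, he⟩
  · rintro ⟨hp, hP⟩
    exact ⟨σ ⟨p, hp⟩, by simpa using hP, by simp⟩

open Classical in
/-- The sets that are reached from a staircase `L` with sides `T` and the rest, after the elements of
`ρ` have been added one by one. -/
noncomputable def stairFamily (L : List (ℕ × ℕ)) (j : (Fin z → Fin k) × Finset (Fin k)) :
    Finset (Finset (Fin k)) :=
  (Finset.univ.image fun i : Fin z => (Finset.univ.filter (· < i)).image j.1) ∪
    Finset.univ.filter fun A => Finset.univ.image j.1 ⊆ A ∧
      InStair 0 0 L (A ∩ j.2).card (A ∩ (j.2 ∪ Finset.univ.image j.1)ᶜ).card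

/-- A set that contains all of ρ is determined by its traces on the two sides; the summand `z`
counts the shorter prefixes of ρ. -/
theorem stairFamily_card_le {j : (Fin z → Fin k) × Finset (Fin k)} (hT : j.2.card = m)
    (hU : (j.2 ∪ Finset.univ.image j.1)ᶜ.card = m) :
    (stairFamily L j).card ≤ z + stairWeight m 0 0 L := by
  classical
  refine (Finset.card_union_le _ _).trans (Nat.add_le_add ?_ ?_)
  · exact Finset.card_image_le.trans (by simp)
  · rw [← Finset.card_image_of_injOn
      (f := fun A => (A ∩ j.2, A ∩ (j.2 ∪ Finset.univ.image j.1)ᶜ))]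
    · refine card_inStair_le hT hU fun P hP => ?_
      obtain ⟨A, hA, rfl⟩ := Finset.mem_image.1 hP
      exact ⟨Finset.inter_subset_right, Finset.inter_subset_right, (Finset.mem_filter.1 hA).2.2⟩
    · intro A hA B hB h
      have hA' := (Finset.mem_filter.1 (Finset.mem_coe.1 hA)).2.1
      have hB' := (Finset.mem_filter.1 (Finset.mem_coe.1 hB)).2.1
      obtain ⟨h1, h2⟩ := Prod.ext_iff.1 h
      ext e
      have e1 := Finset.ext_iff.1 h1 e
      have e2 := Finset.ext_iff.1 h2 e
      simp only [Finset.mem_inter, Finset.mem_compl, Finset.mem_union] at e1 e2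
      by_cases hR : e ∈ Finset.univ.image j.1
      · exact ⟨fun _ => hB' hR, fun _ => hA' hR⟩
      · tauto

/-- `j` consists of the first elements of the order `σ` and the elements at the places in `W`, for
a path `W` in the staircase. -/
def Follows (L : List (ℕ × ℕ)) (σ : Equiv.Perm (Fin k))
    (j : (Fin z → Fin k) × Finset (Fin k)) : Prop :=
  (∀ i, (σ.symm (j.1 i)).val = i.val) ∧ ∃ W ∈ stairPaths z L, j.2 = placed σ (· ∈ W)

theorem Follows.image_eq {σ : Equiv.Perm (Fin k)} {j : (Fin z → Fin k) × Finset (Fin k)}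
    (h : ∀ i, (σ.symm (j.1 i)).val = i.val) (i : Fin z) :
    (Finset.univ.filter (· < i)).image j.1 = placed σ (· < i.val) := by
  ext e
  simp only [Finset.mem_image, Finset.mem_filter, Finset.mem_univ, true_and, mem_placed]
  constructor
  · rintro ⟨l, hl, rfl⟩
    rw [h l]; exact hl
  · intro he
    refine ⟨⟨(σ.symm e).val, he.trans i.2⟩, he, ?_⟩
    apply σ.symm.injective
    exact Fin.ext (h _)

theorem Follows.image_univ_eq {σ : Equiv.Perm (Fin k)} {j : (Fin z → Fin k) × Finset (Fin k)}
    (h : ∀ i, (σ.symm (j.1 i)).val = i.val) :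
    Finset.univ.image j.1 = placed σ (· < z) := by
  ext e
  simp only [Finset.mem_image, Finset.mem_univ, true_and, mem_placed]
  constructor
  · rintro ⟨l, rfl⟩
    rw [h l]; exact l.2
  · intro he
    refine ⟨⟨(σ.symm e).val, he⟩, ?_⟩
    apply σ.symm.injective
    exact Fin.ext (h _)

theorem card_placed_inter (W : Finset ℕ) (σ : Equiv.Perm (Fin k)) {i : ℕ} (hi : i ≤ k) :
    (placed σ (· < i) ∩ placed σ (· ∈ W)).card = (W.filter (· < i)).card := by
  have : placed σ (· < i) ∩ placed σ (· ∈ W) = placed σ (fun p => p < i ∧ p ∈ W) := by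
    ext e; simp [mem_placed]
  rw [this, card_placed]
  congr 1
  ext p
  simp only [Finset.mem_filter, Finset.mem_range]
  constructor
  · rintro ⟨-, h1, h2⟩
    exact ⟨h2, h1⟩
  · rintro ⟨h1, h2⟩
    exact ⟨by omega, h2, h1⟩

theorem card_placed_inter_compl (hk : k = z + stairLength L) {W : Finset ℕ}
    (hW : W ∈ stairPaths z L) (σ : Equiv.Perm (Fin k)) {i : ℕ} (hi : i ≤ k) :
    (placed σ (· < i) ∩ (placed σ (· ∈ W) ∪ placed σ (· < z))ᶜ).card =
      i - z - (W.filter (· < i)).card := by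
  have hs := stairPaths_subset hW
  have : placed σ (· < i) ∩ (placed σ (· ∈ W) ∪ placed σ (· < z))ᶜ =
      placed σ (fun p => p < i ∧ ¬ (p ∈ W ∨ p < z)) := by
    ext e; simp [mem_placed]
  rw [this, card_placed]
  have h2 : (Finset.range k).filter (fun p => p < i ∧ ¬ (p ∈ W ∨ p < z)) =
      Finset.Ico z i \ W.filter (· < i) := by
    ext p
    simp only [Finset.mem_filter, Finset.mem_range, Finset.mem_sdiff, Finset.mem_Ico]
    constructor
    · rintro ⟨-, h1, h2⟩
      push Not at h2
      exact ⟨⟨h2.2, h1⟩, fun h => h2.1 h.1⟩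
    · rintro ⟨⟨h1, h2⟩, h3⟩
      refine ⟨by omega, h2, ?_⟩
      rintro (h | h)
      · exact h3 ⟨h, h2⟩
      · omega
  rw [h2, Finset.card_sdiff_of_subset, Nat.card_Ico]
  intro t ht
  have h3 := Finset.mem_filter.1 ht
  exact Finset.mem_Ico.2 ⟨(Finset.mem_Ico.1 (hs h3.1)).1, h3.2⟩

/-- Up to place `z` the initial segment is a prefix of ρ; from then on its two trace sizes are the
coordinates of a point on the path `W`. -/
theorem Follows.mem_stairFamily (hk : k = z + stairLength L) {σ : Equiv.Perm (Fin k)}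
    {j : (Fin z → Fin k) × Finset (Fin k)} (h : Follows L σ j) {i : ℕ} (hi : i ≤ k) :
    placed σ (· < i) ∈ stairFamily L j := by
  classical
  obtain ⟨hρ, W, hW, hT⟩ := h
  rw [stairFamily, Finset.mem_union]
  rcases Nat.lt_or_ge i z with hz | hz
  · refine .inl (Finset.mem_image.2 ⟨⟨i, hz⟩, Finset.mem_univ _, ?_⟩)
    convert Follows.image_eq hρ ⟨i, hz⟩
  · refine .inr (Finset.mem_filter.2 ⟨Finset.mem_univ _, ?_, ?_⟩)
    · intro e he
      obtain ⟨l, -, rfl⟩ := Finset.mem_image.1 he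
      rw [mem_placed, hρ]
      exact l.2.trans_le hz
    · have h1 := (stairPaths_inStair (x := 0) (y := 0) hW hz (hk ▸ hi)).2
      rw [Nat.zero_add, Nat.zero_add] at h1
      have h2 := card_placed_inter W σ hi
      have h3 := card_placed_inter_compl hk hW σ hi
      have h4 := Follows.image_univ_eq hρ
      rw [hT]
      convert h1 using 1
      rw [← h3, ← h4]

theorem Follows.stairFamily_card_le (hk : k = z + stairLength L) (hw : stairWidth L = m)
    (hl : stairLength L = 2 * m) {σ : Equiv.Perm (Fin k)}
    {j : (Fin z → Fin k) × Finset (Fin k)} (h : Follows L σ j) :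
    (stairFamily L j).card ≤ z + stairWeight m 0 0 L := by
  obtain ⟨hρ, W, hW, hT⟩ := h
  have hf : W.filter (· < k) = W := Finset.filter_true_of_mem fun p hp =>
    hk ▸ (Finset.mem_Ico.1 (stairPaths_subset hW hp)).2
  have hu : placed σ (· < k) = Finset.univ := by
    ext e; simp [mem_placed]
  have hWm := (stairPaths_card_mem hW).trans hw
  apply TSP.stairFamily_card_le
  · have := card_placed_inter W σ le_rfl
    rw [hf, hu, Finset.univ_inter, hWm, ← hT] at this
    exact this
  · have := card_placed_inter_compl hk hW σ le_rfl
    rw [hf, hu, Finset.univ_inter, hWm, ← hT, ← Follows.image_univ_eq hρ] at this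
    rw [this]
    omega

/-- The order forces ρ, and each lattice path yields its own side, namely the elements placed at the
horizontal steps. -/
theorem exists_follows (hk : k = z + stairLength L) (σ : Equiv.Perm (Fin k)) :
    ∃ S : Finset ((Fin z → Fin k) × Finset (Fin k)), stairCount L ≤ S.card ∧
      ∀ j ∈ S, Follows L σ j := by
  classical
  have hzk : z ≤ k := by omega
  refine ⟨(stairPaths z L).image fun W => (fun i => σ (Fin.castLE hzk i), placed σ (· ∈ W)), ?_, ?_⟩
  · rw [Finset.card_image_of_injOn, stairPaths_card]
    intro W hW W' hW' h
    have h2 := Finset.ext_iff.1 (Prod.ext_iff.1 h).2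
    have hs := stairPaths_subset (Finset.mem_coe.1 hW)
    have hs' := stairPaths_subset (Finset.mem_coe.1 hW')
    ext p
    constructor
    · intro hp
      have hpk : p < k := hk ▸ (Finset.mem_Ico.1 (hs hp)).2
      have := (h2 (σ ⟨p, hpk⟩)).1 (mem_placed.2 (by simpa using hp))
      simpa [mem_placed] using this
    · intro hp
      have hpk : p < k := hk ▸ (Finset.mem_Ico.1 (hs' hp)).2
      have := (h2 (σ ⟨p, hpk⟩)).2 (mem_placed.2 (by simpa using hp))
      simpa [mem_placed] using this
  · intro j hj
    obtain ⟨W, hW, rfl⟩ := Finset.mem_image.1 hj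
    exact ⟨fun i => by simp, W, hW, rfl⟩

/-- Sublevel sets of a function are initial segments of the order that sorts it. -/
theorem exists_sublevel_eq (f : ℕ → ℕ) :
    ∃ σ : Equiv.Perm (Fin k), ∀ t, ∃ i ≤ k,
      (Finset.range k).filter (fun e => f e < t) = (placed σ (· < i)).map Fin.valEmbedding := by
  refine ⟨Tuple.sort (fun e : Fin k => f e), fun t => ?_⟩
  set σ := Tuple.sort (fun e : Fin k => f e)
  have hmono : Monotone (fun p => f (σ p)) := Tuple.monotone_sort (fun e : Fin k => f e)
  -- The least such `i` is the first place in sorted order with value at least `t`, or `k` if there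
  -- is none.
  have hex : ∃ i, ∀ h : i < k, t ≤ f (σ ⟨i, h⟩) := ⟨k, fun h => absurd h (lt_irrefl k)⟩
  classical
  have hlt : ∀ p : Fin k, f (σ p) < t ↔ p.val < Nat.find hex := by
    intro p
    constructor
    · intro hp
      by_contra hcon
      push Not at hcon
      have h1 : Nat.find hex < k := hcon.trans_lt p.2
      have h2 := Nat.find_spec hex h1
      have h3 : f (σ ⟨Nat.find hex, h1⟩) ≤ f (σ p) := hmono (show ⟨Nat.find hex, h1⟩ ≤ p from hcon)
      omega
    · intro hp
      have h1 := Nat.find_min hex hp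
      push Not at h1
      obtain ⟨h2, h3⟩ := h1
      exact h3
  refine ⟨Nat.find hex, Nat.find_min' hex fun h => absurd h (lt_irrefl k), ?_⟩
  ext e
  simp only [Finset.mem_filter, Finset.mem_range, Finset.mem_map, mem_placed]
  constructor
  · rintro ⟨h1, h2⟩
    refine ⟨⟨e, h1⟩, ?_, rfl⟩
    rw [← hlt, Equiv.apply_symm_apply]
    exact h2
  · rintro ⟨e', h1, rfl⟩
    refine ⟨e'.2, ?_⟩
    rw [← hlt, Equiv.apply_symm_apply] at h1
    exact h1

theorem exists_family_of_staircase {ls lN K : ℕ} (hk : k = z + stairLength L)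
    (hw : stairWidth L = m) (hl : stairLength L = 2 * m) (hk0 : 0 < k)
    (hweight : z + stairWeight m 0 0 L ≤ 2 ^ ls - 2) (hK : k ^ k < 2 ^ K)
    (hcount : k ^ z * 2 ^ k * K ≤ 2 ^ lN * stairCount L) :
    ∃ F : ℕ → Finset (Finset ℕ), (∀ j, (F j).card ≤ 2 ^ ls - 2) ∧
      ∀ f : ℕ → ℕ, Set.InjOn f (Set.Iio k) → ∃ j < 2 ^ lN,
        ∀ t, (Finset.range k).filter (fun e => f e < t) ∈ F j := by
  classical
  have : Nonempty (Fin k) := ⟨⟨0, hk0⟩⟩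
  obtain ⟨h, hh⟩ := exists_hitting (O := Equiv.Perm (Fin k))
    (J := (Fin z → Fin k) × Finset (Fin k)) (Follows L) (G := stairCount L) (N := 2 ^ lN) (K := K)
    (exists_follows hk) (by simpa using hcount) (by
      rw [Fintype.card_perm, Fintype.card_fin]
      exact (Nat.factorial_le_pow k).trans_lt hK)
  -- Pairs with sides of the wrong size may give oversized families, which are replaced by the empty
  -- one. A pair followed by some order is not affected, by `Follows.stairFamily_card_le`.
  refine ⟨fun j => if hj : j < 2 ^ lN then
    if (stairFamily L (h ⟨j, hj⟩)).card ≤ 2 ^ ls - 2 then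
      (stairFamily L (h ⟨j, hj⟩)).image (Finset.map Fin.valEmbedding) else ∅ else ∅, ?_, ?_⟩
  · intro j
    dsimp only
    split_ifs with h1 h2
    · exact Finset.card_image_le.trans h2
    · simp
    · simp
  · intro f _
    obtain ⟨σ, hσ⟩ := exists_sublevel_eq (k := k) f
    obtain ⟨j, hj⟩ := hh σ
    refine ⟨j, j.2, fun t => ?_⟩
    obtain ⟨i, hi, hi'⟩ := hσ t
    dsimp only
    rw [dif_pos j.2, if_pos ((hj.stairFamily_card_le hk hw hl).trans hweight), hi']
    exact Finset.mem_image_of_mem _ (hj.mem_stairFamily hk hi)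

end

/-! ### Binomial tails -/

/-- The Chernoff bound without logarithms: expand $m^m=(a+(m-a))^m$ and keep the terms with $q\in
I$, whose weights are at least the weight at $q=a$. -/
theorem sum_choose_mul_le {m a : ℕ} (ha : a ≤ m) {I : Finset ℕ}
    (hI : ∀ q ∈ I, q ≤ m ∧ a ^ a * (m - a) ^ (m - a) ≤ a ^ q * (m - a) ^ (m - q)) :
    (∑ q ∈ I, m.choose q) * (a ^ a * (m - a) ^ (m - a)) ≤ m ^ m := by
  calc (∑ q ∈ I, m.choose q) * (a ^ a * (m - a) ^ (m - a))
      ≤ ∑ q ∈ I, a ^ q * (m - a) ^ (m - q) * m.choose q := by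
        rw [Finset.sum_mul]
        refine Finset.sum_le_sum fun q hq => ?_
        rw [mul_comm]
        exact Nat.mul_le_mul_right _ (hI q hq).2
    _ ≤ ∑ q ∈ Finset.range (m + 1), a ^ q * (m - a) ^ (m - q) * m.choose q :=
        Finset.sum_le_sum_of_subset fun q hq => Finset.mem_range.2 (Nat.lt_succ_of_le (hI q hq).1)
    _ = (a + (m - a)) ^ m := (add_pow a (m - a) m).symm
    _ = m ^ m := by rw [Nat.add_sub_cancel' ha]

/-- Chernoff bound for the lower tail. -/
theorem sum_choose_lower {m b : ℕ} (hb : 2 * b ≤ m) (a : ℕ) :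
    (∑ q ∈ Finset.Icc a b, m.choose q) * (b ^ b * (m - b) ^ (m - b)) ≤ m ^ m := by
  refine sum_choose_mul_le (by omega) fun q hq => ?_
  obtain ⟨-, hqb⟩ := Finset.mem_Icc.1 hq
  refine ⟨by omega, ?_⟩
  obtain ⟨d, rfl⟩ := Nat.exists_eq_add_of_le hqb
  have : m - q = d + (m - (q + d)) := by omega
  rw [this, pow_add, pow_add, mul_assoc]
  gcongr
  omega

/-- Chernoff bound for the upper tail. -/
theorem sum_choose_upper {m a b : ℕ} (ha : m ≤ 2 * a) (ham : a ≤ m) (hbm : b ≤ m) :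
    (∑ q ∈ Finset.Icc a b, m.choose q) * (a ^ a * (m - a) ^ (m - a)) ≤ m ^ m := by
  refine sum_choose_mul_le ham fun q hq => ?_
  obtain ⟨haq, hqb⟩ := Finset.mem_Icc.1 hq
  refine ⟨by omega, ?_⟩
  obtain ⟨d, rfl⟩ := Nat.exists_eq_add_of_le haq
  have : m - a = d + (m - (a + d)) := by omega
  calc a ^ a * (m - a) ^ (m - a) = a ^ a * ((m - a) ^ d * (m - a) ^ (m - (a + d))) := by
        rw [← pow_add, ← this]
    _ ≤ a ^ a * (a ^ d * (m - a) ^ (m - (a + d))) := by gcongr; omega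
    _ = a ^ (a + d) * (m - a) ^ (m - (a + d)) := by rw [pow_add]; ring

/-- The corner $(x,y)$ is the one closest to the centre in both coordinates, so the two tail bounds
are taken there; `h` is what remains to be checked numerically. -/
theorem rectangle_le {m x y : ℕ} (hx : m ≤ 2 * x) (hxm : x < m) (hy : 2 * y ≤ m) (hy0 : 0 < y)
    (h : 4 * (m ^ m * m ^ m) ≤
      2 ^ m * ((x ^ x * (m - x) ^ (m - x)) * (y ^ y * (m - y) ^ (m - y))))
    (a b : ℕ) (hb : b ≤ m) :
    4 * ((∑ p ∈ Finset.Icc x b, m.choose p) * ∑ q ∈ Finset.Icc a y, m.choose q) ≤ 2 ^ m := by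
  have h1 := sum_choose_upper hx hxm.le hb
  have h2 := sum_choose_lower hy a
  have hpos : 0 < (x ^ x * (m - x) ^ (m - x)) * (y ^ y * (m - y) ^ (m - y)) := by
    have : 0 < m - x := by omega
    have : 0 < m - y := by omega
    have : 0 < x := by omega
    positivity
  refine Nat.le_of_mul_le_mul_right ?_ hpos
  refine le_trans ?_ h
  calc _ = 4 * (((∑ p ∈ Finset.Icc x b, m.choose p) * (x ^ x * (m - x) ^ (m - x))) *
        ((∑ q ∈ Finset.Icc a y, m.choose q) * (y ^ y * (m - y) ^ (m - y)))) := by ring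
    _ ≤ _ := by gcongr

theorem sum_choose_le_two_pow {m a b : ℕ} (hb : b ≤ m) :
    ∑ p ∈ Finset.Icc a b, m.choose p ≤ 2 ^ m := by
  rw [← Nat.sum_range_choose]
  refine Finset.sum_le_sum_of_subset fun p hp => ?_
  have := (Finset.mem_Icc.1 hp).2
  exact Finset.mem_range.2 (by omega)

theorem first_segment_le {m b : ℕ} (hb : b ≤ m) :
    4 * ((∑ p ∈ Finset.Icc 0 b, m.choose p) * ∑ q ∈ Finset.Icc 0 0, m.choose q) ≤ 4 * 2 ^ m := by
  rw [Finset.Icc_self, Finset.sum_singleton, Nat.choose_zero_right, mul_one]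
  exact Nat.mul_le_mul_left 4 (sum_choose_le_two_pow hb)

theorem last_segment_le (m a : ℕ) :
    4 * ((∑ p ∈ Finset.Icc m m, m.choose p) * ∑ q ∈ Finset.Icc a m, m.choose q) ≤ 4 * 2 ^ m := by
  rw [Finset.Icc_self, Finset.sum_singleton, Nat.choose_self, one_mul]
  exact Nat.mul_le_mul_left 4 (sum_choose_le_two_pow le_rfl)

/-- A staircase with four rectangles. -/
def stairs : List (ℕ × ℕ) := [(731, 0), (110, 23), (78, 47), (53, 73), (28, 108), (0, 749)]

theorem stairWeight_cons_le {m x y a b x' y' c d : ℕ} {L : List (ℕ × ℕ)} (hx : x + a = x')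
    (hy : y + b = y')
    (hc : 4 * ((∑ p ∈ Finset.Icc x x', m.choose p) * ∑ q ∈ Finset.Icc y y', m.choose q) ≤ c)
    (hd : 4 * stairWeight m x' y' L ≤ d) : 4 * stairWeight m x y ((a, b) :: L) ≤ c + d := by
  subst hx hy
  rw [stairWeight]
  omega

-- The corners are $(731,0)$, $(841,23)$, $(919,70)$, $(972,143)$, $(1000,251)$. Each of the four
-- proper rectangles contributes at most $2^{1000}/4$, each of the two degenerate segments at most
-- $2^{1000}$, and the end point $1$: altogether $3\cdot2^{1000}+1$. The four elements of ρ make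
-- $k/2=m+2$ and so provide the room $2^{1002}=4\cdot2^{1000}$.
set_option exponentiation.threshold 3000 in
theorem stairWeight_stairs : 4 + stairWeight 1000 0 0 stairs ≤ 2 ^ 1002 - 2 := by
  have h1 := rectangle_le (m := 1000) (x := 731) (y := 23) (by norm_num) (by norm_num)
    (by norm_num) (by norm_num) (by decide +kernel) 0 841 (by norm_num)
  have h2 := rectangle_le (m := 1000) (x := 841) (y := 70) (by norm_num) (by norm_num)
    (by norm_num) (by norm_num) (by decide +kernel) 23 919 (by norm_num)
  have h3 := rectangle_le (m := 1000) (x := 919) (y := 143) (by norm_num) (by norm_num)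
    (by norm_num) (by norm_num) (by decide +kernel) 70 972 (by norm_num)
  have h4 := rectangle_le (m := 1000) (x := 972) (y := 251) (by norm_num) (by norm_num)
    (by norm_num) (by norm_num) (by decide +kernel) 143 1000 (by norm_num)
  have h0 := first_segment_le (m := 1000) (b := 731) (by norm_num)
  have h5 := last_segment_le 1000 251
  have h6 : 4 * stairWeight 1000 1000 1000 [] ≤ 4 := by
    rw [stairWeight, Nat.choose_self]
  have h := stairWeight_cons_le (a := 731) (b := 0) (by norm_num) (by norm_num) h0 <|
    stairWeight_cons_le (a := 110) (b := 23) (by norm_num) (by norm_num) h1 <|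
    stairWeight_cons_le (a := 78) (b := 47) (by norm_num) (by norm_num) h2 <|
    stairWeight_cons_le (a := 53) (b := 73) (by norm_num) (by norm_num) h3 <|
    stairWeight_cons_le (a := 28) (b := 108) (by norm_num) (by norm_num) h4 <|
    stairWeight_cons_le (a := 0) (b := 749) (by norm_num) (by norm_num) h5 h6
  have h7 : 2 ^ 1002 = 4 * 2 ^ 1000 := by norm_num
  have h8 : 16 ≤ 2 ^ 1000 := by norm_num
  rw [← stairs] at h
  rw [h7]
  generalize 2 ^ 1000 = M at h h8 ⊢
  omega

-- The count of lattice paths must save a factor $2^{334}=2^{k/6}$ beyond the polynomial losses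
-- $2004^4$ for ρ and $22044$ for the union bound; this is what permits $lN=5k/6$.
set_option exponentiation.threshold 3000 in
theorem stairCount_stairs : 2004 ^ 4 * 2 ^ 2004 * 22044 ≤ 2 ^ 1670 * stairCount stairs := by
  simp only [stairCount, stairs, Nat.choose_eq_descFactorial_div_factorial]
  decide +kernel

set_option exponentiation.threshold 3000 in
theorem pow_lt_stairs : 2004 ^ 2004 < 2 ^ 22044 := by
  calc 2004 ^ 2004 < (2 ^ 11) ^ 2004 := Nat.pow_lt_pow_left (by norm_num) (by norm_num)
    _ = 2 ^ 22044 := by rw [← pow_mul]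

end TSP

/-! ### The numerical conclusion -/

theorem theorem2 :
    ∃ T : ℝ, T < 1.786 * Real.sqrt 2 ∧ Real.sqrt 2 * T < 3.572 ∧
      TSP.Feasible (Real.sqrt 2) T := by
  obtain ⟨F, hF, hcover⟩ := TSP.exists_family_of_staircase (k := 2004) (m := 1000) (z := 4)
    (L := TSP.stairs) (ls := 1002) (lN := 1670) (K := 22044) rfl rfl rfl (by norm_num)
    TSP.stairWeight_stairs TSP.pow_lt_stairs TSP.stairCount_stairs
  have hfeas := TSP.feasible_of_transitions
    (TSP.transitions_of_family (by norm_num) (by norm_num) F hF hcover) (by norm_num) (by norm_num)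
  set u : ℝ := (2 : ℝ) ^ (5 / 6 : ℝ) with hu
  have hu0 : 0 < u := by positivity
  have hu6 : u ^ 6 = 32 := by
    rw [hu, ← Real.rpow_natCast, ← Real.rpow_mul (by norm_num)]
    norm_num
  -- Sixth powers turn this into a comparison of rationals, since $u=2^{5/6}$.
  have hlt : u < 1.786 := by
    refine lt_of_pow_lt_pow_left₀ 6 (by norm_num) ?_
    rw [hu6]
    norm_num
  -- Here $1670/2004=5/6$ and $1002/2004=1/2$.
  have hT : (2 : ℝ) ^ (((1670 + 1002 : ℕ) : ℝ) / ((2004 : ℕ) : ℝ)) = u * Real.sqrt 2 := by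
    rw [hu, Real.sqrt_eq_rpow, ← Real.rpow_add (by norm_num)]
    norm_num
  rw [hT] at hfeas
  have hs : 0 < Real.sqrt 2 := by positivity
  have hs2 : Real.sqrt 2 * Real.sqrt 2 = 2 := Real.mul_self_sqrt (by norm_num)
  refine ⟨u * Real.sqrt 2, by gcongr, ?_, hfeas⟩
  calc Real.sqrt 2 * (u * Real.sqrt 2) = u * (Real.sqrt 2 * Real.sqrt 2) := by ring
    _ < 3.572 := by rw [hs2]; linarith
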